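/- Let $F$ be an algebraically closed field of characteristic zero, let $l,m,n\ge 0$, $\mathbf t=(t_1,\dots,t_l)$, $\mathbf x=(x_1,\dots,x_m)$, $\mathbf y=(y_1,\dots,y_n)$ be indeterminates, and let $q_1,\dots,q_n\in F$ be neither zero nor roots of unity. On $K=F(\mathbf t,\mathbf x,\mathbf y)$ consider the derivations $\delta_i=\partial/\partial t_i$, the shift operators $\sigma_j$ ($x_j\mapsto x_j+1$, the other indeterminates fixed) and the $q$-shift operators $\tau_k$ ($y_k\mapsto q_ky_k$, the other indeterminates fixed). Fix a monomial ordering on $F[\mathbf t,\mathbf x,\mathbf y]$; a nonzero rational function is monic if it is a quotient of two coprime monic polynomials. A $\Delta$-extension of $K$ is a commutative ring $R\supseteq K$ with pairwise commuting derivations $\delta_i$ and ring monomorphisms $\sigma_j,\tau_k$ of $R$ extending those of $K$. Its constants are the $r\in R$ with $\delta_i(r)=0$, $\sigma_j(r)=r$, $\tau_k(r)=r$ for all $i,j,k$. An $H$-solution in $R$ is a nonzero $h\in R$ with $$\delta_i(h)=u_ih,\qquad \sigma_j(h)=v_jh,\qquad \tau_k(h)=w_kh\qquad(1\le i\le l,\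 1\le j\le m,\ 1\le k\le n)$$ for some $u_i,v_j,w_k\in K$ (its certificates) that are compatible, i.e. all $v_j,w_k$ are nonzero and $$\delta_i(u_j)=\delta_j(u_i),\quad \tfrac{\sigma_i(v_j)}{v_j}=\tfrac{\sigma_j(v_i)}{v_i},\quad \tfrac{\tau_i(w_j)}{w_j}=\tfrac{\tau_j(w_i)}{w_i},\quad \tfrac{\delta_i(v_j)}{v_j}=\sigma_j(u_i)-u_i,\quad \tfrac{\delta_i(w_k)}{w_k}=\tau_k(u_i)-u_i,\quad \tfrac{\sigma_j(w_k)}{w_k}=\tfrac{\tau_k(v_j)}{v_j}$$ for all admissible indices. Say that $R$ is of Picard–Vessiot type if its ring of constants is $F$ and every $H$-solution in $R$ is invertible. An $H$-solution is * a symbolic power $\alpha_1^{x_1}\cdots\alpha_m^{x_m}$ if its certificates are $u_i=\sum_{j=1}^m x_j\,\delta_i(\alpha_j)/\alpha_j$, $v_j=\alpha_j$, $w_k=1$ with monic $\alpha_1,\dots,\alpha_m\in F(\mathbf t)\setminus\{0\}$; * an $E$-solution if its certificates are $u_i=\beta_i$, $v_j=1$, $w_k=1$ with $\beta_1,\dots,\beta_l\in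 F(\mathbf t)$; * a $G$-solution if its certificates are $u_i=0$, $v_j=\lambda_j$, $w_k=1$ with $\lambda_1,\dots,\lambda_m\in F(\mathbf x)\setminus\{0\}$; * a $Q$-solution if its certificates are $u_i=0$, $v_j=1$, $w_k=\mu_k$ with $\mu_1,\dots,\mu_n\in F(\mathbf y)\setminus\{0\}$. **Proposition.** Let $R$ be a $\Delta$-extension of $K$ and $h\in R$ an $H$-solution. Then there is a $\Delta$-extension $R'$ of $K$ containing $R$ (with its operators), which can be taken of Picard–Vessiot type if $R$ is, such that in $R'$ $$h=c\,f\,\mathcal P\,\mathcal E\,\mathcal G\,\mathcal Q$$ with $c\in F\setminus\{0\}$, a rational function $f\in K$, a symbolic power $\mathcal P$, an $E$-solution $\mathcal E$, a $G$-solution $\mathcal G$ and a $Q$-solution $\mathcal Q$ in $R'$. -/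

import Mathlib

universe u v

namespace MixedSystem

/-- Index set of the indeterminates: `t₁,…,t_l`, `x₁,…,x_m`, `y₁,…,y_n`. -/
abbrev Idx (l m n : ℕ) : Type := Fin l ⊕ Fin m ⊕ Fin n

/-- The polynomial ring `F[t, x, y]`. -/
abbrev Poly (F : Type*) [Field F] (l m n : ℕ) := MvPolynomial (Idx l m n) F

/-- The field of rational functions `F(t, x, y)`. -/
abbrev RatFun (F : Type*) [Field F] (l m n : ℕ) := FractionRing (Poly F l m n)

section RationalFunctions

variable {F : Type*} [Field F] {l m n : ℕ}

/-- The indeterminate with index `s`, as a rational function. -/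
noncomputable def X (s : Idx l m n) : RatFun F l m n :=
  algebraMap (Poly F l m n) (RatFun F l m n) (MvPolynomial.X s)

/-- The indeterminate `x_j`. -/
noncomputable def xVar (j : Fin m) : RatFun F l m n := X (Sum.inr (Sum.inl j))

variable (F l m n) in
/-- The subfield `F(t)` of `F(t, x, y)`. -/
noncomputable def fieldT : IntermediateField F (RatFun F l m n) :=
  IntermediateField.adjoin F (Set.range fun i : Fin l => X (Sum.inl i))

variable (F l m n) in
/-- The subfield `F(x)` of `F(t, x, y)`. -/
noncomputable def fieldX : IntermediateField F (RatFun F l m n) :=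
  IntermediateField.adjoin F (Set.range fun j : Fin m => X (Sum.inr (Sum.inl j)))

variable (F l m n) in
/-- The subfield `F(y)` of `F(t, x, y)`. -/
noncomputable def fieldY : IntermediateField F (RatFun F l m n) :=
  IntermediateField.adjoin F (Set.range fun k : Fin n => X (Sum.inr (Sum.inr k)))

/-! The derivation, shift and `q`-shift operators on `F(t, x, y)`. -/

/-- The partial derivative of a rational function `a / b` with respect to the indeterminate `s`,
by the quotient rule. -/
noncomputable def partialFun (s : Idx l m n) (f : RatFun F l m n) : RatFun F l m n :=
  let a := IsFractionRing.num (Poly F l m n) f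
  let b : Poly F l m n := IsFractionRing.den (Poly F l m n) f
  (algebraMap (Poly F l m n) (RatFun F l m n)
      (MvPolynomial.pderiv s a * b - a * MvPolynomial.pderiv s b))
    / algebraMap (Poly F l m n) (RatFun F l m n) b ^ 2

/-- The quotient rule holds for every representation of `f` as a fraction. -/
theorem partialFun_div (s : Idx l m n) (a b : Poly F l m n) (hb : b ≠ 0) :
    partialFun s (algebraMap (Poly F l m n) (RatFun F l m n) a / algebraMap _ _ b) =
      (algebraMap (Poly F l m n) (RatFun F l m n)
        (MvPolynomial.pderiv s a * b - a * MvPolynomial.pderiv s b))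
        / algebraMap (Poly F l m n) (RatFun F l m n) b ^ 2 := by
  set ι := algebraMap (Poly F l m n) (RatFun F l m n) with hι
  have hinj : Function.Injective ι := IsFractionRing.injective _ _
  set f := ι a / ι b with hf
  have hb' : ι b ≠ 0 := fun h => hb (hinj (by simpa using h))
  unfold partialFun
  set p := IsFractionRing.num (Poly F l m n) f
  obtain ⟨d, hd⟩ : ∃ d : Poly F l m n, d = IsFractionRing.den (Poly F l m n) f := ⟨_, rfl⟩
  have hd0 : d ≠ 0 := by rw [hd]; exact nonZeroDivisors.coe_ne_zero _
  have hd' : ι d ≠ 0 := fun h => hd0 (hinj (by simpa using h))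
  have h1 : ι p / ι d = f := by
    rw [hd, ← IsFractionRing.mk'_eq_div]
    exact IsFractionRing.mk'_num_den (Poly F l m n) f
  have h2 : p * b = a * d := by
    apply hinj
    rw [hf, div_eq_div_iff hd' hb'] at h1
    simpa using h1
  have h3 : MvPolynomial.pderiv s p * b + p * MvPolynomial.pderiv s b =
      MvPolynomial.pderiv s a * d + a * MvPolynomial.pderiv s d := by
    have := congrArg (MvPolynomial.pderiv s) h2
    simp only [Derivation.leibniz, smul_eq_mul] at this
    linear_combination this
  simp only [← hd]
  rw [div_eq_div_iff (pow_ne_zero _ hd') (pow_ne_zero _ hb'), ← map_pow, ← map_pow,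
    ← map_mul, ← map_mul]
  congr 1
  linear_combination (b * d) * h3
    - (b * MvPolynomial.pderiv s d + d * MvPolynomial.pderiv s b) * h2

/-- Every rational function is a fraction of polynomials. -/
theorem exists_div (f : RatFun F l m n) : ∃ a b : Poly F l m n, b ≠ 0 ∧
    f = algebraMap (Poly F l m n) (RatFun F l m n) a / algebraMap _ _ b := by
  obtain ⟨a, b, hb, h⟩ := IsFractionRing.div_surjective (A := Poly F l m n) f
  exact ⟨a, b, nonZeroDivisors.ne_zero hb, h.symm⟩

theorem partialFun_add (s : Idx l m n) (f g : RatFun F l m n) :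
    partialFun s (f + g) = partialFun s f + partialFun s g := by
  obtain ⟨a, b, hb, rfl⟩ := exists_div f
  obtain ⟨c, d, hd, rfl⟩ := exists_div g
  have hinj : Function.Injective (algebraMap (Poly F l m n) (RatFun F l m n)) :=
    IsFractionRing.injective _ _
  have hb' := (map_ne_zero_iff _ hinj).2 hb
  have hd' := (map_ne_zero_iff _ hinj).2 hd
  rw [div_add_div _ _ hb' hd', ← map_mul, ← map_mul, ← map_mul, ← map_add,
    partialFun_div _ _ _ (mul_ne_zero hb hd), partialFun_div _ _ _ hb, partialFun_div _ _ _ hd]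
  simp only [Derivation.leibniz, smul_eq_mul, map_add, map_sub, map_mul]
  generalize algebraMap (Poly F l m n) (RatFun F l m n) b = b' at *
  generalize algebraMap (Poly F l m n) (RatFun F l m n) d = d' at *
  rw [div_add_div _ _ (pow_ne_zero 2 hb') (pow_ne_zero 2 hd'),
    div_eq_div_iff (pow_ne_zero 2 (mul_ne_zero hb' hd'))
      (mul_ne_zero (pow_ne_zero 2 hb') (pow_ne_zero 2 hd'))]
  ring

theorem partialFun_mul (s : Idx l m n) (f g : RatFun F l m n) :
    partialFun s (f * g) = f * partialFun s g + g * partialFun s f := by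
  obtain ⟨a, b, hb, rfl⟩ := exists_div f
  obtain ⟨c, d, hd, rfl⟩ := exists_div g
  have hinj : Function.Injective (algebraMap (Poly F l m n) (RatFun F l m n)) :=
    IsFractionRing.injective _ _
  have hb' := (map_ne_zero_iff _ hinj).2 hb
  have hd' := (map_ne_zero_iff _ hinj).2 hd
  rw [div_mul_div_comm, ← map_mul, ← map_mul,
    partialFun_div _ _ _ (mul_ne_zero hb hd), partialFun_div _ _ _ hb, partialFun_div _ _ _ hd]
  simp only [Derivation.leibniz, smul_eq_mul, map_add, map_sub, map_mul]
  generalize algebraMap (Poly F l m n) (RatFun F l m n) b = b' at *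
  generalize algebraMap (Poly F l m n) (RatFun F l m n) d = d' at *
  rw [div_mul_div_comm, div_mul_div_comm,
    div_add_div _ _ (mul_ne_zero hb' (pow_ne_zero 2 hd')) (mul_ne_zero hd' (pow_ne_zero 2 hb')),
    div_eq_div_iff (pow_ne_zero 2 (mul_ne_zero hb' hd'))
      (mul_ne_zero (mul_ne_zero hb' (pow_ne_zero 2 hd')) (mul_ne_zero hd' (pow_ne_zero 2 hb')))]
  ring

theorem partialFun_const (s : Idx l m n) (r : F) :
    partialFun s (algebraMap F (RatFun F l m n) r) = 0 := by
  have h : algebraMap F (RatFun F l m n) r = algebraMap (Poly F l m n) (RatFun F l m n)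
      (algebraMap F (Poly F l m n) r) / algebraMap _ _ (1 : Poly F l m n) := by
    rw [map_one, div_one, ← IsScalarTower.algebraMap_apply]
  rw [h, partialFun_div _ _ _ one_ne_zero]
  simp

/-- The partial derivative with respect to the indeterminate `s`, as an `F`-derivation of
`F(t, x, y)`. -/
noncomputable def partialDer (s : Idx l m n) :
    Derivation F (RatFun F l m n) (RatFun F l m n) :=
  Derivation.mk'
    { toFun := partialFun s
      map_add' := partialFun_add s
      map_smul' := fun r f => by
        rw [RingHom.id_apply, Algebra.smul_def, Algebra.smul_def, partialFun_mul,
          partialFun_const, mul_zero, add_zero] }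
    (fun f g => partialFun_mul s f g)

/-- The `F`-automorphism of `F[t, x, y]` which sends the indeterminate `s` to `c s + d`
(`c` a unit) and fixes the other indeterminates. -/
noncomputable def affinePoly (s : Idx l m n) (c : Fˣ) (d : F) : Poly F l m n ≃ₐ[F] Poly F l m n :=
  AlgEquiv.ofAlgHom
    (MvPolynomial.aeval fun r => if r = s
      then MvPolynomial.C (c : F) * MvPolynomial.X r + MvPolynomial.C d else MvPolynomial.X r)
    (MvPolynomial.aeval fun r => if r = s
      then MvPolynomial.C ((c⁻¹ : Fˣ) : F) * (MvPolynomial.X r - MvPolynomial.C d)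
      else MvPolynomial.X r)
    (by
      ext r : 1
      by_cases h : r = s
      · simp [h, MvPolynomial.algHom_C, ← mul_assoc, ← MvPolynomial.C_mul]
      · simp [h])
    (by
      ext r : 1
      by_cases h : r = s
      · simp [h, MvPolynomial.algHom_C, ← mul_assoc, ← MvPolynomial.C_mul]
      · simp [h])

/-- The derivation `δ_i = ∂/∂t_i` of `F(t, x, y)`. -/
noncomputable def delta (i : Fin l) : Derivation F (RatFun F l m n) (RatFun F l m n) :=
  partialDer (Sum.inl i)

/-- The shift operator `σ_j : x_j ↦ x_j + 1` on `F(t, x, y)`. -/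
noncomputable def sigma (j : Fin m) : RatFun F l m n ≃ₐ[F] RatFun F l m n :=
  IsFractionRing.algEquivOfAlgEquiv
    (affinePoly (Sum.inr (Sum.inl j)) 1 1 : Poly F l m n ≃ₐ[F] Poly F l m n)

/-- The `q`-shift operator `τ_k : y_k ↦ q_k y_k` on `F(t, x, y)`. -/
noncomputable def tau (q : Fin n → Fˣ) (k : Fin n) : RatFun F l m n ≃ₐ[F] RatFun F l m n :=
  IsFractionRing.algEquivOfAlgEquiv
    (affinePoly (Sum.inr (Sum.inr k)) (q k) 0 : Poly F l m n ≃ₐ[F] Poly F l m n)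

/-- Compatibility of the first-order system `δ_i z = u_i z`, `σ_j z = v_j z`, `τ_k z = w_k z`. -/
structure IsCompatible (q : Fin n → Fˣ) (u : Fin l → RatFun F l m n) (v : Fin m → RatFun F l m n)
    (w : Fin n → RatFun F l m n) : Prop where
  v_ne_zero : ∀ j, v j ≠ 0
  w_ne_zero : ∀ k, w k ≠ 0
  delta_delta : ∀ i j, delta i (u j) = delta j (u i)
  sigma_sigma : ∀ i j, sigma i (v j) / v j = sigma j (v i) / v i
  tau_tau : ∀ i j, tau q i (w j) / w j = tau q j (w i) / w i
  delta_sigma : ∀ i j, delta i (v j) / v j = sigma j (u i) - u i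
  delta_tau : ∀ i k, delta i (w k) / w k = tau q k (u i) - u i
  sigma_tau : ∀ j k, sigma j (w k) / w k = tau q k (v j) / v j

/-- A rational function is monic with respect to a monomial ordering if it is a quotient of two
coprime monic polynomials. -/
def IsMonicRat (ord : MonomialOrder (Idx l m n)) (f : RatFun F l m n) : Prop :=
  ∃ a b : Poly F l m n, ord.Monic a ∧ ord.Monic b ∧ IsRelPrime a b ∧
    f = algebraMap (Poly F l m n) (RatFun F l m n) a / algebraMap (Poly F l m n) (RatFun F l m n) b

end RationalFunctions

/-- A `Δ`-extension structure on a commutative ring `R` containing `F(t, x, y)`: pairwise commuting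
derivations `δ_i` and ring monomorphisms `σ_j`, `τ_k` of `R` extending those of `F(t, x, y)`. -/
structure DeltaExtension {F : Type*} [Field F] {l m n : ℕ} (q : Fin n → Fˣ)
    (R : Type*) [CommRing R] [Algebra (RatFun F l m n) R] where
  algebraMap_injective : Function.Injective (algebraMap (RatFun F l m n) R)
  δ : Fin l → Derivation ℤ R R
  σ : Fin m → R →+* R
  τ : Fin n → R →+* R
  σ_injective : ∀ j, Function.Injective (σ j)
  τ_injective : ∀ k, Function.Injective (τ k)
  δ_extends : ∀ i (f : RatFun F l m n), δ i (algebraMap _ R f) = algebraMap _ R (delta i f)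
  σ_extends : ∀ j (f : RatFun F l m n), σ j (algebraMap _ R f) = algebraMap _ R (sigma j f)
  τ_extends : ∀ k (f : RatFun F l m n), τ k (algebraMap _ R f) = algebraMap _ R (tau q k f)
  δ_δ : ∀ i j r, δ i (δ j r) = δ j (δ i r)
  δ_σ : ∀ i j r, δ i (σ j r) = σ j (δ i r)
  δ_τ : ∀ i k r, δ i (τ k r) = τ k (δ i r)
  σ_σ : ∀ i j r, σ i (σ j r) = σ j (σ i r)
  σ_τ : ∀ j k r, σ j (τ k r) = τ k (σ j r)
  τ_τ : ∀ i j r, τ i (τ j r) = τ j (τ i r)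

namespace DeltaExtension

section

variable {F : Type*} [Field F] {l m n : ℕ} {q : Fin n → Fˣ}
  {R : Type*} [CommRing R] [Algebra (RatFun F l m n) R] (D : DeltaExtension (l := l) (m := m) q R)

/-- `h` solves the system `δ_i z = u_i z`, `σ_j z = v_j z`, `τ_k z = w_k z`. -/
structure IsSolution (u : Fin l → RatFun F l m n) (v : Fin m → RatFun F l m n)
    (w : Fin n → RatFun F l m n) (h : R) : Prop where
  δ_eq : ∀ i, D.δ i h = algebraMap _ R (u i) * h
  σ_eq : ∀ j, D.σ j h = algebraMap _ R (v j) * h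
  τ_eq : ∀ k, D.τ k h = algebraMap _ R (w k) * h

/-- `h` is an `H`-solution with certificates `u`, `v`, `w`: a nonzero solution of the compatible
system given by `u`, `v`, `w`. -/
structure HasCertificates (u : Fin l → RatFun F l m n) (v : Fin m → RatFun F l m n)
    (w : Fin n → RatFun F l m n) (h : R) : Prop where
  ne_zero : h ≠ 0
  compatible : IsCompatible q u v w
  isSolution : D.IsSolution u v w h

/-- The system satisfied by a nonzero element of a `Δ`-extension is automatically compatible. -/
theorem hasCertificates_of_ne_zero {u : Fin l → RatFun F l m n} {v : Fin m → RatFun F l m n}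
    {w : Fin n → RatFun F l m n} {h : R} (h0 : h ≠ 0) (hs : D.IsSolution u v w h) :
    D.HasCertificates u v w h := by
  have key : ∀ a b : RatFun F l m n, algebraMap _ R a * h = algebraMap _ R b * h → a = b := by
    intro a b hab
    by_contra hne
    apply h0
    have h1 : algebraMap _ R (a - b) * h = 0 := by rw [map_sub, sub_mul, hab, sub_self]
    have h2 : algebraMap _ R ((a - b)⁻¹) * (algebraMap _ R (a - b) * h) = 0 := by
      rw [h1, mul_zero]
    rwa [← mul_assoc, ← map_mul, inv_mul_cancel₀ (sub_ne_zero.2 hne), map_one, one_mul] at h2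
  obtain ⟨hδ, hσ, hτ⟩ := hs
  have hv : ∀ j, v j ≠ 0 := fun j hj => h0 (D.σ_injective j (by rw [hσ, hj]; simp))
  have hw : ∀ k, w k ≠ 0 := fun k hk => h0 (D.τ_injective k (by rw [hτ, hk]; simp))
  refine ⟨h0, ⟨hv, hw, ?_, ?_, ?_, ?_, ?_, ?_⟩, ⟨hδ, hσ, hτ⟩⟩
  · intro i j
    have e := D.δ_δ i j h
    simp only [hδ, Derivation.leibniz, smul_eq_mul, D.δ_extends] at e
    apply key
    linear_combination e
  · intro i j
    have e := D.σ_σ i j h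
    simp only [hσ, map_mul, D.σ_extends] at e
    rw [div_eq_div_iff (hv _) (hv _)]
    apply key
    simp only [map_mul]
    linear_combination e
  · intro i j
    have e := D.τ_τ i j h
    simp only [hτ, map_mul, D.τ_extends] at e
    rw [div_eq_div_iff (hw _) (hw _)]
    apply key
    simp only [map_mul]
    linear_combination e
  · intro i j
    have e := D.δ_σ i j h
    simp only [hσ, hδ, Derivation.leibniz, smul_eq_mul, map_mul, D.σ_extends, D.δ_extends] at e
    rw [div_eq_iff (hv _)]
    apply key
    simp only [map_mul, map_sub]
    linear_combination e
  · intro i j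
    have e := D.δ_τ i j h
    simp only [hτ, hδ, Derivation.leibniz, smul_eq_mul, map_mul, D.τ_extends, D.δ_extends] at e
    rw [div_eq_iff (hw _)]
    apply key
    simp only [map_mul, map_sub]
    linear_combination e
  · intro i j
    have e := D.σ_τ i j h
    simp only [hτ, hσ, map_mul, D.τ_extends, D.σ_extends] at e
    rw [div_eq_div_iff (hw _) (hv _)]
    apply key
    simp only [map_mul]
    linear_combination e

/-- `H`-solutions (hyperexponential-hypergeometric solutions). -/
def IsHSolution (h : R) : Prop := ∃ u v w, D.HasCertificates u v w h

/-- Constants: elements killed by all `δ_i` and fixed by all `σ_j` and `τ_k`. -/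
def IsConstant (r : R) : Prop :=
  (∀ i, D.δ i r = 0) ∧ (∀ j, D.σ j r = r) ∧ (∀ k, D.τ k r = r)

/-- The properties of the Picard-Vessiot `Δ`-extensions in which `H`-solutions are taken:
the ring of constants is `F`, and every `H`-solution is invertible. -/
structure IsPVType : Prop where
  constants : ∀ r, D.IsConstant r → ∃ c : F, r = algebraMap (RatFun F l m n) R (algebraMap F _ c)
  isUnit : ∀ h, D.IsHSolution h → IsUnit h

/-- Symbolic powers `α₁^{x₁} ⋯ α_m^{x_m}` with all `α_j ∈ F(t)` nonzero and monic. -/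
def IsSymbolicPower (ord : MonomialOrder (Idx l m n)) (p : R) : Prop :=
  ∃ α : Fin m → RatFun F l m n, (∀ j, α j ∈ fieldT F l m n ∧ α j ≠ 0 ∧ IsMonicRat ord (α j)) ∧
    D.HasCertificates (fun i => ∑ j, xVar j * (delta i (α j) / α j)) α (fun _ => 1) p

/-- `E`-solutions: `H`-solutions with certificates `β, 1, 1`, where `β_i ∈ F(t)`. -/
def IsESolution (e : R) : Prop :=
  ∃ β : Fin l → RatFun F l m n, (∀ i, β i ∈ fieldT F l m n) ∧
    D.HasCertificates β (fun _ => 1) (fun _ => 1) e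

/-- `G`-solutions: `H`-solutions with certificates `0, λ, 1`, where `λ_j ∈ F(x)` is nonzero. -/
def IsGSolution (g : R) : Prop :=
  ∃ lam : Fin m → RatFun F l m n, (∀ j, lam j ∈ fieldX F l m n ∧ lam j ≠ 0) ∧
    D.HasCertificates (fun _ => 0) lam (fun _ => 1) g

/-- `Q`-solutions: `H`-solutions with certificates `0, 1, μ`, where `μ_k ∈ F(y)` is nonzero. -/
def IsQSolution (s : R) : Prop :=
  ∃ μ : Fin n → RatFun F l m n, (∀ k, μ k ∈ fieldY F l m n ∧ μ k ≠ 0) ∧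
    D.HasCertificates (fun _ => 0) (fun _ => 1) μ s

/-- `ι : R → R'` is an embedding of `Δ`-extensions of `F(t, x, y)`. -/
structure IsEmbedding {R' : Type*} [CommRing R'] [Algebra (RatFun F l m n) R']
    (D' : DeltaExtension (l := l) (m := m) q R') (ι : R →ₐ[RatFun F l m n] R') : Prop where
  injective : Function.Injective ι
  map_δ : ∀ i r, ι (D.δ i r) = D'.δ i (ι r)
  map_σ : ∀ j r, ι (D.σ j r) = D'.σ j (ι r)
  map_τ : ∀ k r, ι (D.τ k r) = D'.τ k (ι r)

end

end DeltaExtension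

end MixedSystem

/-! Write `γ_s` for the operators `σ_j`, `τ_k` and `C_s` for their certificates. Replacing `h` by `f
h` with `f` rational multiplies `C_s` by the coboundary `γ_s(f)/f` and adds `δ_i(f)/f` to `u_i`
(`IsGenSystem.gauge`). The aim is to choose `f` so that no `C_s` has a zero or pole at an
irreducible polynomial `p` that mixes indeterminates of different kinds.

Such a `p` is attacked with an operator `γ_s` whose indeterminate occurs in `p`, so that the
translates of `p` are pairwise non-associated. The central claim is that the orders of `C_s` along
this orbit add up to zero. If `p` involves `t_i`, the product of `2L` consecutive translates of
`C_s` has logarithmic derivative `γ_s^{2L}(u_i) - u_i`. For large `L` this has no pole in the middle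
of the orbit, whereas a nonzero order would force one (`not_windowNeZero_of_involves`). If `p`
involves `x_j` and `y_k`, compatibility makes the orbit sum of `C_{σ_j}` invariant under `τ_k`, and
a nonzero sum would recur on infinitely many orbits (`not_windowNeZero_of_involves_y`). Zeros and
poles of total order zero on an orbit cancel against a coboundary (`exists_gauge_single`), and
commutation carries the vanishing over to all other `C_r` (`IsGenSystem.exists_gauge`).

Afterwards each `C_s` is a product of functions of `t`, of `x` and of `y`. The remaining
compatibility conditions leave only a `y`-factor in the `C_{τ_k}`, only `α_j(t) λ_j(x)` in the
`C_{σ_j}`, and only `∑ x_j δ_i(α_j)/α_j + β_i(t)` in the `u_i`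
(`IsCompatible.exists_decomposition`).

It remains to realise the factors. Each of the systems of `P`, `E`, `G` gets an invertible solution
in a larger ring: a Laurent polynomial variable, or a root when a power of the system is already
solvable, so that no new constants appear (`exists_adjoin`). Then `Q` is the quotient of `h` by `f P
E G`. -/

namespace MixedSystem

/-! ### Orders of fractions at the primes of a factorial ring. -/

section OrdAt

variable {A : Type*} [CommRing A] [IsDomain A] [UniqueFactorizationMonoid A]
  {K : Type*} [Field K] [Algebra A K] [IsFractionRing A K]

/-- The order of a fraction `f` at the prime element `p`. -/
noncomputable def ordAt (p : A) (f : K) : ℤ :=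
  (multiplicity p (IsFractionRing.num A f) : ℤ) - multiplicity p (IsFractionRing.den A f : A)

theorem _root_.Prime.multiplicity_mul_of_ne_zero {p a b : A} (hp : Prime p) (ha : a ≠ 0)
    (hb : b ≠ 0) : multiplicity p (a * b) = multiplicity p a + multiplicity p b :=
  multiplicity_mul hp (FiniteMultiplicity.of_not_isUnit hp.not_isUnit (mul_ne_zero ha hb))

theorem ordAt_div {p a b : A} (hp : Prime p) (ha : a ≠ 0) (hb : b ≠ 0) :
    ordAt p (algebraMap A K a / algebraMap A K b) = (multiplicity p a : ℤ) - multiplicity p b := by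
  have hinj : Function.Injective (algebraMap A K) := IsFractionRing.injective _ _
  unfold ordAt
  set f := algebraMap A K a / algebraMap A K b with hf
  have hb' : algebraMap A K b ≠ 0 := (map_ne_zero_iff _ hinj).2 hb
  have ha' : algebraMap A K a ≠ 0 := (map_ne_zero_iff _ hinj).2 ha
  obtain ⟨d, hd⟩ : ∃ d : A, d = IsFractionRing.den A f := ⟨_, rfl⟩
  have hd0 : d ≠ 0 := by rw [hd]; exact nonZeroDivisors.coe_ne_zero _
  have hd' : algebraMap A K d ≠ 0 := (map_ne_zero_iff _ hinj).2 hd0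
  have h1 : algebraMap A K (IsFractionRing.num A f) / algebraMap A K d = f := by
    rw [hd, ← IsFractionRing.mk'_eq_div]
    exact IsFractionRing.mk'_num_den A f
  have hn0 : IsFractionRing.num A f ≠ 0 := by
    intro h0
    rw [h0, map_zero, zero_div] at h1
    exact div_ne_zero ha' hb' h1.symm
  have h2 : IsFractionRing.num A f * b = a * d := by
    apply hinj
    rw [hf, div_eq_div_iff hd' hb'] at h1
    simpa using h1
  have h3 := congrArg (multiplicity p) h2
  rw [hp.multiplicity_mul_of_ne_zero hn0 hb, hp.multiplicity_mul_of_ne_zero ha hd0] at h3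
  rw [← hd]
  omega

theorem exists_div_of_ne_zero (A : Type*) [CommRing A] [IsDomain A] {K : Type*} [Field K]
    [Algebra A K] [IsFractionRing A K] {f : K} (hf : f ≠ 0) :
    ∃ a b : A, a ≠ 0 ∧ b ≠ 0 ∧ f = algebraMap A K a / algebraMap A K b := by
  obtain ⟨a, b, hb, rfl⟩ := IsFractionRing.div_surjective (A := A) f
  refine ⟨a, b, ?_, nonZeroDivisors.ne_zero hb, rfl⟩
  rintro rfl
  simp at hf

theorem ordAt_mul {p : A} (hp : Prime p) {f g : K} (hf : f ≠ 0) (hg : g ≠ 0) :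
    ordAt p (f * g) = ordAt p f + ordAt p g := by
  obtain ⟨a, b, ha, hb, rfl⟩ := exists_div_of_ne_zero A hf
  obtain ⟨c, d, hc, hd, rfl⟩ := exists_div_of_ne_zero A hg
  rw [div_mul_div_comm, ← map_mul, ← map_mul, ordAt_div hp (mul_ne_zero ha hc) (mul_ne_zero hb hd),
    ordAt_div hp ha hb, ordAt_div hp hc hd, hp.multiplicity_mul_of_ne_zero ha hc,
    hp.multiplicity_mul_of_ne_zero hb hd]
  push_cast
  ring

theorem ordAt_algebraMap {p a : A} (hp : Prime p) (ha : a ≠ 0) :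
    ordAt p (algebraMap A K a) = multiplicity p a := by
  have := ordAt_div (K := K) hp ha one_ne_zero
  rwa [map_one, div_one, multiplicity_of_one_right hp.not_isUnit, Nat.cast_zero, sub_zero] at this

theorem ordAt_one {p : A} (hp : Prime p) : ordAt p (1 : K) = 0 := by
  rw [← map_one (algebraMap A K), ordAt_algebraMap hp one_ne_zero,
    multiplicity_of_one_right hp.not_isUnit, Nat.cast_zero]

theorem ordAt_inv {p : A} (hp : Prime p) {f : K} (hf : f ≠ 0) : ordAt p f⁻¹ = -ordAt p f := by
  have := ordAt_mul hp hf (inv_ne_zero hf)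
  rw [mul_inv_cancel₀ hf, ordAt_one hp] at this
  omega

theorem ordAt_div' {p : A} (hp : Prime p) {f g : K} (hf : f ≠ 0) (hg : g ≠ 0) :
    ordAt p (f / g) = ordAt p f - ordAt p g := by
  rw [div_eq_mul_inv, ordAt_mul hp hf (inv_ne_zero hg), ordAt_inv hp hg, sub_eq_add_neg]

theorem ordAt_prod {p : A} (hp : Prime p) {ι : Type*} (s : Finset ι) (f : ι → K)
    (hf : ∀ i ∈ s, f i ≠ 0) : ordAt p (∏ i ∈ s, f i) = ∑ i ∈ s, ordAt p (f i) := by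
  classical
  induction s using Finset.induction_on with
  | empty => simp [ordAt_one hp]
  | insert a s ha ih =>
    have hs : ∀ i ∈ s, f i ≠ 0 := fun i hi => hf i (Finset.mem_insert_of_mem hi)
    rw [Finset.prod_insert ha, Finset.sum_insert ha,
      ordAt_mul hp (hf a (Finset.mem_insert_self _ _)) (Finset.prod_ne_zero_iff.2 hs), ih hs]

theorem ordAt_congr {p p' : A} (h : Associated p p') (f : K) : ordAt p f = ordAt p' f := by
  unfold ordAt
  rw [multiplicity_eq_of_associated_left h, multiplicity_eq_of_associated_left h]

theorem ordAt_map {p : A} (hp : Prime p) (g : A ≃+* A) (γ : K ≃+* K)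
    (hγ : ∀ a, γ (algebraMap A K a) = algebraMap A K (g a)) {f : K} (hf : f ≠ 0) :
    ordAt (g p) (γ f) = ordAt p f := by
  obtain ⟨a, b, ha, hb, rfl⟩ := exists_div_of_ne_zero A hf
  rw [map_div₀, hγ, hγ, ordAt_div hp ha hb,
    ordAt_div ((MulEquiv.prime_iff g).2 hp) (by simpa using ha) (by simpa using hb),
    multiplicity_map_eq, multiplicity_map_eq]

omit [UniqueFactorizationMonoid A] in
theorem multiplicity_of_irreducible {p r : A} (hp : Prime p) (hr : Irreducible r) :
    (Associated p r → multiplicity p r = 1) ∧ (¬ Associated p r → multiplicity p r = 0) := by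
  constructor
  · intro h
    rw [multiplicity_eq_of_associated_right h.symm, multiplicity_self]
  · intro h
    rw [multiplicity_eq_zero]
    exact fun hd => h (hp.irreducible.associated_of_dvd hr hd)

/-- A nonzero fraction is the `p`-power given by its order times a fraction prime to `p`. -/
theorem exists_eq_zpow_mul_div {p : A} (hp : Prime p) {f : K} (hf : f ≠ 0) :
    ∃ a b : A, ¬ p ∣ a ∧ ¬ p ∣ b ∧
      f = algebraMap A K p ^ ordAt p f * (algebraMap A K a / algebraMap A K b) := by
  have hinj : Function.Injective (algebraMap A K) := IsFractionRing.injective _ _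
  have hp' : algebraMap A K p ≠ 0 := (map_ne_zero_iff _ hinj).2 hp.ne_zero
  obtain ⟨a, b, ha, hb, rfl⟩ := exists_div_of_ne_zero A hf
  obtain ⟨a', ha1, ha2⟩ :=
    (FiniteMultiplicity.of_not_isUnit hp.not_isUnit ha).exists_eq_pow_mul_and_not_dvd
  obtain ⟨b', hb1, hb2⟩ :=
    (FiniteMultiplicity.of_not_isUnit hp.not_isUnit hb).exists_eq_pow_mul_and_not_dvd
  refine ⟨a', b', ha2, hb2, ?_⟩
  rw [ordAt_div hp ha hb]
  conv_lhs => rw [ha1, hb1]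
  rw [map_mul, map_mul, map_pow, map_pow, mul_div_mul_comm, zpow_sub₀ hp', zpow_natCast,
    zpow_natCast]

omit [IsDomain A] in
/-- Only finitely many members of a family of pairwise non-associated irreducible elements
divide a given nonzero element. -/
theorem finite_setOf_dvd {ι : Type*} {p : ι → A} (hp : ∀ i, Irreducible (p i))
    (hne : ∀ i j, Associated (p i) (p j) → i = j) {a : A} (ha : a ≠ 0) :
    {i | p i ∣ a}.Finite := by
  classical
  have h : ∀ i : {i | p i ∣ a}, ∃ r ∈ UniqueFactorizationMonoid.factors a, Associated (p i) r :=
    fun i => UniqueFactorizationMonoid.exists_mem_factors_of_dvd ha (hp i) i.2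
  choose r hr1 hr2 using h
  refine Finite.of_injective
    (fun i => (⟨r i, by simpa using hr1 i⟩ : (UniqueFactorizationMonoid.factors a).toFinset)) ?_
  intro i j hij
  have : r i = r j := congrArg Subtype.val hij
  exact Subtype.ext (hne _ _ ((hr2 i).trans (this ▸ (hr2 j).symm)))

theorem finite_setOf_ordAt_ne_zero {ι : Type*} {p : ι → A} (hp : ∀ i, Irreducible (p i))
    (hne : ∀ i j, Associated (p i) (p j) → i = j) {f : K} (hf : f ≠ 0) :
    {i | ordAt (p i) f ≠ 0}.Finite := by
  obtain ⟨a, b, ha, hb, rfl⟩ := exists_div_of_ne_zero A hf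
  refine ((finite_setOf_dvd hp hne ha).union (finite_setOf_dvd hp hne hb)).subset ?_
  intro i hi
  by_contra h
  simp only [Set.mem_union, Set.mem_ofPred_eq, not_or] at h
  apply hi
  rw [ordAt_div (hp i).prime ha hb, multiplicity_eq_zero.2 h.1, multiplicity_eq_zero.2 h.2, sub_self]

/-- A finite set of irreducible elements which represents all places where `f` has nonzero
order. -/
theorem exists_finset_ordAt {f : K} (hf : f ≠ 0) : ∃ T : Finset A,
    (∀ p ∈ T, Irreducible p) ∧ ∀ p, Irreducible p → ordAt p f ≠ 0 → ∃ r ∈ T, Associated p r := by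
  classical
  obtain ⟨a, b, ha, hb, rfl⟩ := exists_div_of_ne_zero A hf
  refine ⟨(UniqueFactorizationMonoid.factors (a * b)).toFinset, fun p hp =>
    UniqueFactorizationMonoid.irreducible_of_factor p (by simpa using hp), fun p hp h => ?_⟩
  have hd : p ∣ a * b := by
    by_contra hd
    apply h
    rw [ordAt_div hp.prime ha hb, multiplicity_eq_zero.2 fun h => hd (h.mul_right _),
      multiplicity_eq_zero.2 fun h => hd (h.mul_left _), sub_self]
  obtain ⟨r, h1, h2⟩ :=
    UniqueFactorizationMonoid.exists_mem_factors_of_dvd (mul_ne_zero ha hb) hp hd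
  exact ⟨r, by simpa using h1, h2⟩

/-- A nonzero fraction whose order vanishes at all primes is a unit. -/
theorem exists_unit_of_ordAt_eq_zero {f : K} (hf : f ≠ 0)
    (h : ∀ p : A, Irreducible p → ordAt p f = 0) : ∃ a : Aˣ, f = algebraMap A K a := by
  have hinj : Function.Injective (algebraMap A K) := IsFractionRing.injective _ _
  obtain ⟨d, hd⟩ : ∃ d : A, d = IsFractionRing.den A f := ⟨_, rfl⟩
  have hd0 : d ≠ 0 := by rw [hd]; exact nonZeroDivisors.coe_ne_zero _
  have h1 : algebraMap A K (IsFractionRing.num A f) / algebraMap A K d = f := by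
    rw [hd, ← IsFractionRing.mk'_eq_div]
    exact IsFractionRing.mk'_num_den A f
  have hn0 : IsFractionRing.num A f ≠ 0 := by
    intro h0
    rw [h0, map_zero, zero_div] at h1
    exact hf h1.symm
  have hrel := IsFractionRing.num_den_reduced A f
  rw [← hd] at hrel
  have key : ∀ p : A, Irreducible p → multiplicity p (IsFractionRing.num A f) = multiplicity p d := by
    intro p hp
    have := h p hp
    unfold ordAt at this
    rw [← hd] at this
    omega
  -- Numerator and denominator are coprime and have equal multiplicity at `p`, so `p` divides
  -- neither.
  have hboth : ∀ p : A, Irreducible p → ¬ (p ∣ IsFractionRing.num A f) ∧ ¬ p ∣ d := by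
    intro p hp
    have h2 := key p hp
    by_cases hpd : p ∣ d
    · exfalso
      have : p ∣ IsFractionRing.num A f := by
        rw [← dvd_iff_multiplicity_pos, h2, dvd_iff_multiplicity_pos]
        exact hpd
      exact hp.not_isUnit (hrel this hpd)
    · refine ⟨?_, hpd⟩
      rwa [← multiplicity_eq_zero, h2, multiplicity_eq_zero]
  have hu : ∀ a : A, a ≠ 0 → (∀ p : A, Irreducible p → ¬ p ∣ a) → IsUnit a := by
    intro a ha hpa
    by_contra hna
    obtain ⟨p, hp1, hp2⟩ := WfDvdMonoid.exists_irreducible_factor hna ha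
    exact hpa p hp1 hp2
  obtain ⟨a, ha⟩ := hu _ hn0 fun p hp => (hboth p hp).1
  obtain ⟨b, hb⟩ := hu _ hd0 fun p hp => (hboth p hp).2
  refine ⟨a * b⁻¹, ?_⟩
  have hb' : algebraMap A K b ≠ 0 := (map_ne_zero_iff _ hinj).2 b.ne_zero
  rw [← h1, ← ha, ← hb, div_eq_iff hb', ← map_mul]
  congr 1
  simp

end OrdAt

/-! ### Splitting rational functions by classes of irreducible factors. -/

section Parts

variable {F : Type*} [Field F] {l m n : ℕ}

/-- The part of a nonzero polynomial composed of the irreducible factors in a given class. -/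
theorem exists_monic_part_poly (ord : MonomialOrder (Idx l m n)) (Pr : Poly F l m n → Prop)
    (hPr : ∀ p p', Associated p p' → Pr p → Pr p') {a : Poly F l m n} (ha : a ≠ 0) :
    ∃ g : Poly F l m n, ord.Monic g ∧ g ∣ a ∧
      (∀ S : Subfield (RatFun F l m n), (∀ c, algebraMap F (RatFun F l m n) c ∈ S) →
        (∀ p, Irreducible p → Pr p → algebraMap _ (RatFun F l m n) p ∈ S) →
          algebraMap _ (RatFun F l m n) g ∈ S) ∧
      ∀ p, Irreducible p → (Pr p → multiplicity p g = multiplicity p a) ∧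
        (¬ Pr p → multiplicity p g = 0) := by
  revert ha
  induction a using WfDvdMonoid.induction_on_irreducible with
  | zero => exact fun h => absurd rfl h
  | unit u hu =>
    intro _
    refine ⟨1, ord.monic_one, one_dvd _, fun S _ _ => by simp,
      fun p hp => ?_⟩
    rw [multiplicity_of_one_right hp.not_isUnit, multiplicity_of_isUnit_right hp.not_isUnit hu]
    exact ⟨fun _ => rfl, fun _ => rfl⟩
  | mul a r ha hr ih =>
    intro _
    obtain ⟨g, hg1, hg2, hg3, hg4⟩ := ih ha
    by_cases h : Pr r
    · have hlc : ord.leadingCoeff r ≠ 0 := by simpa using hr.ne_zero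
      have hu : IsUnit (MvPolynomial.C (ord.leadingCoeff r)⁻¹ : Poly F l m n) :=
        (isUnit_iff_ne_zero.2 (inv_ne_zero hlc)).map MvPolynomial.C
      -- Each factor is normalised to leading coefficient one; orders do not see the scalar.
      set r' : Poly F l m n := MvPolynomial.C (ord.leadingCoeff r)⁻¹ * r with hr'
      have hass : Associated r r' := (associated_unit_mul_left r _ hu).symm
      have hrr : Irreducible r' := hass.irreducible hr
      have hmon : ord.Monic r' := by
        rw [MonomialOrder.Monic, hr', MonomialOrder.leadingCoeff_mul, MonomialOrder.leadingCoeff_C,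
          inv_mul_cancel₀ hlc]
      refine ⟨r' * g, hmon.mul hg1, mul_dvd_mul hass.dvd' hg2, fun S hS hS' => ?_, fun p hp => ?_⟩
      · rw [map_mul]
        exact S.mul_mem (hS' _ hrr (hPr _ _ hass h)) (hg3 S hS hS')
      · rw [hp.prime.multiplicity_mul_of_ne_zero hrr.ne_zero
          hg1.ne_zero,
          hp.prime.multiplicity_mul_of_ne_zero hr.ne_zero ha,
          multiplicity_eq_of_associated_right hass]
        refine ⟨fun hPp => by rw [(hg4 p hp).1 hPp], fun hPp => ?_⟩
        rw [(hg4 p hp).2 hPp, add_zero]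
        exact (multiplicity_of_irreducible hp.prime hrr).2 fun hpr =>
          hPp (hPr _ _ (hpr.trans hass.symm).symm h)
    · refine ⟨g, hg1, hg2.mul_left _, hg3, fun p hp => ⟨fun hPp => ?_, (hg4 p hp).2⟩⟩
      rw [hp.prime.multiplicity_mul_of_ne_zero hr.ne_zero ha, (hg4 p hp).1 hPp,
        (multiplicity_of_irreducible hp.prime hr).2 fun hpr => h (hPr _ _ hpr hPp), zero_add]

/-- The part of a nonzero rational function composed of the irreducible factors in a given
class. -/
theorem exists_monic_part (ord : MonomialOrder (Idx l m n)) (Pr : Poly F l m n → Prop)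
    (hPr : ∀ p p', Associated p p' → Pr p → Pr p') {f : RatFun F l m n} (hf : f ≠ 0) :
    ∃ g : RatFun F l m n, g ≠ 0 ∧ IsMonicRat ord g ∧
      (∀ S : Subfield (RatFun F l m n), (∀ c, algebraMap F (RatFun F l m n) c ∈ S) →
        (∀ p, Irreducible p → Pr p → algebraMap _ (RatFun F l m n) p ∈ S) → g ∈ S) ∧
      ∀ p : Poly F l m n, Irreducible p → (Pr p → ordAt p g = ordAt p f) ∧
        (¬ Pr p → ordAt p g = 0) := by
  have hinj : Function.Injective (algebraMap (Poly F l m n) (RatFun F l m n)) :=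
    IsFractionRing.injective _ _
  obtain ⟨d, hd⟩ : ∃ d : Poly F l m n, d = IsFractionRing.den (Poly F l m n) f := ⟨_, rfl⟩
  have hd0 : d ≠ 0 := by rw [hd]; exact nonZeroDivisors.coe_ne_zero _
  have h1 : algebraMap _ (RatFun F l m n) (IsFractionRing.num (Poly F l m n) f) /
      algebraMap _ (RatFun F l m n) d = f := by
    rw [hd, ← IsFractionRing.mk'_eq_div]
    exact IsFractionRing.mk'_num_den (Poly F l m n) f
  have hn0 : IsFractionRing.num (Poly F l m n) f ≠ 0 := by
    intro h0
    rw [h0, map_zero, zero_div] at h1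
    exact hf h1.symm
  have hrel := IsFractionRing.num_den_reduced (Poly F l m n) f
  rw [← hd] at hrel
  obtain ⟨a, ha1, ha2, ha3, ha4⟩ := exists_monic_part_poly ord Pr hPr hn0
  obtain ⟨b, hb1, hb2, hb3, hb4⟩ := exists_monic_part_poly ord Pr hPr hd0
  have ha0 : a ≠ 0 := ha1.ne_zero
  have hb0 : b ≠ 0 := hb1.ne_zero
  refine ⟨algebraMap _ _ a / algebraMap _ _ b,
    div_ne_zero ((map_ne_zero_iff _ hinj).2 ha0) ((map_ne_zero_iff _ hinj).2 hb0),
    ⟨a, b, ha1, hb1, fun c hc hc' => hrel (hc.trans ha2) (hc'.trans hb2), rfl⟩,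
    fun S hS hS' => S.div_mem (ha3 S hS hS') (hb3 S hS hS'), fun p hp => ?_⟩
  rw [ordAt_div hp.prime ha0 hb0]
  refine ⟨fun h => ?_, fun h => ?_⟩
  · rw [(ha4 p hp).1 h, (hb4 p hp).1 h, hd]
    rfl
  · rw [(ha4 p hp).2 h, (hb4 p hp).2 h, sub_self]

/-- A nonzero rational function whose order vanishes at all irreducible polynomials is a
constant. -/
theorem exists_const_of_ordAt_eq_zero {f : RatFun F l m n} (hf : f ≠ 0)
    (h : ∀ p : Poly F l m n, Irreducible p → ordAt p f = 0) :
    ∃ c : F, c ≠ 0 ∧ f = algebraMap F _ c := by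
  obtain ⟨a, rfl⟩ := exists_unit_of_ordAt_eq_zero hf h
  obtain ⟨c, hc, hac⟩ := MvPolynomial.isUnit_iff_eq_C_of_isReduced.1 a.isUnit
  refine ⟨c, hc.ne_zero, ?_⟩
  rw [hac, IsScalarTower.algebraMap_apply F (Poly F l m n)]
  rfl

end Parts

end MixedSystem

namespace MixedSystem

/-! ### Shifts and dilations, and their action on irreducible polynomials. -/

section Operators

variable {F : Type*} [Field F] {l m n : ℕ}

theorem affinePoly_X (s r : Idx l m n) (c : Fˣ) (d : F) :
    affinePoly s c d (MvPolynomial.X r) = if r = s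
      then MvPolynomial.C (c : F) * MvPolynomial.X r + MvPolynomial.C d else MvPolynomial.X r := by
  simp [affinePoly]

theorem affinePoly_C (s : Idx l m n) (c : Fˣ) (d : F) (e : F) :
    affinePoly s c d (MvPolynomial.C e) = MvPolynomial.C e :=
  (affinePoly s c d).commutes e

theorem pderiv_affinePoly (r s : Idx l m n) (c : Fˣ) (d : F) (p : Poly F l m n) :
    MvPolynomial.pderiv r (affinePoly s c d p) =
      MvPolynomial.C (if r = s then (c : F) else 1) *
        affinePoly s c d (MvPolynomial.pderiv r p) := by
  induction p using MvPolynomial.induction_on with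
  | C a => simp [affinePoly_C]
  | add p q hp hq => simp only [map_add, hp, hq, mul_add]
  | mul_X p t hp =>
    simp only [map_mul, Derivation.leibniz, smul_eq_mul, map_add, hp, MvPolynomial.pderiv_X,
      affinePoly_X]
    by_cases hts : t = s
    · subst hts
      by_cases hrt : r = t
      · subst hrt
        simp [MvPolynomial.pderiv_X]
        ring
      · simp [MvPolynomial.pderiv_X, hrt, Ne.symm hrt]
    · by_cases hrt : r = t
      · subst hrt
        simp [hts]
      · simp [hts, Ne.symm hrt, MvPolynomial.pderiv_X]
        ring

theorem affinePoly_comm {s r : Idx l m n} (h : s ≠ r) (c c' : Fˣ) (d d' : F) (p : Poly F l m n) :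
    affinePoly s c d (affinePoly r c' d' p) = affinePoly r c' d' (affinePoly s c d p) := by
  have : ((affinePoly s c d : Poly F l m n ≃ₐ[F] _).toAlgHom.comp (affinePoly r c' d').toAlgHom) =
      (affinePoly r c' d').toAlgHom.comp (affinePoly s c d).toAlgHom := by
    ext t : 1
    by_cases h1 : t = s
    · subst h1
      simp [affinePoly_X, h, affinePoly_C]
    · by_cases h2 : t = r
      · subst h2
        simp [affinePoly_X, h1, affinePoly_C]
      · simp [affinePoly_X, h1, h2]
  exact DFunLike.congr_fun this p

/-- Composition of shifts of one indeterminate. -/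
theorem affinePoly_one_zpow (s : Idx l m n) (N : ℤ) :
    (affinePoly s 1 1 : Poly F l m n ≃ₐ[F] _) ^ N = affinePoly s 1 (N : F) := by
  have hmul : ∀ d d' : F, (affinePoly s 1 d * affinePoly s 1 d' : Poly F l m n ≃ₐ[F] _) =
      affinePoly s 1 (d' + d) := by
    intro d d'
    apply AlgEquiv.coe_toAlgHom_injective
    ext t : 1
    by_cases h1 : t = s
    · subst h1
      simp [affinePoly_X, affinePoly_C]
      ring
    · simp [affinePoly_X, h1]
  let e : Multiplicative F →* (Poly F l m n ≃ₐ[F] Poly F l m n) :=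
    MonoidHom.mk' (fun d => affinePoly s 1 (Multiplicative.toAdd d)) fun a b => by
      rw [hmul, toAdd_mul, add_comm]
  have := map_zpow e (Multiplicative.ofAdd (1 : F)) N
  rw [← ofAdd_zsmul, zsmul_one] at this
  exact this.symm

/-- Composition of dilations of one indeterminate. -/
theorem affinePoly_zero_zpow (s : Idx l m n) (c : Fˣ) (N : ℤ) :
    (affinePoly s c 0 : Poly F l m n ≃ₐ[F] _) ^ N = affinePoly s (c ^ N) 0 := by
  let e : Fˣ →* (Poly F l m n ≃ₐ[F] Poly F l m n) :=
    MonoidHom.mk' (fun d => affinePoly s d 0) fun a b => by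
      apply AlgEquiv.coe_toAlgHom_injective
      ext t : 1
      by_cases h1 : t = s
      · subst h1
        simp [affinePoly_X, affinePoly_C]
        ring
      · simp [affinePoly_X, h1]
  exact (map_zpow e c N).symm

/-- The (`q`-)shift automorphisms of `F[t, x, y]`. -/
noncomputable def genPoly (q : Fin n → Fˣ) : Fin m ⊕ Fin n → Poly F l m n ≃ₐ[F] Poly F l m n
  | Sum.inl j => affinePoly (Sum.inr (Sum.inl j)) 1 1
  | Sum.inr k => affinePoly (Sum.inr (Sum.inr k)) (q k) 0

/-- The operators `σ_j` and `τ_k` as one family of automorphisms of `F(t, x, y)`. -/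
noncomputable def gen (q : Fin n → Fˣ) (s : Fin m ⊕ Fin n) : RatFun F l m n ≃ₐ[F] RatFun F l m n :=
  IsFractionRing.algEquivOfAlgEquiv (genPoly q s : Poly F l m n ≃ₐ[F] Poly F l m n)

theorem gen_inl (q : Fin n → Fˣ) (j : Fin m) : gen (l := l) q (Sum.inl j) = sigma j := rfl

theorem gen_inr (q : Fin n → Fˣ) (k : Fin n) : gen (l := l) (m := m) q (Sum.inr k) = tau q k := rfl

theorem gen_algebraMap (q : Fin n → Fˣ) (s : Fin m ⊕ Fin n) (p : Poly F l m n) :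
    gen q s (algebraMap _ (RatFun F l m n) p) = algebraMap _ _ (genPoly q s p) :=
  IsFractionRing.algEquivOfAlgEquiv_algebraMap _ p

theorem genPoly_eq_affinePoly (q : Fin n → Fˣ) (s : Fin m ⊕ Fin n) :
    ∃ c d, (genPoly q s : Poly F l m n ≃ₐ[F] _) = affinePoly (Sum.inr s) c d := by
  rcases s with j | k
  exacts [⟨_, _, rfl⟩, ⟨_, _, rfl⟩]

theorem genPoly_comm (q : Fin n → Fˣ) (s r : Fin m ⊕ Fin n) (p : Poly F l m n) :
    genPoly q s (genPoly q r p) = genPoly q r (genPoly q s p) := by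
  by_cases h : s = r
  · rw [h]
  · obtain ⟨c, d, hs⟩ := genPoly_eq_affinePoly (l := l) q s
    obtain ⟨c', d', hr⟩ := genPoly_eq_affinePoly (l := l) q r
    rw [hs, hr]
    exact affinePoly_comm (by simpa using h) _ _ _ _ _

theorem gen_comm (q : Fin n → Fˣ) (s r : Fin m ⊕ Fin n) (f : RatFun F l m n) :
    gen q s (gen q r f) = gen q r (gen q s f) := by
  obtain ⟨a, b, hb, rfl⟩ := exists_div f
  simp only [map_div₀, gen_algebraMap, genPoly_comm q s r]

theorem partialDer_algebraMap (s : Idx l m n) (p : Poly F l m n) :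
    partialDer s (algebraMap _ (RatFun F l m n) p) =
      algebraMap _ _ (MvPolynomial.pderiv s p) := by
  change partialFun s _ = _
  simpa using partialFun_div s p 1 one_ne_zero

theorem delta_algebraMap (i : Fin l) (p : Poly F l m n) :
    delta i (algebraMap _ (RatFun F l m n) p) =
      algebraMap _ _ (MvPolynomial.pderiv (Sum.inl i) p) :=
  partialDer_algebraMap _ p

theorem pderiv_genPoly_inl (q : Fin n → Fˣ) (s : Fin m ⊕ Fin n) (i : Fin l) (p : Poly F l m n) :
    MvPolynomial.pderiv (Sum.inl i) (genPoly q s p) =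
      genPoly q s (MvPolynomial.pderiv (Sum.inl i) p) := by
  obtain ⟨c, d, hs⟩ := genPoly_eq_affinePoly (l := l) q s
  rw [hs, pderiv_affinePoly]
  simp

theorem delta_gen (q : Fin n → Fˣ) (s : Fin m ⊕ Fin n) (i : Fin l) (f : RatFun F l m n) :
    delta i (gen q s f) = gen q s (delta i f) := by
  obtain ⟨a, b, hb, rfl⟩ := exists_div f
  simp only [map_div₀, gen_algebraMap, Derivation.leibniz_div, delta_algebraMap, smul_eq_mul,
    pderiv_genPoly_inl, map_sub, map_mul, map_pow, map_inv₀]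

/-- `p` involves the indeterminate `s`. -/
def Involves (s : Idx l m n) (p : Poly F l m n) : Prop := MvPolynomial.pderiv s p ≠ 0

/-- By the chain rule the operators commute with each partial derivative up to a nonzero scalar. -/
theorem involves_genPoly (q : Fin n → Fˣ) (r : Idx l m n) (s : Fin m ⊕ Fin n) (p : Poly F l m n) :
    Involves r (genPoly q s p) ↔ Involves r p := by
  obtain ⟨c, d, hs⟩ := genPoly_eq_affinePoly (l := l) q s
  rw [Involves, Involves, hs, pderiv_affinePoly, not_iff_not, mul_eq_zero, MvPolynomial.C_eq_zero]
  have h : (if r = Sum.inr s then (c : F) else 1) ≠ 0 := by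
    split_ifs <;> simp
  simp [h]

theorem associated_iff_exists_C {p p' : Poly F l m n} :
    Associated p p' ↔ ∃ c : F, c ≠ 0 ∧ p' = MvPolynomial.C c * p := by
  constructor
  · rintro ⟨u, rfl⟩
    obtain ⟨c, hc, hu⟩ := MvPolynomial.isUnit_iff_eq_C_of_isReduced.1 u.isUnit
    exact ⟨c, hc.ne_zero, by rw [hu, mul_comm]⟩
  · rintro ⟨c, hc, rfl⟩
    exact (associated_unit_mul_left _ _ ((isUnit_iff_ne_zero.2 hc).map MvPolynomial.C)).symm

theorem involves_congr {p p' : Poly F l m n} (h : Associated p p') (r : Idx l m n) :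
    Involves r p ↔ Involves r p' := by
  obtain ⟨c, hc, rfl⟩ := associated_iff_exists_C.1 h
  simp [Involves, hc]

theorem ordAt_gen (q : Fin n → Fˣ) (s : Fin m ⊕ Fin n) {p : Poly F l m n} (hp : Irreducible p)
    {f : RatFun F l m n} (hf : f ≠ 0) : ordAt (genPoly q s p) (gen q s f) = ordAt p f :=
  ordAt_map hp.prime (genPoly q s).toRingEquiv (gen q s).toRingEquiv (gen_algebraMap q s) hf

theorem irreducible_map (g : Poly F l m n ≃ₐ[F] Poly F l m n) {p : Poly F l m n}
    (hp : Irreducible p) : Irreducible (g p) :=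
  (MulEquiv.irreducible_iff g).2 hp

/-! Expansion of polynomials in powers of one indeterminate. -/

/-- A polynomial as a polynomial in the indeterminate `s`. -/
noncomputable def slice (s : Idx l m n) : Poly F l m n →ₐ[F] Polynomial (Poly F l m n) :=
  MvPolynomial.aeval fun r => if r = s then Polynomial.X else Polynomial.C (MvPolynomial.X r)

theorem slice_X (s r : Idx l m n) : slice (F := F) s (MvPolynomial.X r) =
    if r = s then Polynomial.X else Polynomial.C (MvPolynomial.X r) := by
  simp [slice]

theorem slice_C (s : Idx l m n) (c : F) :
    slice s (MvPolynomial.C c) = Polynomial.C (MvPolynomial.C c) :=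
  (slice s).commutes c

theorem eval_slice (s : Idx l m n) (p : Poly F l m n) :
    (slice s p).eval (MvPolynomial.X s) = p := by
  induction p using MvPolynomial.induction_on with
  | C a => simp
  | add p q hp hq => simp [hp, hq]
  | mul_X p t hp =>
    rw [map_mul, Polynomial.eval_mul, hp, slice_X]
    split_ifs with h <;> simp [h]

theorem slice_injective (s : Idx l m n) : Function.Injective (slice (F := F) s) := by
  intro p p' h
  rw [← eval_slice s p, h, eval_slice]

theorem slice_pderiv (s : Idx l m n) (p : Poly F l m n) :
    slice s (MvPolynomial.pderiv s p) = Polynomial.derivative (slice s p) := by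
  induction p using MvPolynomial.induction_on with
  | C a => simp
  | add p q hp hq => simp [hp, hq]
  | mul_X p t hp =>
    simp only [Derivation.leibniz, smul_eq_mul, map_add, map_mul, hp, Polynomial.derivative_mul,
      slice_X, MvPolynomial.pderiv_X, Pi.single_apply]
    by_cases h : t = s
    · simp [h]; ring
    · simp [h]; ring

theorem slice_affinePoly_self (s : Idx l m n) (c : Fˣ) (d : F) (p : Poly F l m n) :
    slice s (affinePoly s c d p) = (slice s p).comp
      (Polynomial.C (MvPolynomial.C (c : F)) * Polynomial.X + Polynomial.C (MvPolynomial.C d)) := by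
  induction p using MvPolynomial.induction_on with
  | C a => simp [affinePoly_C]
  | add p q hp hq => simp [hp, hq]
  | mul_X p t hp =>
    rw [map_mul, map_mul, map_mul, hp, Polynomial.mul_comp, affinePoly_X, slice_X]
    by_cases h : t = s
    · simp [h, slice_X]
    · simp [h, slice_X]

theorem slice_affinePoly_of_ne {s r : Idx l m n} (h : r ≠ s) (c : Fˣ) (d : F) (p : Poly F l m n) :
    slice s (affinePoly r c d p) =
      (slice s p).map ((affinePoly r c d).toAlgHom : Poly F l m n →+* Poly F l m n) := by
  induction p using MvPolynomial.induction_on with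
  | C a => simp [affinePoly_C]
  | add p q hp hq => simp [hp, hq]
  | mul_X p t hp =>
    rw [map_mul, map_mul, map_mul, hp, Polynomial.map_mul, affinePoly_X, slice_X]
    by_cases h1 : t = s
    · have : s ≠ r := h.symm
      simp [h1, slice_X, this]
    · by_cases h2 : t = r
      · simp [slice_X, h2, h, affinePoly_X]
      · simp [slice_X, h1, h2, affinePoly_X]

/-- In characteristic zero only polynomials of degree zero in `s` have zero derivative, so
involvement can be read off from a degree. -/
theorem not_involves_iff [CharZero F] (s : Idx l m n) (p : Poly F l m n) :
    ¬ Involves s p ↔ (slice s p).natDegree = 0 := by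
  rw [Involves, not_not]
  constructor
  · intro h
    apply Polynomial.derivative_eq_zero.1
    rw [← slice_pderiv, h, map_zero]
  · intro h
    apply slice_injective s
    rw [slice_pderiv, map_zero, Polynomial.eq_C_of_natDegree_eq_zero h, Polynomial.derivative_C]

/-- A polynomial in which no indeterminate outside of `S` occurs. -/
theorem mem_supported_of_not_involves [CharZero F] (S : Set (Idx l m n)) (p : Poly F l m n)
    (h : ∀ s ∉ S, ¬ Involves s p) : p ∈ MvPolynomial.supported F S := by
  rw [MvPolynomial.mem_supported]
  intro s hs
  by_contra hsS
  have hs' := h s hsS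
  rw [Involves, not_not] at hs'
  obtain ⟨d, hd, hds⟩ := (MvPolynomial.mem_vars_iff_mem_support s).1 hs
  have h1 := MvPolynomial.coeff_pderiv (i := s) p (d - Finsupp.single s 1)
  have h2 : d - Finsupp.single s 1 + Finsupp.single s 1 = d := by
    apply tsub_add_cancel_of_le
    rw [Finsupp.single_le_iff]
    exact Nat.one_le_iff_ne_zero.2 (Finsupp.mem_support_iff.1 hds)
  rw [hs', MvPolynomial.coeff_zero, h2] at h1
  rcases mul_eq_zero.1 h1.symm with h3 | h3
  · exact MvPolynomial.mem_support_iff.1 hd h3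
  · exact Nat.cast_add_one_ne_zero _ h3

/-- A polynomial which is multiplied by a constant under a shift of `s` is fixed. -/
theorem eq_one_of_shift_eq_C_mul [CharZero F] {s : Idx l m n} {d c : F} {p : Poly F l m n}
    (hp : p ≠ 0) (h : affinePoly s 1 d p = MvPolynomial.C c * p) :
    c = 1 ∧ (d ≠ 0 → ¬ Involves s p) := by
  have h1 := congrArg (slice s) h
  rw [slice_affinePoly_self, map_mul, slice_C] at h1
  have hsp : slice s p ≠ 0 := fun h0 => hp (slice_injective s (by rw [h0, map_zero]))
  have hc : c = 1 := by
    -- A shift does not change the leading coefficient with respect to `s`.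
    have h2 := congrArg Polynomial.leadingCoeff h1
    rw [Polynomial.leadingCoeff_comp (by simp), Polynomial.leadingCoeff_mul] at h2
    simp only [Units.val_one, MvPolynomial.C_1, Polynomial.C_1, one_mul,
      Polynomial.leadingCoeff_X_add_C, one_pow, mul_one, Polynomial.leadingCoeff_C] at h2
    have h3 : (MvPolynomial.C c : Poly F l m n) = 1 :=
      (mul_eq_right₀ (Polynomial.leadingCoeff_ne_zero.2 hsp)).1 h2.symm
    rw [← MvPolynomial.C_1] at h3
    exact MvPolynomial.C_injective _ _ h3
  refine ⟨hc, fun hd => ?_⟩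
  rw [not_involves_iff]
  subst hc
  simp only [Units.val_one, MvPolynomial.C_1, Polynomial.C_1, one_mul] at h1
  -- Periodicity: the values at the infinitely many points `N d` agree, so the polynomial in `s` is
  -- constant.
  have h2 : ∀ N : ℕ, (slice s p).eval (MvPolynomial.C (N * d)) = (slice s p).eval 0 := by
    intro N
    induction N with
    | zero => simp
    | succ N ih =>
      rw [← ih, ← congrArg (Polynomial.eval (MvPolynomial.C (N * d))) h1, Polynomial.eval_comp]
      simp [add_mul]
  have h3 : slice s p = Polynomial.C ((slice s p).eval 0) := by
    apply Polynomial.eq_of_infinite_eval_eq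
    refine (Set.infinite_range_of_injective
      (f := fun N : ℕ => (MvPolynomial.C (N * d) : Poly F l m n)) ?_).mono ?_
    · intro N N' hN
      have := MvPolynomial.C_injective _ _ hN
      exact_mod_cast mul_right_cancel₀ hd this
    · rintro _ ⟨N, rfl⟩
      simp only [Set.mem_ofPred_eq, h2, Polynomial.eval_C]
  rw [h3, Polynomial.natDegree_C]

/-- Shifts of an irreducible polynomial which involves the shifted indeterminate are not
associated. -/
theorem eq_zero_of_associated_shift [CharZero F] (q : Fin n → Fˣ) {j : Fin m} {p : Poly F l m n}
    (hp : Irreducible p) (hj : Involves (Sum.inr (Sum.inl j)) p) {N : ℤ}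
    (h : Associated p ((genPoly q (Sum.inl j) ^ N) p)) : N = 0 := by
  obtain ⟨c, hc, h1⟩ := associated_iff_exists_C.1 h
  rw [genPoly, affinePoly_one_zpow] at h1
  by_contra hN
  exact (eq_one_of_shift_eq_C_mul hp.ne_zero h1).2 (by exact_mod_cast hN) hj

/-- Combined shifts and dilations of an irreducible polynomial which involves `y_k` are not
associated, unless the dilation is trivial. -/
theorem eq_zero_of_associated_of_coeff [CharZero F] {q : Fin n → Fˣ}
    (hq : ∀ k, ∀ N : ℕ, 0 < N → q k ^ N ≠ 1) {k : Fin n} {p : Poly F l m n}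
    (hp : Irreducible p) (hk : Involves (Sum.inr (Sum.inr k)) p)
    (hpX : ¬ Associated p (MvPolynomial.X (Sum.inr (Sum.inr k))))
    (ψ : Poly F l m n ≃ₐ[F] Poly F l m n)
    (hψ1 : ∀ p, slice (Sum.inr (Sum.inr k)) (ψ p) =
      (slice (Sum.inr (Sum.inr k)) p).map (ψ.toAlgHom : Poly F l m n →+* Poly F l m n))
    (hψ2 : ∀ p c, p ≠ 0 → ψ p = MvPolynomial.C c * p → c = 1) {N : ℤ}
    (h : Associated p (ψ ((genPoly q (Sum.inr k) ^ N) p))) : N = 0 := by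
  obtain ⟨c, hc, h1⟩ := associated_iff_exists_C.1 h
  rw [genPoly, affinePoly_zero_zpow] at h1
  set s : Idx l m n := Sum.inr (Sum.inr k) with hs
  have h2 := congrArg (slice s) h1
  rw [hψ1, slice_affinePoly_self, map_mul, slice_C, MvPolynomial.C_0, Polynomial.C_0, add_zero]
    at h2
  -- Comparing coefficients of `y_k ^ e`: `ψ` multiplies each nonzero coefficient by a scalar, which
  -- `hψ2` forces to be one. Hence `c = q_k ^ (N e)` for every exponent `e` that occurs.
  have h3 : ∀ e, (slice s p).coeff e ≠ 0 → (c = ((q k ^ N) ^ e : Fˣ)) := by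
    intro e he
    have h4 := congrArg (fun P => Polynomial.coeff P e) h2
    simp only [Polynomial.coeff_map, Polynomial.comp_C_mul_X_coeff, Polynomial.coeff_C_mul,
      map_mul, map_pow] at h4
    have h5 : ψ ((slice s p).coeff e) =
        MvPolynomial.C (c * (((q k ^ N) ^ e : Fˣ) : F)⁻¹) * (slice s p).coeff e := by
      have h6 : ψ (MvPolynomial.C ((q k ^ N : Fˣ) : F)) = MvPolynomial.C ((q k ^ N : Fˣ) : F) :=
        ψ.commutes _
      have h7 : (MvPolynomial.C (((q k ^ N : Fˣ) : F) ^ e) : Poly F l m n) *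
          MvPolynomial.C ((((q k ^ N : Fˣ) : F) ^ e)⁻¹) = 1 := by
        rw [← MvPolynomial.C_mul, mul_inv_cancel₀ (pow_ne_zero _ (Units.ne_zero _)),
            MvPolynomial.C_1]
      have h4' : ψ ((slice s p).coeff e) * (MvPolynomial.C (((q k ^ N : Fˣ) : F) ^ e)) =
          MvPolynomial.C c * (slice s p).coeff e := by
        rw [← h4, MvPolynomial.C_pow]
        exact congrArg (fun z => ψ ((slice s p).coeff e) * z ^ e) h6.symm
      rw [MvPolynomial.C_mul, Units.val_pow_eq_pow_val]
      linear_combination (MvPolynomial.C ((((q k ^ N : Fˣ) : F) ^ e)⁻¹)) * h4' -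
        ψ ((slice s p).coeff e) * h7
    have h8 := hψ2 _ _ he h5
    field_simp at h8
    exact h8
  by_contra hN
  -- For `N ≠ 0` these scalars differ for different `e`, as `q_k` is no root of unity. So only one
  -- power of `y_k` occurs, it is not the zeroth, and `y_k` divides the irreducible `p`.
  have huniq : ∀ e e', (slice s p).coeff e ≠ 0 → (slice s p).coeff e' ≠ 0 → e = e' := by
    intro e e' he he'
    by_contra hee
    have h4 := (h3 e he).symm.trans (h3 e' he')
    have h5 : (q k ^ N) ^ e = (q k ^ N) ^ e' := Units.ext h4
    rw [← zpow_natCast, ← zpow_natCast, ← zpow_mul, ← zpow_mul] at h5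
    have h6 : q k ^ (N * e - N * e') = 1 := by rw [zpow_sub, h5, mul_inv_cancel]
    have h7 : N * e - N * e' ≠ 0 := by
      rw [← mul_sub]
      exact mul_ne_zero hN (by omega)
    have h8 : q k ^ (N * e - N * e').natAbs = 1 := by
      rw [← zpow_natCast, Int.natCast_natAbs]
      rcases abs_choice (N * e - N * e' : ℤ) with h | h <;> rw [h]
      · exact h6
      · rw [zpow_neg, h6, inv_one]
    exact hq k _ (Int.natAbs_pos.2 h7) h8
  have hd : (slice s p).natDegree ≠ 0 := fun h0 => (not_involves_iff s p).2 h0 hk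
  have hlc : (slice s p).coeff (slice s p).natDegree ≠ 0 := by
    rw [Polynomial.coeff_natDegree, Polynomial.leadingCoeff_ne_zero]
    intro h0
    rw [h0] at hd
    simp at hd
  have h0 : (slice s p).coeff 0 = 0 := by
    by_contra h0
    exact hd (huniq _ _ hlc h0)
  obtain ⟨P, hP⟩ := Polynomial.X_dvd_iff.2 h0
  have h4 : MvPolynomial.X s ∣ p := by
    refine ⟨P.eval (MvPolynomial.X s), ?_⟩
    conv_lhs => rw [← eval_slice s p, hP]
    simp
  exact hpX ((MvPolynomial.X_prime.irreducible.associated_of_dvd hp h4).symm)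

theorem eq_zero_of_associated_dilation [CharZero F] {q : Fin n → Fˣ}
    (hq : ∀ k, ∀ N : ℕ, 0 < N → q k ^ N ≠ 1) {k : Fin n} {p : Poly F l m n}
    (hp : Irreducible p) (hk : Involves (Sum.inr (Sum.inr k)) p)
    (hpX : ¬ Associated p (MvPolynomial.X (Sum.inr (Sum.inr k)))) {N : ℤ}
    (h : Associated p ((genPoly q (Sum.inr k) ^ N) p)) : N = 0 := by
  refine eq_zero_of_associated_of_coeff hq hp hk hpX AlgEquiv.refl (fun p => ?_)
    (fun p c hp h => ?_) h
  · exact (Polynomial.map_id).symm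
  · have h' : MvPolynomial.C c * p = 1 * p := by rw [one_mul]; exact h.symm
    have h3 := mul_right_cancel₀ hp h'
    rw [← MvPolynomial.C_1] at h3
    exact MvPolynomial.C_injective _ _ h3

/-- It separates the `σ_j`-orbits of the `τ_k`-translates of `p`. A shift of `x_j` acts on the
coefficients in `y_k` and has no eigenvalue other than one. -/
theorem eq_zero_of_associated_shift_dilation [CharZero F] {q : Fin n → Fˣ}
    (hq : ∀ k, ∀ N : ℕ, 0 < N → q k ^ N ≠ 1) {j : Fin m} {k : Fin n} {p : Poly F l m n}
    (hp : Irreducible p) (hk : Involves (Sum.inr (Sum.inr k)) p)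
    (hpX : ¬ Associated p (MvPolynomial.X (Sum.inr (Sum.inr k)))) {M N : ℤ}
    (h : Associated p ((genPoly q (Sum.inl j) ^ M) ((genPoly q (Sum.inr k) ^ N) p))) : N = 0 := by
  refine eq_zero_of_associated_of_coeff hq hp hk hpX _ (fun p => ?_) (fun p c hp h => ?_) h
  · rw [genPoly, affinePoly_one_zpow]
    exact slice_affinePoly_of_ne (by simp) _ _ p
  · rw [genPoly, affinePoly_one_zpow] at h
    exact (eq_one_of_shift_eq_C_mul hp h).1

end Operators

end MixedSystem

namespace MixedSystem

/-! ### Orders of the certificates along orbits. -/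

section Descent

variable {F : Type*} [Field F] {l m n : ℕ}

/-- Compatible systems, with the `σ_j` and the `τ_k` treated alike. -/
structure IsGenSystem (q : Fin n → Fˣ) (U : Fin l → RatFun F l m n)
    (C : Fin m ⊕ Fin n → RatFun F l m n) : Prop where
  ne_zero : ∀ s, C s ≠ 0
  comm : ∀ s r, gen q s (C r) * C s = gen q r (C s) * C r
  delta_eq : ∀ i s, delta i (C s) / C s = gen q s (U i) - U i

theorem logDeriv_mul (i : Fin l) {f g : RatFun F l m n} (hf : f ≠ 0) (hg : g ≠ 0) :
    delta i (f * g) / (f * g) = delta i f / f + delta i g / g := by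
  rw [Derivation.leibniz, smul_eq_mul, smul_eq_mul]
  field_simp
  ring

theorem logDeriv_inv (i : Fin l) {f : RatFun F l m n} (hf : f ≠ 0) :
    delta i f⁻¹ / f⁻¹ = -(delta i f / f) := by
  have h := logDeriv_mul i hf (inv_ne_zero hf)
  rw [mul_inv_cancel₀ hf, Derivation.map_one_eq_zero, zero_div] at h
  linear_combination -h

theorem logDeriv_div (i : Fin l) {f g : RatFun F l m n} (hf : f ≠ 0) (hg : g ≠ 0) :
    delta i (f / g) / (f / g) = delta i f / f - delta i g / g := by
  rw [div_eq_mul_inv f g, logDeriv_mul i hf (inv_ne_zero hg), logDeriv_inv i hg, sub_eq_add_neg]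

theorem gen_ne_zero (q : Fin n → Fˣ) (s : Fin m ⊕ Fin n) {f : RatFun F l m n} (hf : f ≠ 0) :
    gen q s f ≠ 0 := by simpa using hf

/-- These are the certificates of `f z` when `z` solves the given system. The new factors are
compatible because the operators commute on rational functions. -/
theorem IsGenSystem.gauge {q : Fin n → Fˣ} {U : Fin l → RatFun F l m n}
    {C : Fin m ⊕ Fin n → RatFun F l m n} (h : IsGenSystem q U C) {f : RatFun F l m n}
    (hf : f ≠ 0) :
    IsGenSystem q (fun i => U i + delta i f / f) (fun s => C s * (gen q s f / f)) where
  ne_zero s := mul_ne_zero (h.ne_zero s) (div_ne_zero (gen_ne_zero q s hf) hf)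
  comm s r := by
    have h1 := h.comm s r
    have h2 := gen_comm q s r f
    have hs := gen_ne_zero q s hf
    have hr := gen_ne_zero q r hf
    simp only [map_mul, map_div₀]
    rw [h2]
    field_simp
    linear_combination (gen q r (gen q s f)) * h1
  delta_eq i s := by
    rw [logDeriv_mul i (h.ne_zero s) (div_ne_zero (gen_ne_zero q s hf) hf), h.delta_eq,
      logDeriv_div i (gen_ne_zero q s hf) hf, delta_gen, map_add, map_div₀]
    ring

/-- The product `c γ(c) ⋯ γ^(N-1)(c)`. -/
noncomputable def orbitProd {K : Type*} [Field K] (γ : K → K) (c : K) : ℕ → K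
  | 0 => 1
  | N + 1 => c * γ (orbitProd γ c N)

theorem orbitProd_ne_zero (q : Fin n → Fˣ) (s : Fin m ⊕ Fin n) {c : RatFun F l m n} (hc : c ≠ 0)
    (N : ℕ) : orbitProd (gen q s) c N ≠ 0 := by
  induction N with
  | zero => exact one_ne_zero
  | succ N ih => exact mul_ne_zero hc (gen_ne_zero q s ih)

/-- If `γ z = c z`, then `orbitProd γ c N` is the factor by which `γ^N` multiplies `z`. The
condition linking `δ_i` and `γ` therefore telescopes to the one linking `δ_i` and `γ^N`. -/
theorem delta_iterate_gen (q : Fin n → Fˣ) (s : Fin m ⊕ Fin n) (i : Fin l) {c u : RatFun F l m n}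
    (hc : c ≠ 0) (h : delta i c / c = gen q s u - u) (N : ℕ) :
    delta i (orbitProd (gen q s) c N) / orbitProd (gen q s) c N = (gen q s)^[N] u - u := by
  induction N with
  | zero => simp [orbitProd]
  | succ N ih =>
    have h0 := orbitProd_ne_zero q s hc N
    rw [orbitProd, logDeriv_mul i hc (gen_ne_zero q s h0), delta_gen, ← map_div₀, ih, h, map_sub,
      Function.iterate_succ_apply']
    ring

/-- The compatibility of `γ_s` and `γ_r`, passed on to `γ_s^N` and `γ_r`. -/
theorem gen_orbitProd (q : Fin n → Fˣ) (s r : Fin m ⊕ Fin n) {c b : RatFun F l m n}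
    (h : gen q s b * c = gen q r c * b) (N : ℕ) :
    gen q r (orbitProd (gen q s) c N) * b = (gen q s)^[N] b * orbitProd (gen q s) c N := by
  induction N with
  | zero => simp [orbitProd]
  | succ N ih =>
    have ih' := congrArg (gen q s) ih
    rw [map_mul, map_mul] at ih'
    rw [orbitProd, map_mul, gen_comm q r s, Function.iterate_succ_apply']
    linear_combination c * ih' - gen q s (gen q r (orbitProd (gen q s) c N)) * h

theorem genPoly_zpow_add_one (q : Fin n → Fˣ) (s : Fin m ⊕ Fin n) (e : ℤ) (p : Poly F l m n) :
    genPoly q s ((genPoly q s ^ e) p) = (genPoly q s ^ (e + 1)) p := by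
  rw [add_comm, zpow_add, zpow_one, AlgEquiv.mul_apply]

theorem ordAt_zpow_gen (q : Fin n → Fˣ) (s : Fin m ⊕ Fin n) {p : Poly F l m n} (hp : Irreducible p)
    {f : RatFun F l m n} (hf : f ≠ 0) (e : ℤ) :
    ordAt ((genPoly q s ^ e) p) (gen q s f) = ordAt ((genPoly q s ^ (e - 1)) p) f := by
  rw [← ordAt_gen q s (irreducible_map _ hp) hf, genPoly_zpow_add_one, sub_add_cancel]

theorem ordAt_iterate_gen (q : Fin n → Fˣ) (s : Fin m ⊕ Fin n) {p : Poly F l m n}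
    (hp : Irreducible p) {f : RatFun F l m n} (hf : f ≠ 0) (N : ℕ) (e : ℤ) :
    ordAt ((genPoly q s ^ e) p) ((gen q s)^[N] f) = ordAt ((genPoly q s ^ (e - N)) p) f := by
  have hne : ∀ N : ℕ, (gen q s)^[N] f ≠ 0 := by
    intro N
    induction N with
    | zero => exact hf
    | succ N ih =>
      rw [Function.iterate_succ_apply']
      exact gen_ne_zero q s ih
  induction N generalizing e with
  | zero => simp
  | succ N ih =>
    rw [Function.iterate_succ_apply', ordAt_zpow_gen q s hp (hne N), ih]
    congr 3
    push_cast
    ring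

/-- Each application of `γ_s` moves the point of the orbit back by one, so the order is the sum over
the window `e, e - 1, …, e - N + 1`. -/
theorem ordAt_orbitProd (q : Fin n → Fˣ) (s : Fin m ⊕ Fin n) {p : Poly F l m n}
    (hp : Irreducible p) {c : RatFun F l m n} (hc : c ≠ 0) (N : ℕ) (e : ℤ) :
    ordAt ((genPoly q s ^ e) p) (orbitProd (gen q s) c N) =
      ∑ i ∈ Finset.range N, ordAt ((genPoly q s ^ (e - i)) p) c := by
  induction N generalizing e with
  | zero => simp [orbitProd, ordAt_one (irreducible_map _ hp).prime]
  | succ N ih =>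
    have h0 := orbitProd_ne_zero q s hc N
    rw [orbitProd, ordAt_mul (irreducible_map _ hp).prime hc (gen_ne_zero q s h0),
      ordAt_zpow_gen q s hp h0, ih, Finset.sum_range_succ', add_comm]
    congr 1
    · refine Finset.sum_congr rfl fun i _ => ?_
      congr 3
      push_cast
      ring
    · simp

/-- The translates of `p` under the powers of `g` are pairwise non-associated. -/
def InfOrbit (g : Poly F l m n ≃ₐ[F] Poly F l m n) (p : Poly F l m n) : Prop :=
  ∀ N : ℤ, Associated p ((g ^ N) p) → N = 0

theorem associated_map (g : Poly F l m n ≃ₐ[F] Poly F l m n) {p p' : Poly F l m n}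
    (h : Associated p p') : Associated (g p) (g p') :=
  h.map (g : Poly F l m n →* Poly F l m n)

theorem InfOrbit.inj {g : Poly F l m n ≃ₐ[F] Poly F l m n} {p : Poly F l m n}
    (h : InfOrbit g p) (i j : ℤ) (hij : Associated ((g ^ i) p) ((g ^ j) p)) : i = j := by
  have h1 := associated_map (g ^ (-i)) hij
  rw [← AlgEquiv.mul_apply, ← AlgEquiv.mul_apply, ← zpow_add, ← zpow_add, neg_add_cancel,
    zpow_zero, AlgEquiv.one_apply] at h1
  have := h _ h1
  omega

theorem InfOrbit.eventually_of_finite {P : ℤ → Prop} (h : {i | P i}.Finite) :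
    ∀ᶠ L : ℕ in Filter.atTop, ¬ P L ∧ ¬ P (-L) := by
  have h1 : {L : ℕ | P L}.Finite :=
    h.preimage (f := fun L : ℕ => (L : ℤ)) (Nat.cast_injective.injOn)
  have h2 : {L : ℕ | P (-L)}.Finite :=
    h.preimage (f := fun L : ℕ => -(L : ℤ)) ((neg_injective.comp Nat.cast_injective).injOn)
  rw [← Nat.cofinite_eq_atTop]
  exact (h1.eventually_cofinite_notMem).and h2.eventually_cofinite_notMem

/-- Along an infinite orbit the order is a function on `ℤ` with finite support; a constant one
vanishes. -/
theorem InfOrbit.ordAt_eq_zero {g : Poly F l m n ≃ₐ[F] Poly F l m n} {p : Poly F l m n}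
    (hp : Irreducible p) (h : InfOrbit g p) {f : RatFun F l m n} (hf : f ≠ 0)
    (hc : ∀ i : ℤ, ordAt ((g ^ i) p) f = ordAt p f) : ordAt p f = 0 := by
  have hfin := finite_setOf_ordAt_ne_zero (fun i : ℤ => irreducible_map (g ^ i) hp) h.inj hf
  obtain ⟨L, hL, -⟩ := (InfOrbit.eventually_of_finite hfin).exists
  rw [← hc L]
  exact not_not.1 hL

/-- The order of the products over long symmetric windows does not vanish. -/
def WindowNeZero (q : Fin n → Fˣ) (s : Fin m ⊕ Fin n) (c : RatFun F l m n) (p : Poly F l m n) :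
    Prop :=
  ∀ᶠ L : ℕ in Filter.atTop,
    ordAt ((genPoly q s ^ (L : ℤ)) p) (orbitProd (gen q s) c (2 * L)) ≠ 0

/-- The window of length `2 L` that ends at `L` eventually covers every nonzero order along an
infinite orbit, so `WindowNeZero` asserts a nonzero orbit sum. If no order had the sign opposite to
that of `p`, multiplying the sum by `ordAt p c` would give nonnegative terms and one positive
square. -/
theorem exists_opposite_sign {q : Fin n → Fˣ} {s : Fin m ⊕ Fin n} {c : RatFun F l m n}
    (hc : c ≠ 0) {p : Poly F l m n} (hp : Irreducible p) (h : ¬ WindowNeZero q s c p)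
    (h0 : ordAt p c ≠ 0) : ∃ k : ℤ, ordAt p c * ordAt ((genPoly q s ^ k) p) c < 0 := by
  by_contra! hk
  apply h
  -- From `L = 1` on, the window contains the index zero, which is the term `i = L`.
  filter_upwards [Filter.eventually_ge_atTop 1] with L hL hzero
  rw [ordAt_orbitProd q s hp hc] at hzero
  have h1 : 0 < ∑ i ∈ Finset.range (2 * L),
      ordAt p c * ordAt ((genPoly q s ^ ((L : ℤ) - i)) p) c := by
    refine Finset.sum_pos' (fun i _ => hk _) ⟨L, Finset.mem_range.2 (by omega), ?_⟩
    rw [sub_self, zpow_zero, AlgEquiv.one_apply]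
    exact mul_self_pos.2 h0
  rw [← Finset.mul_sum, hzero, mul_zero] at h1
  exact lt_irrefl _ h1

/-- The derivative is nonzero and of smaller degree in `s`. -/
theorem not_dvd_pderiv [CharZero F] {s : Idx l m n} {p : Poly F l m n} (h : Involves s p) :
    ¬ p ∣ MvPolynomial.pderiv s p := by
  intro hd
  have h1 : slice s p ∣ Polynomial.derivative (slice s p) := by
    rw [← slice_pderiv]
    exact map_dvd _ hd
  have h2 : (slice s p).natDegree ≠ 0 := fun h0 => (not_involves_iff s p).2 h0 h
  have h3 : Polynomial.derivative (slice s p) ≠ 0 := by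
    rw [← slice_pderiv]
    exact fun h0 => h (slice_injective s (by rw [h0, map_zero]))
  exact absurd (Polynomial.natDegree_le_of_dvd h1 h3)
    (not_le.2 (Polynomial.natDegree_derivative_lt h2))

/-- A logarithmic derivative has a pole at the zeros and poles which depend on `t_i`. -/
theorem ordAt_eq_zero_of_logDeriv [CharZero F] {i : Fin l} {p : Poly F l m n} (hp : Irreducible p)
    (hi : Involves (Sum.inl i) p) {f : RatFun F l m n} (hf : f ≠ 0) {a b : Poly F l m n}
    (hb : ¬ p ∣ b) (h : delta i f / f = algebraMap _ _ a / algebraMap _ _ b) : ordAt p f = 0 := by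
  have hinj : Function.Injective (algebraMap (Poly F l m n) (RatFun F l m n)) :=
    IsFractionRing.injective _ _
  obtain ⟨c, d, hc, hd, hfe⟩ := exists_eq_zpow_mul_div hp.prime hf
  set N := ordAt p f with hN
  have ne : ∀ {z : Poly F l m n}, ¬ p ∣ z → algebraMap _ (RatFun F l m n) z ≠ 0 := by
    intro z hz h0
    rw [map_eq_zero_iff _ hinj] at h0
    exact hz (h0 ▸ dvd_zero _)
  have hp' : algebraMap _ (RatFun F l m n) p ≠ 0 := (map_ne_zero_iff _ hinj).2 hp.ne_zero
  have hc' := ne hc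
  have hd' := ne hd
  have hb' := ne hb
  have hz : ∀ N : ℤ, delta i (algebraMap _ (RatFun F l m n) p ^ N) /
      algebraMap _ (RatFun F l m n) p ^ N = N * (delta i (algebraMap _ (RatFun F l m n) p) /
      algebraMap _ (RatFun F l m n) p) := by
    intro N
    rw [Derivation.leibniz_zpow, zpow_sub_one₀ hp']
    have := zpow_ne_zero N hp'
    simp only [smul_eq_mul, zsmul_eq_mul]
    field_simp
  rw [hfe, logDeriv_mul i (zpow_ne_zero _ hp') (div_ne_zero hc' hd'), hz,
    logDeriv_div i hc' hd', delta_algebraMap, delta_algebraMap, delta_algebraMap] at h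
  by_contra hN0
  have h1 : (N : RatFun F l m n) = algebraMap _ _ (N : Poly F l m n) := by simp
  rw [h1] at h
  field_simp at h
  simp only [← map_mul, ← map_add, ← map_sub] at h
  have h2 := hinj h
  -- Writing `f = p^N c/d`, the term `N δ_i(p)/p` is the only one that could have a pole at `p`.
  -- After clearing denominators `p` divides a product none of whose factors it divides.
  have h3 : p ∣ (N : Poly F l m n) * MvPolynomial.pderiv (Sum.inl i) p * c * d * b := by
    refine ⟨c * d * a - b * (MvPolynomial.pderiv (Sum.inl i) c * d -
      c * MvPolynomial.pderiv (Sum.inl i) d), ?_⟩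
    linear_combination h2
  rcases hp.prime.dvd_or_dvd h3 with h3 | h3
  · rcases hp.prime.dvd_or_dvd h3 with h3 | h3
    · rcases hp.prime.dvd_or_dvd h3 with h3 | h3
      · rcases hp.prime.dvd_or_dvd h3 with h3 | h3
        · refine hp.not_isUnit (isUnit_of_dvd_unit h3 ?_)
          have : (N : Poly F l m n) = MvPolynomial.C (N : F) := by simp
          rw [this]
          exact (isUnit_iff_ne_zero.2 (by exact_mod_cast hN0)).map MvPolynomial.C
        · exact not_dvd_pderiv hi h3
      · exact hc h3
    · exact hd h3
  · exact hb h3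

/-- The product over the window has logarithmic derivative `γ^{2L}(u_i) - u_i`. Its possible poles
come from the denominator `b` of `u_i` and its translate by `2 L`, and for large `L` both stay away
from the point `g^L p`, where a nonzero order would produce a pole. -/
theorem not_windowNeZero_of_involves [CharZero F] {q : Fin n → Fˣ} {U : Fin l → RatFun F l m n}
    {C : Fin m ⊕ Fin n → RatFun F l m n} (h : IsGenSystem q U C) {s : Fin m ⊕ Fin n}
    {p : Poly F l m n} (hp : Irreducible p) {i : Fin l} (hi : Involves (Sum.inl i) p)
    (hinf : InfOrbit (genPoly q s) p) : ¬ WindowNeZero q s (C s) p := by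
  intro hw
  have hinj : Function.Injective (algebraMap (Poly F l m n) (RatFun F l m n)) :=
    IsFractionRing.injective _ _
  obtain ⟨a, b, hb, hab⟩ := exists_div (U i)
  have hfin := finite_setOf_dvd (fun i : ℤ => irreducible_map (genPoly q s ^ i) hp) hinf.inj hb
  -- `L` is so large that neither `g^L p` nor `g^{-L} p` divides `b`.
  obtain ⟨L, hL, hL1, hL2⟩ := (hw.and (InfOrbit.eventually_of_finite hfin)).exists
  set g := genPoly (l := l) q s with hg
  have hiter : ∀ (N : ℕ) (z : Poly F l m n), (gen q s)^[N] (algebraMap _ (RatFun F l m n) z) =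
      algebraMap _ _ ((g ^ (N : ℤ)) z) := by
    intro N z
    induction N with
    | zero => simp
    | succ N ih =>
      rw [Function.iterate_succ_apply', ih, gen_algebraMap, genPoly_zpow_add_one]
      push_cast
      rfl
  have hiterdiv : ∀ (N : ℕ) (x y : RatFun F l m n),
      (gen q s)^[N] (x / y) = (gen q s)^[N] x / (gen q s)^[N] y := by
    intro N
    induction N with
    | zero => intro x y; rfl
    | succ N ih => intro x y; simp only [Function.iterate_succ_apply, map_div₀, ih]
  have h1 := delta_iterate_gen q s i (h.ne_zero s) (h.delta_eq i s) (2 * L)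
  rw [hab, hiterdiv, hiter, hiter, div_sub_div _ _
    ((map_ne_zero_iff _ hinj).2 (by simpa using hb)) ((map_ne_zero_iff _ hinj).2 hb), ← map_mul,
    ← map_mul, ← map_mul, ← map_sub] at h1
  refine hL (ordAt_eq_zero_of_logDeriv (irreducible_map _ hp) ?_
    (orbitProd_ne_zero q s (h.ne_zero s) _) ?_ h1)
  · have : ∀ N : ℕ, Involves (Sum.inl i) ((g ^ (N : ℤ)) p) := by
      intro N
      induction N with
      | zero => simpa using hi
      | succ N ih =>
        push_cast
        rw [← genPoly_zpow_add_one, involves_genPoly]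
        exact ih
    exact this L
  · intro hd
    rcases (irreducible_map _ hp).prime.dvd_or_dvd hd with hd | hd
    · apply hL2
      -- If `g^L p` divides `g^{2L} b`, then `g^{-L} p` divides `b`.
      have h2 := map_dvd (g ^ (-(2 * L : ℕ) : ℤ)) hd
      rw [← AlgEquiv.mul_apply, ← AlgEquiv.mul_apply, ← zpow_add, ← zpow_add, neg_add_cancel,
        zpow_zero, AlgEquiv.one_apply] at h2
      convert h2 using 3
      push_cast
      ring
    · exact hL1 hd

/-- By `gen_orbitProd` the window products of `C_s` and of `γ_r(C_s)` differ by the factor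
`γ_s^{2L}(C_r)/C_r`. At the middle of the window this factor only sees the orders of `C_r` at the
indices `-L` and `L`, which vanish for large `L`. So the orbit sums at `γ_r(p)` and at `p` agree. -/
theorem WindowNeZero.step {q : Fin n → Fˣ} {U : Fin l → RatFun F l m n}
    {C : Fin m ⊕ Fin n → RatFun F l m n} (h : IsGenSystem q U C) {s r : Fin m ⊕ Fin n}
    {p : Poly F l m n} (hp : Irreducible p) (hinf : InfOrbit (genPoly q s) (genPoly q r p))
    (hw : WindowNeZero q s (C s) (genPoly q r p)) : WindowNeZero q s (C s) p := by
  have hp' := irreducible_map (genPoly q r) hp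
  have hfin := finite_setOf_ordAt_ne_zero
    (fun i : ℤ => irreducible_map (genPoly q s ^ i) hp') hinf.inj (h.ne_zero r)
  unfold WindowNeZero at hw ⊢
  filter_upwards [hw, InfOrbit.eventually_of_finite hfin] with L hL hL'
  rw [not_not, not_not] at hL'
  have hcomm : Commute (genPoly (l := l) q r) (genPoly q s) :=
    AlgEquiv.ext fun z => genPoly_comm q r s z
  have h1 := gen_orbitProd q s r (h.comm s r) (2 * L)
  have hO := orbitProd_ne_zero q s (h.ne_zero s) (2 * L)
  have h2 := congrArg (ordAt ((genPoly q s ^ (L : ℤ)) (genPoly q r p))) h1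
  have hirr := (irreducible_map (genPoly q s ^ (L : ℤ)) hp').prime
  have hit : (gen q s)^[2 * L] (C r) ≠ 0 := by
    intro h0
    rw [h0, zero_mul] at h1
    exact mul_ne_zero (gen_ne_zero q r hO) (h.ne_zero r) h1
  rw [ordAt_mul hirr (gen_ne_zero q r hO) (h.ne_zero r), ordAt_mul hirr hit hO,
    ordAt_iterate_gen q s hp' (h.ne_zero r), hL'.1] at h2
  have h3 : (L : ℤ) - (2 * L : ℕ) = -L := by push_cast; ring
  rw [h3, hL'.2, add_zero, zero_add, ← AlgEquiv.mul_apply, ← (hcomm.zpow_right L).eq,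
    AlgEquiv.mul_apply, ordAt_gen q r (irreducible_map _ hp) hO] at h2
  rw [h2]
  rw [← AlgEquiv.mul_apply, (hcomm.zpow_right L).eq, AlgEquiv.mul_apply]
  exact hL

/-- A nonzero `σ_j`-orbit sum would persist at all `τ_k^{-M}(p)` by `WindowNeZero.step`. These lie
on different `σ_j`-orbits, so `C_{σ_j}` would have infinitely many zeros and poles. -/
theorem not_windowNeZero_of_involves_y [CharZero F] {q : Fin n → Fˣ}
    (hq : ∀ k, ∀ N : ℕ, 0 < N → q k ^ N ≠ 1) {U : Fin l → RatFun F l m n}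
    {C : Fin m ⊕ Fin n → RatFun F l m n} (h : IsGenSystem q U C) {j : Fin m} {k : Fin n}
    {p : Poly F l m n} (hp : Irreducible p) (hj : Involves (Sum.inr (Sum.inl j)) p)
    (hk : Involves (Sum.inr (Sum.inr k)) p) :
    ¬ WindowNeZero q (Sum.inl j) (C (Sum.inl j)) p := by
  intro hw
  have hpX : ¬ Associated p (MvPolynomial.X (Sum.inr (Sum.inr k))) := by
    intro hass
    rw [involves_congr hass] at hj
    exact hj (MvPolynomial.pderiv_X_of_ne (by simp))
  set g := genPoly (l := l) q (Sum.inl j) with hg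
  set t := genPoly (l := l) (m := m) q (Sum.inr k) with ht
  have hcomm : Commute t g := AlgEquiv.ext fun z => genPoly_comm q (Sum.inr k) (Sum.inl j) z
  have hinv : ∀ (r : Idx l m n) (M : ℕ), Involves r ((t ^ (-M : ℤ)) p) ↔ Involves r p := by
    intro r M
    induction M with
    | zero => simp
    | succ M ih =>
      rw [← ih, ← involves_genPoly q r (Sum.inr k) ((t ^ (-(M + 1 : ℕ) : ℤ)) p), ht,
        genPoly_zpow_add_one]
      push_cast
      rw [neg_add_rev, neg_add_cancel_comm]
  have hall : ∀ M : ℕ, WindowNeZero q (Sum.inl j) (C (Sum.inl j)) ((t ^ (-M : ℤ)) p) := by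
    intro M
    induction M with
    | zero => simpa using hw
    | succ M ih =>
      have h1 : genPoly q (Sum.inr k) ((t ^ (-(M + 1 : ℕ) : ℤ)) p) = (t ^ (-M : ℤ)) p := by
        rw [ht, genPoly_zpow_add_one]
        push_cast
        rw [neg_add_rev, neg_add_cancel_comm]
      refine WindowNeZero.step h (r := Sum.inr k) (irreducible_map _ hp) ?_ ?_
      · rw [h1]
        intro N hN
        exact eq_zero_of_associated_shift q (irreducible_map _ hp) ((hinv _ M).2 hj) hN
      · rwa [h1]
  -- A nonzero sum has a nonzero term, which gives one zero or pole on each orbit.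
  have hex : ∀ M : ℕ, ∃ i : ℤ, ordAt ((g ^ i) ((t ^ (-M : ℤ)) p)) (C (Sum.inl j)) ≠ 0 := by
    intro M
    obtain ⟨L, hL⟩ := (hall M).exists
    rw [ordAt_orbitProd q _ (irreducible_map _ hp) (h.ne_zero _)] at hL
    obtain ⟨i, -, hi⟩ := Finset.exists_ne_zero_of_sum_ne_zero hL
    exact ⟨_, hi⟩
  choose e he using hex
  -- The chosen points are pairwise non-associated: undoing the shift and the dilation turns an
  -- association into one between `p` and `g^a t^{M-M'} p`, which forces `M = M'`.
  have hfin := finite_setOf_ordAt_ne_zero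
    (p := fun M : ℕ => (g ^ e M) ((t ^ (-M : ℤ)) p))
    (fun M => irreducible_map _ (irreducible_map _ hp)) (fun M M' hMM => by
      have h1 := associated_map (t ^ (M : ℤ)) (associated_map (g ^ (-e M)) hMM)
      simp only [← AlgEquiv.mul_apply] at h1
      have h2 : t ^ (M : ℤ) * (g ^ (-e M) * (g ^ e M * t ^ (-M : ℤ))) = 1 := by
        rw [← mul_assoc (g ^ (-e M)), ← zpow_add, neg_add_cancel, zpow_zero, one_mul, ← zpow_add,
          add_neg_cancel, zpow_zero]
      have h3 : t ^ (M : ℤ) * (g ^ (-e M) * (g ^ e M' * t ^ (-M' : ℤ))) =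
          g ^ (-e M + e M') * t ^ ((M : ℤ) - M') := by
        rw [← mul_assoc (g ^ (-e M)), ← zpow_add, ← mul_assoc, ((hcomm.zpow_zpow _ _)).eq,
          mul_assoc, ← zpow_add, ← sub_eq_add_neg]
      rw [h2, h3, AlgEquiv.one_apply, AlgEquiv.mul_apply] at h1
      have := eq_zero_of_associated_shift_dilation hq hp hk hpX h1
      omega) (h.ne_zero (Sum.inl j))
  exact Set.infinite_univ (hfin.subset fun M _ => he M)

end Descent

end MixedSystem

namespace MixedSystem

/-! ### Removal of the mixed zeros and poles. -/

section Reduction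

variable {F : Type*} [Field F] {l m n : ℕ}

/-- The quotient of two translates of `p` is a multiplicative coboundary. -/
theorem exists_coboundary_translate (q : Fin n → Fˣ) (s : Fin m ⊕ Fin n) {p : Poly F l m n}
    (hp : Irreducible p) (k : ℤ) : ∃ f : RatFun F l m n, f ≠ 0 ∧
      gen q s f / f = algebraMap _ _ ((genPoly q s ^ k) p) / algebraMap _ _ p ∧
      ∀ r : Poly F l m n, Irreducible r → ordAt r f ≠ 0 →
        ∃ i : ℤ, Associated r ((genPoly q s ^ i) p) := by
  have hinj : Function.Injective (algebraMap (Poly F l m n) (RatFun F l m n)) :=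
    IsFractionRing.injective _ _
  have hne : ∀ i : ℤ, algebraMap _ (RatFun F l m n) ((genPoly q s ^ i) p) ≠ 0 := fun i =>
    (map_ne_zero_iff _ hinj).2 (irreducible_map _ hp).ne_zero
  have hord : ∀ (r : Poly F l m n) (i : ℤ), Irreducible r →
      ordAt r (algebraMap _ (RatFun F l m n) ((genPoly q s ^ i) p)) ≠ 0 →
        Associated r ((genPoly q s ^ i) p) := by
    intro r i hr h
    by_contra hass
    rw [ordAt_algebraMap hr.prime (irreducible_map _ hp).ne_zero,
      (multiplicity_of_irreducible hr.prime (irreducible_map _ hp)).2 hass] at h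
    exact h rfl
  have hp0 : algebraMap _ (RatFun F l m n) p ≠ 0 := (map_ne_zero_iff _ hinj).2 hp.ne_zero
  -- For `k ≥ 0` the function `f` is the telescoping product of the translates with exponents `0, …,
  -- k - 1`; for `k < 0` it is the reciprocal of the product over `k, …, -1`.
  induction k using Int.induction_on with
  | zero => exact ⟨1, one_ne_zero, by simp [hp0], fun r hr h => absurd (ordAt_one hr.prime) h⟩
  | succ k ih =>
    obtain ⟨f, hf, h1, h2⟩ := ih
    refine ⟨f * algebraMap _ _ ((genPoly q s ^ (k : ℤ)) p), mul_ne_zero hf (hne _), ?_,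
      fun r hr h => ?_⟩
    · rw [map_mul, mul_div_mul_comm, h1, gen_algebraMap, genPoly_zpow_add_one]
      have := hne k
      field_simp
    · rw [ordAt_mul hr.prime hf (hne _)] at h
      by_cases h3 : ordAt r f = 0
      · rw [h3, zero_add] at h
        exact ⟨_, hord r _ hr h⟩
      · exact h2 r hr h3
  | pred k ih =>
    obtain ⟨f, hf, h1, h2⟩ := ih
    refine ⟨f / algebraMap _ _ ((genPoly q s ^ (-(k : ℤ) - 1)) p), div_ne_zero hf (hne _), ?_,
      fun r hr h => ?_⟩
    · have h4 := hne (-(k : ℤ))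
      have h5 := hne (-(k : ℤ) - 1)
      rw [map_div₀, div_div_div_comm, h1, gen_algebraMap, genPoly_zpow_add_one, sub_add_cancel]
      field_simp
    · rw [ordAt_div' hr.prime hf (hne _)] at h
      by_cases h3 : ordAt r f = 0
      · rw [h3, zero_sub, neg_ne_zero] at h
        exact ⟨_, hord r _ hr h⟩
      · exact h2 r hr h3

theorem zpow_invariant {q : Fin n → Fˣ} {s : Fin m ⊕ Fin n} {B : Poly F l m n → Prop}
    (hB : ∀ p, B (genPoly q s p) ↔ B p) (i : ℤ) (p : Poly F l m n) :
    B ((genPoly q s ^ i) p) ↔ B p := by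
  induction i using Int.induction_on with
  | zero => simp
  | succ i ih => rw [← genPoly_zpow_add_one, hB, ih]
  | pred i ih => rw [← hB, genPoly_zpow_add_one, sub_add_cancel, ih]

/-- The zeros and poles of `c` in a class of balanced irreducible polynomials are removed by a
coboundary. -/
theorem exists_gauge_single (q : Fin n → Fˣ) (s : Fin m ⊕ Fin n) (B : Poly F l m n → Prop)
    (hB : ∀ p, B (genPoly q s p) ↔ B p) (hBa : ∀ p p', Associated p p' → B p → B p')
    {c : RatFun F l m n} (hc : c ≠ 0)
    (hbal : ∀ f : RatFun F l m n, f ≠ 0 → ∀ p : Poly F l m n, Irreducible p → B p →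
      ordAt p (c * (gen q s f / f)) ≠ 0 → ∃ k : ℤ, ordAt p (c * (gen q s f / f)) *
        ordAt ((genPoly q s ^ k) p) (c * (gen q s f / f)) < 0) :
    ∃ f : RatFun F l m n, f ≠ 0 ∧ (∀ p : Poly F l m n, Irreducible p → ¬ B p → ordAt p f = 0) ∧
      ∀ p : Poly F l m n, Irreducible p → B p → ordAt p (c * (gen q s f / f)) = 0 := by
  have hinj : Function.Injective (algebraMap (Poly F l m n) (RatFun F l m n)) :=
    IsFractionRing.injective _ _
  obtain ⟨T, hT1, hT2⟩ := exists_finset_ordAt (A := Poly F l m n) hc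
  -- Induction on the total of the absolute orders. The representatives `T` can be kept, since no
  -- step raises an absolute order, and `hbal` speaks of all gauges so that it survives each step.
  obtain ⟨N, hN⟩ : ∃ N, ∑ r ∈ T, (ordAt r c).natAbs = N := ⟨_, rfl⟩
  induction N using Nat.strong_induction_on generalizing c with
  | _ N ih =>
  by_cases hall : ∀ p : Poly F l m n, Irreducible p → B p → ordAt p c = 0
  · exact ⟨1, one_ne_zero, fun p hp _ => ordAt_one hp.prime, fun p hp hp' => by
      rw [map_one, div_one, mul_one, hall p hp hp']⟩
  push Not at hall
  obtain ⟨p, hp, hBp, hpc⟩ := hall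
  -- The balance condition yields a zero and a pole on one orbit; `P` is taken to be the zero.
  obtain ⟨P, hP, k, hBP, hpos, hneg⟩ : ∃ P : Poly F l m n, Irreducible P ∧ ∃ k : ℤ, B P ∧
      0 < ordAt P c ∧ ordAt ((genPoly q s ^ k) P) c < 0 := by
    have h1 := hbal 1 one_ne_zero p hp hBp
    simp only [map_one, div_one, mul_one] at h1
    obtain ⟨k, hk⟩ := h1 hpc
    rcases lt_or_gt_of_ne hpc with h2 | h2
    · refine ⟨(genPoly q s ^ k) p, irreducible_map _ hp, -k, (zpow_invariant hB k p).2 hBp,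
        pos_of_mul_neg_right hk h2.le, ?_⟩
      rwa [← AlgEquiv.mul_apply, ← zpow_add, neg_add_cancel, zpow_zero, AlgEquiv.one_apply]
    · exact ⟨p, hp, k, hBp, h2, by
        by_contra h3
        exact absurd (mul_nonneg h2.le (not_lt.1 h3)) (not_le.2 hk)⟩
  obtain ⟨f, hf, hf1, hf2⟩ := exists_coboundary_translate q s hP k
  have hP' := irreducible_map (genPoly q s ^ k) hP
  have hPK : algebraMap _ (RatFun F l m n) P ≠ 0 := (map_ne_zero_iff _ hinj).2 hP.ne_zero
  have hPK' : algebraMap _ (RatFun F l m n) ((genPoly q s ^ k) P) ≠ 0 :=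
    (map_ne_zero_iff _ hinj).2 hP'.ne_zero
  have hff : gen q s f / f ≠ 0 := div_ne_zero (gen_ne_zero q s hf) hf
  -- Multiplication by `g^k(P)/P` lowers the positive order at `P` and raises the negative one at
  -- `g^k(P)`, each by one.
  have hord : ∀ r : Poly F l m n, Irreducible r → ordAt r (c * (gen q s f / f)) =
      ordAt r c + (multiplicity r ((genPoly q s ^ k) P) - multiplicity r P) := by
    intro r hr
    rw [ordAt_mul hr.prime hc hff, hf1, ordAt_div hr.prime hP'.ne_zero hP.ne_zero]
  have hle : ∀ r : Poly F l m n, Irreducible r →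
      (ordAt r (c * (gen q s f / f))).natAbs ≤ (ordAt r c).natAbs ∧
      (Associated r P → (ordAt r (c * (gen q s f / f))).natAbs < (ordAt r c).natAbs) := by
    intro r hr
    rw [hord r hr]
    by_cases h1 : Associated r P
    · have h2 : ordAt r c = ordAt P c := ordAt_congr h1 c
      have h3 : ¬ Associated r ((genPoly q s ^ k) P) := by
        intro h3
        have := ordAt_congr h3 c
        omega
      rw [(multiplicity_of_irreducible hr.prime hP).1 h1,
        (multiplicity_of_irreducible hr.prime hP').2 h3]
      refine ⟨?_, fun _ => ?_⟩ <;> push_cast <;> omega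
    · rw [(multiplicity_of_irreducible hr.prime hP).2 h1]
      refine ⟨?_, fun h => absurd h h1⟩
      by_cases h3 : Associated r ((genPoly q s ^ k) P)
      · rw [(multiplicity_of_irreducible hr.prime hP').1 h3]
        have := ordAt_congr h3 c
        push_cast
        omega
      · rw [(multiplicity_of_irreducible hr.prime hP').2 h3]
        simp
  have hlt : ∑ r ∈ T, (ordAt r (c * (gen q s f / f))).natAbs < N := by
    rw [← hN]
    obtain ⟨r, hr, hrP⟩ := hT2 P hP hpos.ne'
    exact Finset.sum_lt_sum (fun r hr => (hle r (hT1 r hr)).1)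
      ⟨r, hr, (hle r (hT1 r hr)).2 hrP.symm⟩
  obtain ⟨f', hf', h1, h2⟩ := ih _ hlt (mul_ne_zero hc hff)
    (fun f' hf' p hp hBp => by
      have := hbal (f * f') (mul_ne_zero hf hf') p hp hBp
      rwa [map_mul, mul_div_mul_comm, ← mul_assoc] at this)
    (fun p hp h => hT2 p hp fun h0 => h (by
      have := (hle p hp).1
      omega)) rfl
  refine ⟨f * f', mul_ne_zero hf hf', fun p hp hBp => ?_, fun p hp hBp => ?_⟩
  · rw [ordAt_mul hp.prime hf hf', h1 p hp hBp, add_zero]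
    by_contra h0
    obtain ⟨i, hi⟩ := hf2 p hp h0
    exact hBp (hBa _ _ hi.symm ((zpow_invariant hB i P).2 hBP))
  · rw [map_mul, mul_div_mul_comm, ← mul_assoc]
    exact h2 p hp hBp

/-- Only indeterminates in `S` occur in `p`. -/
def InvolvesOnly (S : Set (Idx l m n)) (p : Poly F l m n) : Prop := ∀ s ∉ S, ¬ Involves s p

theorem involvesOnly_congr {p p' : Poly F l m n} (h : Associated p p') (S : Set (Idx l m n)) :
    InvolvesOnly S p ↔ InvolvesOnly S p' := by
  simp only [InvolvesOnly, involves_congr h]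

theorem involvesOnly_genPoly (q : Fin n → Fˣ) (S : Set (Idx l m n)) (s : Fin m ⊕ Fin n)
    (p : Poly F l m n) : InvolvesOnly S (genPoly q s p) ↔ InvolvesOnly S p := by
  simp only [InvolvesOnly, involves_genPoly]

/-- The indeterminates `t`. -/
def blockT (l m n : ℕ) : Set (Idx l m n) := Set.range Sum.inl

/-- The indeterminates `x`. -/
def blockX (l m n : ℕ) : Set (Idx l m n) := Set.range fun j => Sum.inr (Sum.inl j)

/-- The indeterminates `y`. -/
def blockY (l m n : ℕ) : Set (Idx l m n) := Set.range fun k => Sum.inr (Sum.inr k)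

/-- Indeterminates of at least two kinds occur in `p`. -/
def IsMixed (p : Poly F l m n) : Prop :=
  ¬ InvolvesOnly (blockT l m n) p ∧ ¬ InvolvesOnly (blockX l m n) p ∧
    ¬ InvolvesOnly (blockY l m n) p

/-- The mixed polynomials whose zeros and poles are removed with the help of the operator `s`. -/
def Removable (s : Fin m ⊕ Fin n) (p : Poly F l m n) : Prop :=
  IsMixed p ∧ Involves (Sum.inr s) p ∧
    ((∃ i, Involves (Sum.inl i) p) ∨ ∃ j k, s = Sum.inl j ∧ Involves (Sum.inr (Sum.inr k)) p)

theorem removable_congr {p p' : Poly F l m n} (h : Associated p p') (s : Fin m ⊕ Fin n) :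
    Removable s p ↔ Removable s p' := by
  simp only [Removable, IsMixed, involvesOnly_congr h, involves_congr h]

theorem removable_genPoly (q : Fin n → Fˣ) (s r : Fin m ⊕ Fin n) (p : Poly F l m n) :
    Removable s (genPoly q r p) ↔ Removable s p := by
  simp only [Removable, IsMixed, involvesOnly_genPoly, involves_genPoly]

/-- If some `t_i` occurs, any other indeterminate supplies the operator. Otherwise both an `x_j` and
a `y_k` occur, and `σ_j` serves. -/
theorem IsMixed.exists_removable {p : Poly F l m n} (h : IsMixed p) : ∃ s, Removable s p := by
  obtain ⟨h1, h2, h3⟩ := h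
  have h1' := h1
  have h2' := h2
  have h3' := h3
  simp only [InvolvesOnly, blockT, blockX, blockY, Set.mem_range, not_exists, not_forall, not_not,
    exists_prop] at h1' h2' h3'
  obtain ⟨s1, hs1, hi1⟩ := h1'
  obtain ⟨s2, hs2, hi2⟩ := h2'
  obtain ⟨s3, hs3, hi3⟩ := h3'
  rcases s1 with i | s
  · exact absurd rfl (hs1 i)
  by_cases ht : ∃ i : Fin l, Involves (Sum.inl i) p
  · exact ⟨s, ⟨h1, h2, h3⟩, hi1, Or.inl ht⟩
  · rcases s2 with i | j | k
    · exact absurd ⟨i, hi2⟩ ht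
    · exact absurd rfl (hs2 j)
    · rcases s3 with i | j | k'
      · exact absurd ⟨i, hi3⟩ ht
      · exact ⟨Sum.inl j, ⟨h1, h2, h3⟩, hi3, Or.inr ⟨j, k, rfl, hi2⟩⟩
      · exact absurd rfl (hs3 k')

variable [CharZero F]

/-- The polynomials `y_k` have to be excluded, since a dilation merely rescales its own
indeterminate. -/
theorem infOrbit_of_involves {q : Fin n → Fˣ} (hq : ∀ k, ∀ N : ℕ, 0 < N → q k ^ N ≠ 1)
    {s : Fin m ⊕ Fin n} {p : Poly F l m n} (hp : Irreducible p) (hs : Involves (Sum.inr s) p)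
    (hX : ∀ k, ¬ Associated p (MvPolynomial.X (Sum.inr (Sum.inr k)))) :
    InfOrbit (genPoly q s) p := by
  rcases s with j | k
  · exact fun N hN => eq_zero_of_associated_shift q hp hs hN
  · exact fun N hN => eq_zero_of_associated_dilation hq hp hs (hX k) hN

omit [CharZero F] in
theorem not_associated_X_of_involves {p : Poly F l m n} {r s : Idx l m n} (h : Involves r p)
    (hrs : s ≠ r) : ¬ Associated p (MvPolynomial.X s) := by
  intro hass
  rw [involves_congr hass] at h
  exact h (MvPolynomial.pderiv_X_of_ne hrs)

theorem Removable.infOrbit {q : Fin n → Fˣ} (hq : ∀ k, ∀ N : ℕ, 0 < N → q k ^ N ≠ 1)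
    {s : Fin m ⊕ Fin n} {p : Poly F l m n} (hp : Irreducible p) (h : Removable s p) :
    InfOrbit (genPoly q s) p := by
  obtain ⟨-, hs, h⟩ := h
  refine infOrbit_of_involves hq hp hs fun k => ?_
  rcases h with ⟨i, hi⟩ | ⟨j, k', rfl, -⟩
  · exact not_associated_X_of_involves hi (by simp)
  · exact not_associated_X_of_involves hs (by simp)

theorem Removable.not_windowNeZero {q : Fin n → Fˣ} (hq : ∀ k, ∀ N : ℕ, 0 < N → q k ^ N ≠ 1)
    {U : Fin l → RatFun F l m n} {C : Fin m ⊕ Fin n → RatFun F l m n} (hC : IsGenSystem q U C)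
    {s : Fin m ⊕ Fin n} {p : Poly F l m n} (hp : Irreducible p) (h : Removable s p) :
    ¬ WindowNeZero q s (C s) p := by
  have hinf := h.infOrbit hq hp
  obtain ⟨-, hs, h⟩ := h
  rcases h with ⟨i, hi⟩ | ⟨j, k, rfl, hk⟩
  · exact not_windowNeZero_of_involves hC hp hi hinf
  · exact not_windowNeZero_of_involves_y hq hC hp hs hk

omit [CharZero F] in
theorem ordAt_gen_eq {q : Fin n → Fˣ} {s : Fin m ⊕ Fin n} {p : Poly F l m n} (hp : Irreducible p)
    {f : RatFun F l m n} (hf : f ≠ 0) :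
    ordAt p (gen q s f) = ordAt ((genPoly q s ^ (-1 : ℤ)) p) f := by
  simpa using ordAt_zpow_gen q s hp hf 0

omit [CharZero F] in
/-- If the order of one member of the system vanishes along an infinite orbit, so does the order
of all others. -/
theorem IsGenSystem.ordAt_eq_zero {q : Fin n → Fˣ}
    {U : Fin l → RatFun F l m n} {C : Fin m ⊕ Fin n → RatFun F l m n} (hC : IsGenSystem q U C)
    {s r : Fin m ⊕ Fin n} {p : Poly F l m n} (hp : Irreducible p) (hinf : InfOrbit (genPoly q s) p)
    (h : ∀ i : ℤ, ordAt ((genPoly q r ^ (-1 : ℤ)) ((genPoly q s ^ i) p)) (C s) =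
      ordAt ((genPoly q s ^ i) p) (C s)) : ordAt p (C r) = 0 := by
  -- In the commutation relation the two orders of `C_s` cancel by hypothesis, so the order of `C_r`
  -- is constant along the orbit.
  have h1 : ∀ i : ℤ, ordAt ((genPoly q s ^ (i - 1)) p) (C r) =
      ordAt ((genPoly q s ^ i) p) (C r) := by
    intro i
    have hpi := irreducible_map (genPoly q s ^ i) hp
    have h2 := congrArg (ordAt ((genPoly q s ^ i) p)) (hC.comm s r)
    rw [ordAt_mul hpi.prime (gen_ne_zero q s (hC.ne_zero r)) (hC.ne_zero s),
      ordAt_mul hpi.prime (gen_ne_zero q r (hC.ne_zero s)) (hC.ne_zero r),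
      ordAt_zpow_gen q s hp (hC.ne_zero r), ordAt_gen_eq hpi (hC.ne_zero s), h i] at h2
    omega
  refine hinf.ordAt_eq_zero hp (hC.ne_zero r) fun i => ?_
  induction i using Int.induction_on with
  | zero => simp
  | succ i ih => rw [← h1, add_sub_cancel_right, ih]
  | pred i ih => rw [h1, ih]

/-- All zeros and poles at mixed irreducible polynomials are removed by a gauge transformation. -/
theorem IsGenSystem.exists_gauge {q : Fin n → Fˣ} (hq : ∀ k, ∀ N : ℕ, 0 < N → q k ^ N ≠ 1)
    {U : Fin l → RatFun F l m n} {C : Fin m ⊕ Fin n → RatFun F l m n} (hC : IsGenSystem q U C) :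
    ∃ f : RatFun F l m n, f ≠ 0 ∧ ∀ p : Poly F l m n, Irreducible p → IsMixed p → ∀ r,
      ordAt p (C r * (gen q r f / f)) = 0 := by
  classical
  suffices h : ∀ S : Finset (Fin m ⊕ Fin n), ∃ f : RatFun F l m n, f ≠ 0 ∧
      ∀ s ∈ S, ∀ p : Poly F l m n, Irreducible p → Removable s p → ∀ r,
        ordAt p (C r * (gen q r f / f)) = 0 by
    obtain ⟨f, hf, h⟩ := h Finset.univ
    refine ⟨f, hf, fun p hp hmix r => ?_⟩
    obtain ⟨s, hs⟩ := hmix.exists_removable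
    exact h s (Finset.mem_univ _) p hp hs r
  intro S
  induction S using Finset.induction_on with
  | empty => exact ⟨1, one_ne_zero, by simp⟩
  | insert s S hsS ih =>
    obtain ⟨f, hf, hS⟩ := ih
    have hC' := hC.gauge hf
    -- The class consists of the polynomials that belong to `s` and to none of the operators treated
    -- before. It is stable under all operators, so the new gauge leaves the earlier classes
    -- untouched.
    obtain ⟨f', hf', h1, h2⟩ := exists_gauge_single q s
      (fun p => Removable s p ∧ ∀ s' ∈ S, ¬ Removable s' p)
      (fun p => by simp only [removable_genPoly])
      (fun p p' hpp => by simp only [removable_congr hpp]; exact id)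
      (hC'.ne_zero s) (fun f' hf' p hp hBp h0 => exists_opposite_sign
        ((hC'.gauge hf').ne_zero s) hp (hBp.1.not_windowNeZero hq (hC'.gauge hf') hp) h0)
    have hC'' := hC'.gauge hf'
    have hff : ∀ r, C r * (gen q r (f * f') / (f * f')) =
        C r * (gen q r f / f) * (gen q r f' / f') := by
      intro r
      rw [map_mul, mul_div_mul_comm, mul_assoc]
    have hold : ∀ s' ∈ S, ∀ p : Poly F l m n, Irreducible p → Removable s' p → ∀ r,
        ordAt p (C r * (gen q r f / f) * (gen q r f' / f')) = 0 := by
      intro s' hs' p hp hr r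
      rw [ordAt_mul hp.prime (hC'.ne_zero r) (div_ne_zero (gen_ne_zero q r hf') hf'),
        hS s' hs' p hp hr r, ordAt_div' hp.prime (gen_ne_zero q r hf') hf', ordAt_gen_eq hp hf',
        h1 p hp fun h => h.2 s' hs' hr, h1 _ (irreducible_map _ hp) fun h => h.2 s' hs'
          ((zpow_invariant (removable_genPoly q s' r) _ p).2 hr)]
      simp
    refine ⟨f * f', mul_ne_zero hf hf', fun s' hs' p hp hr r => ?_⟩
    rw [hff]
    rcases Finset.mem_insert.1 hs' with rfl | hs'
    · by_cases hex : ∃ s'' ∈ S, Removable s'' p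
      · obtain ⟨s'', hs'', hr'⟩ := hex
        exact hold s'' hs'' p hp hr' r
      · push Not at hex
        -- On the new class the certificate of the operator itself has no zeros or poles, at
        -- translates by any operator; `IsGenSystem.ordAt_eq_zero` extends this to the other
        -- certificates.
        have hz : ∀ (i : ℤ), ordAt ((genPoly q s' ^ i) p) _ = 0 := fun i =>
          h2 ((genPoly q s' ^ i) p) (irreducible_map _ hp)
            ⟨(zpow_invariant (removable_genPoly q s' s') i p).2 hr, fun s'' hs'' h =>
              hex s'' hs'' ((zpow_invariant (removable_genPoly q s'' s') i p).1 h)⟩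
        refine hC''.ordAt_eq_zero hp (hr.infOrbit hq hp) fun i => ?_
        rw [hz i]
        refine h2 _ (irreducible_map _ (irreducible_map _ hp))
          ⟨(zpow_invariant (removable_genPoly q s' r) _ _).2
            ((zpow_invariant (removable_genPoly q s' s') i p).2 hr), fun s'' hs'' h =>
              hex s'' hs'' ((zpow_invariant (removable_genPoly q s'' s') i p).1
                ((zpow_invariant (removable_genPoly q s'' r) _ _).1 h))⟩
    · exact hold s' hs' p hp hr r

end Reduction

end MixedSystem

namespace MixedSystem

/-! ### The shape of compatible certificates. -/

section Decomposition

variable {F : Type*} [Field F] {l m n : ℕ}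

theorem adjoin_induction_fixed {S : Set (RatFun F l m n)} (g : RatFun F l m n ≃ₐ[F] RatFun F l m n)
    (h : ∀ z ∈ S, g z = z) {f : RatFun F l m n} (hf : f ∈ IntermediateField.adjoin F S) :
    g f = f := by
  induction hf using IntermediateField.adjoin_induction with
  | mem z hz => exact h z hz
  | algebraMap c => exact g.commutes c
  | add a b _ _ ha hb => rw [map_add, ha, hb]
  | inv a _ ha => rw [map_inv₀, ha]
  | mul a b _ _ ha hb => rw [map_mul, ha, hb]

theorem adjoin_induction_delta {S : Set (RatFun F l m n)} (i : Fin l)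
    (h : ∀ z ∈ S, delta i z = 0) {f : RatFun F l m n} (hf : f ∈ IntermediateField.adjoin F S) :
    delta i f = 0 := by
  induction hf using IntermediateField.adjoin_induction with
  | mem z hz => exact h z hz
  | algebraMap c => exact (delta i).map_algebraMap c
  | add a b _ _ ha hb => rw [map_add, ha, hb, add_zero]
  | inv a _ ha => rw [Derivation.leibniz_inv, ha, smul_zero]
  | mul a b _ _ ha hb => rw [Derivation.leibniz, ha, hb, smul_zero, smul_zero, add_zero]

theorem gen_X_of_ne (q : Fin n → Fˣ) (s : Fin m ⊕ Fin n) {r : Idx l m n} (h : r ≠ Sum.inr s) :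
    gen q s (X r : RatFun F l m n) = X r := by
  obtain ⟨c, d, hs⟩ := genPoly_eq_affinePoly (F := F) (l := l) q s
  rw [X, gen_algebraMap, hs, affinePoly_X, if_neg h]

theorem gen_fieldT (q : Fin n → Fˣ) (s : Fin m ⊕ Fin n) {f : RatFun F l m n}
    (hf : f ∈ fieldT F l m n) : gen q s f = f := by
  refine adjoin_induction_fixed _ ?_ hf
  rintro _ ⟨i, rfl⟩
  exact gen_X_of_ne q s (by simp)

theorem sigma_fieldY (j : Fin m) {f : RatFun F l m n}
    (hf : f ∈ fieldY F l m n) : sigma j f = f := by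
  refine adjoin_induction_fixed _ ?_ hf
  rintro _ ⟨i, rfl⟩
  exact gen_X_of_ne (fun _ => 1) (Sum.inl j) (by simp)

theorem tau_fieldX (q : Fin n → Fˣ) (k : Fin n) {f : RatFun F l m n}
    (hf : f ∈ fieldX F l m n) : tau q k f = f := by
  refine adjoin_induction_fixed _ ?_ hf
  rintro _ ⟨i, rfl⟩
  exact gen_X_of_ne q (Sum.inr k) (by simp)

theorem delta_X_of_ne (i : Fin l) {r : Idx l m n} (h : r ≠ Sum.inl i) :
    delta i (X r : RatFun F l m n) = 0 := by
  rw [X, delta_algebraMap, MvPolynomial.pderiv_X_of_ne h, map_zero]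

theorem delta_fieldX (i : Fin l) {f : RatFun F l m n} (hf : f ∈ fieldX F l m n) :
    delta i f = 0 := by
  refine adjoin_induction_delta _ ?_ hf
  rintro _ ⟨j, rfl⟩
  exact delta_X_of_ne i (by simp)

theorem delta_fieldY (i : Fin l) {f : RatFun F l m n} (hf : f ∈ fieldY F l m n) :
    delta i f = 0 := by
  refine adjoin_induction_delta _ ?_ hf
  rintro _ ⟨j, rfl⟩
  exact delta_X_of_ne i (by simp)

theorem sigma_xVar (j j' : Fin m) : sigma j' (xVar j : RatFun F l m n) =
    xVar j + if j = j' then 1 else 0 := by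
  rw [xVar, X, ← gen_inl (fun _ => 1), gen_algebraMap, genPoly, affinePoly_X]
  by_cases h : j = j'
  · simp [h]
  · simp [h]

theorem genPoly_of_not_involves [CharZero F] (q : Fin n → Fˣ) (s : Fin m ⊕ Fin n)
    {p : Poly F l m n} (h : ¬ Involves (Sum.inr s) p) : genPoly q s p = p := by
  obtain ⟨c, d, hs⟩ := genPoly_eq_affinePoly (F := F) (l := l) q s
  apply slice_injective (Sum.inr s)
  rw [hs, slice_affinePoly_self]
  rw [not_involves_iff] at h
  rw [Polynomial.eq_C_of_natDegree_eq_zero h, Polynomial.C_comp]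

theorem algebraMap_mem_adjoin [CharZero F] {S : Set (Idx l m n)} {p : Poly F l m n}
    (h : InvolvesOnly S p) :
    algebraMap _ (RatFun F l m n) p ∈ IntermediateField.adjoin F (X '' S) := by
  have h1 := mem_supported_of_not_involves S p h
  have h2 : MvPolynomial.supported F S ≤ (IntermediateField.adjoin F
      (X '' S : Set (RatFun F l m n))).toSubalgebra.comap
        (IsScalarTower.toAlgHom F (Poly F l m n) (RatFun F l m n)) := by
    apply Algebra.adjoin_le
    rintro _ ⟨s, hs, rfl⟩
    exact IntermediateField.subset_adjoin F _ ⟨s, hs, rfl⟩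
  exact h2 h1

theorem algebraMap_mem_fieldT [CharZero F] {p : Poly F l m n} (h : InvolvesOnly (blockT l m n) p) :
    algebraMap _ (RatFun F l m n) p ∈ fieldT F l m n := by
  have := algebraMap_mem_adjoin h
  rwa [blockT, ← Set.range_comp] at this

theorem algebraMap_mem_fieldX [CharZero F] {p : Poly F l m n} (h : InvolvesOnly (blockX l m n) p) :
    algebraMap _ (RatFun F l m n) p ∈ fieldX F l m n := by
  have := algebraMap_mem_adjoin h
  rwa [blockX, ← Set.range_comp] at this

theorem algebraMap_mem_fieldY [CharZero F] {p : Poly F l m n} (h : InvolvesOnly (blockY l m n) p) :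
    algebraMap _ (RatFun F l m n) p ∈ fieldY F l m n := by
  have := algebraMap_mem_adjoin h
  rwa [blockY, ← Set.range_comp] at this

theorem exists_involves [CharZero F] {p : Poly F l m n} (hp : Irreducible p) :
    ∃ s, Involves s p := by
  by_contra! h
  have h1 := mem_supported_of_not_involves ∅ p fun s _ => h s
  rw [MvPolynomial.supported_empty] at h1
  obtain ⟨c, rfl⟩ := Algebra.mem_bot.1 h1
  refine hp.not_isUnit ((isUnit_iff_ne_zero.2 ?_).map MvPolynomial.C)
  rintro rfl
  exact hp.ne_zero (map_zero _)

/-- The purely `t`-, `x`- or `y`-part of a rational function. -/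
theorem exists_block_part [CharZero F] (ord : MonomialOrder (Idx l m n)) (S : Set (Idx l m n))
    (L : IntermediateField F (RatFun F l m n))
    (hL : ∀ p : Poly F l m n, InvolvesOnly S p → algebraMap _ (RatFun F l m n) p ∈ L)
    {f : RatFun F l m n} (hf : f ≠ 0) :
    ∃ g : RatFun F l m n, g ≠ 0 ∧ IsMonicRat ord g ∧ g ∈ L ∧
      ∀ p : Poly F l m n, Irreducible p → (InvolvesOnly S p → ordAt p g = ordAt p f) ∧
        (¬ InvolvesOnly S p → ordAt p g = 0) := by
  obtain ⟨g, h1, h2, h3, h4⟩ := exists_monic_part ord (InvolvesOnly S)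
    (fun p p' h => (involvesOnly_congr h S).1) hf
  exact ⟨g, h1, h2, h3 L.toSubfield (fun c => L.algebraMap_mem c) fun p _ hp => hL p hp, h4⟩

theorem InvolvesOnly.not_of_disjoint [CharZero F] {p : Poly F l m n} (hp : Irreducible p)
    {S S' : Set (Idx l m n)} (hS : Disjoint S S') (h : InvolvesOnly S p) : ¬ InvolvesOnly S' p := by
  intro h'
  obtain ⟨s, hs⟩ := exists_involves hp
  have h1 : s ∈ S := by
    by_contra h1
    exact h s h1 hs
  have h2 : s ∈ S' := by
    by_contra h2
    exact h' s h2 hs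
  exact Set.disjoint_left.1 hS h1 h2

theorem disjoint_blockT_blockX : Disjoint (blockT l m n) (blockX l m n) := by
  rw [Set.disjoint_left]
  rintro _ ⟨i, rfl⟩ ⟨j, hj⟩
  simp at hj

theorem disjoint_blockT_blockY : Disjoint (blockT l m n) (blockY l m n) := by
  rw [Set.disjoint_left]
  rintro _ ⟨i, rfl⟩ ⟨j, hj⟩
  simp at hj

theorem disjoint_blockX_blockY : Disjoint (blockX l m n) (blockY l m n) := by
  rw [Set.disjoint_left]
  rintro _ ⟨i, rfl⟩ ⟨j, hj⟩
  simp at hj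

/-- A rational function without mixed zeros and poles is a product of functions of `t`, of `x` and
of `y`. -/
theorem exists_eq_mul_of_not_mixed [CharZero F] (ord : MonomialOrder (Idx l m n))
    {f : RatFun F l m n} (hf : f ≠ 0)
    (h : ∀ p : Poly F l m n, Irreducible p → IsMixed p → ordAt p f = 0) :
    ∃ a b d : RatFun F l m n, a ≠ 0 ∧ b ≠ 0 ∧ d ≠ 0 ∧ IsMonicRat ord a ∧
      a ∈ fieldT F l m n ∧ b ∈ fieldX F l m n ∧ d ∈ fieldY F l m n ∧ f = a * b * d ∧
      (∀ p : Poly F l m n, Irreducible p → ¬ InvolvesOnly (blockT l m n) p → ordAt p a = 0) ∧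
      (∀ p : Poly F l m n, Irreducible p → ¬ InvolvesOnly (blockX l m n) p → ordAt p b = 0) ∧
      (∀ p : Poly F l m n, Irreducible p → InvolvesOnly (blockX l m n) p → ordAt p b = ordAt p f) ∧
      (∀ p : Poly F l m n, Irreducible p → ¬ InvolvesOnly (blockY l m n) p → ordAt p d = 0) := by
  obtain ⟨a, ha, ham, haL, hao⟩ :=
    exists_block_part ord _ _ (fun _ => algebraMap_mem_fieldT) hf
  obtain ⟨b, hb, -, hbL, hbo⟩ :=
    exists_block_part ord _ _ (fun _ => algebraMap_mem_fieldX) hf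
  obtain ⟨d, hd, -, hdL, hdo⟩ :=
    exists_block_part ord _ _ (fun _ => algebraMap_mem_fieldY) hf
  have hab := mul_ne_zero (mul_ne_zero ha hb) hd
  obtain ⟨c, hc, hcf⟩ := exists_const_of_ordAt_eq_zero (div_ne_zero hf hab) fun p hp => by
    rw [ordAt_div' hp.prime hf hab, ordAt_mul hp.prime (mul_ne_zero ha hb) hd,
      ordAt_mul hp.prime ha hb]
    by_cases hT : InvolvesOnly (blockT l m n) p
    · rw [(hao p hp).1 hT, (hbo p hp).2 (hT.not_of_disjoint hp disjoint_blockT_blockX),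
        (hdo p hp).2 (hT.not_of_disjoint hp disjoint_blockT_blockY)]
      ring
    · rw [(hao p hp).2 hT]
      by_cases hX : InvolvesOnly (blockX l m n) p
      · rw [(hbo p hp).1 hX, (hdo p hp).2 (hX.not_of_disjoint hp disjoint_blockX_blockY)]
        ring
      · rw [(hbo p hp).2 hX]
        by_cases hY : InvolvesOnly (blockY l m n) p
        · rw [(hdo p hp).1 hY]
          ring
        · rw [(hdo p hp).2 hY, h p hp ⟨hT, hX, hY⟩]
          ring
  have hc' : algebraMap F (RatFun F l m n) c ≠ 0 := by simpa using hc
  have hcb : ∀ p : Poly F l m n, Irreducible p →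
      ordAt p (algebraMap F (RatFun F l m n) c * b) = ordAt p b := by
    intro p hp
    have h1 : ordAt p (algebraMap F (RatFun F l m n) c) = 0 := by
      rw [IsScalarTower.algebraMap_apply F (Poly F l m n),
        ordAt_algebraMap hp.prime (by simpa using hc), multiplicity_of_isUnit_right hp.not_isUnit
          ((isUnit_iff_ne_zero.2 hc).map (algebraMap F (Poly F l m n))), Nat.cast_zero]
    rw [ordAt_mul hp.prime hc' hb, h1, zero_add]
  -- The leftover constant goes into the `x`-factor, because the `t`-factor has to remain monic.
  refine ⟨a, algebraMap F _ c * b, d, ha, mul_ne_zero hc' hb, hd, ham, haL,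
    (fieldX F l m n).mul_mem ((fieldX F l m n).algebraMap_mem c) hbL, hdL, ?_,
    fun p hp => (hao p hp).2, fun p hp h => ?_, fun p hp h => ?_, fun p hp => (hdo p hp).2⟩
  · rw [div_eq_iff hab] at hcf
    rw [hcf]
    ring
  · rw [hcb p hp, (hbo p hp).2 h]
  · rw [hcb p hp, (hbo p hp).1 h]

theorem genPoly_zpow_neg_one (q : Fin n → Fˣ) (s : Fin m ⊕ Fin n) (p : Poly F l m n) :
    (genPoly q s ^ (-1 : ℤ)) (genPoly q s p) = p := by
  rw [zpow_neg_one]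
  exact (genPoly q s).symm_apply_apply p

variable [CharZero F]

omit [CharZero F] in
theorem pow_injective_of_not_root {q : Fin n → Fˣ} (hq : ∀ k, ∀ N : ℕ, 0 < N → q k ^ N ≠ 1)
    (k : Fin n) {e e' : ℤ} (h : q k ^ e = q k ^ e') : e = e' := by
  by_contra hne
  have h6 : q k ^ (e - e') = 1 := by rw [zpow_sub, h, mul_inv_cancel]
  have h8 : q k ^ (e - e').natAbs = 1 := by
    rw [← zpow_natCast, Int.natCast_natAbs]
    rcases abs_choice (e - e') with h | h <;> rw [h]
    · exact h6
    · rw [zpow_neg, h6, inv_one]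
  exact hq k _ (Int.natAbs_pos.2 (sub_ne_zero.2 hne)) h8

/-- Zeros and poles of a function which is fixed by all shifts and dilations depend on `t` only. -/
theorem involvesOnly_of_fixed (ord : MonomialOrder (Idx l m n)) {q : Fin n → Fˣ}
    (hq : ∀ k, ∀ N : ℕ, 0 < N → q k ^ N ≠ 1) {f : RatFun F l m n} (hf : f ≠ 0)
    (hfix : ∀ s, gen q s f = f) {p : Poly F l m n} (hp : Irreducible p) (h : ordAt p f ≠ 0) :
    InvolvesOnly (blockT l m n) p := by
  have hinj : Function.Injective (algebraMap (Poly F l m n) (RatFun F l m n)) :=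
    IsFractionRing.injective _ _
  have key : ∀ p : Poly F l m n, Irreducible p → ordAt p f ≠ 0 →
      (∀ k, ¬ Associated p (MvPolynomial.X (Sum.inr (Sum.inr k)))) →
        InvolvesOnly (blockT l m n) p := by
    intro p hp h hX s hs hi
    rcases s with i | s
    · exact hs ⟨i, rfl⟩
    · refine h ((infOrbit_of_involves hq hp hi hX).ordAt_eq_zero hp hf fun i => ?_)
      have h1 : ∀ i : ℤ, ordAt ((genPoly q s ^ (i - 1)) p) f = ordAt ((genPoly q s ^ i) p) f := by
        intro i
        rw [← ordAt_zpow_gen q s hp hf, hfix]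
      induction i using Int.induction_on with
      | zero => simp
      | succ i ih => rw [← h1, add_sub_cancel_right, ih]
      | pred i ih => rw [h1, ih]
  -- Only `p = y_k` is left, up to a constant; its orbit is finite, so its order has to be
  -- determined by another argument.
  refine key p hp h fun k hk => ?_
  have hXirr : ∀ k : Fin n, Irreducible (MvPolynomial.X (Sum.inr (Sum.inr k)) : Poly F l m n) :=
    fun k => MvPolynomial.X_prime.irreducible
  have hXne : ∀ k : Fin n, (X (Sum.inr (Sum.inr k)) : RatFun F l m n) ≠ 0 := fun k =>
    (map_ne_zero_iff _ hinj).2 (hXirr k).ne_zero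
  set e : Fin n → ℤ := fun k =>
    ordAt (MvPolynomial.X (Sum.inr (Sum.inr k)) : Poly F l m n) f with he
  have hXass : ∀ k k' : Fin n, Associated (MvPolynomial.X (Sum.inr (Sum.inr k)) : Poly F l m n)
      (MvPolynomial.X (Sum.inr (Sum.inr k'))) → k = k' := by
    intro k k' hass
    by_contra hkk
    refine not_associated_X_of_involves (F := F) (r := Sum.inr (Sum.inr k)) ?_
      (by simpa using Ne.symm hkk) hass
    rw [Involves, MvPolynomial.pderiv_X_self]
    exact one_ne_zero
  have hzp : ∀ (p : Poly F l m n) (hp : Irreducible p) (z : RatFun F l m n) (hz : z ≠ 0) (N : ℤ),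
      ordAt p (z ^ N) = N * ordAt p z := by
    intro p hp z hz N
    induction N using Int.induction_on with
    | zero => simp [ordAt_one hp.prime]
    | succ N ih => rw [zpow_add_one₀ hz, ordAt_mul hp.prime (zpow_ne_zero _ hz) hz, ih]; ring
    | pred N ih =>
      rw [zpow_sub_one₀ hz, ordAt_mul hp.prime (zpow_ne_zero _ hz) (inv_ne_zero hz), ih,
        ordAt_inv hp.prime hz]
      ring
  set Y : RatFun F l m n := ∏ k, X (Sum.inr (Sum.inr k)) ^ e k with hY
  have hY0 : Y ≠ 0 := Finset.prod_ne_zero_iff.2 fun k _ => zpow_ne_zero _ (hXne k)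
  have hYord : ∀ p : Poly F l m n, Irreducible p → ordAt p Y =
      ∑ k, e k * multiplicity p (MvPolynomial.X (Sum.inr (Sum.inr k)) : Poly F l m n) := by
    intro p hp
    rw [hY, ordAt_prod hp.prime _ _ fun k _ => zpow_ne_zero _ (hXne k)]
    refine Finset.sum_congr rfl fun k _ => ?_
    rw [hzp p hp _ (hXne k), X, ordAt_algebraMap hp.prime (hXirr k).ne_zero]
  obtain ⟨a, ha, -, haL, hao⟩ :=
    exists_block_part ord _ _ (fun _ => algebraMap_mem_fieldT) hf
  obtain ⟨c, hc, hcf⟩ := exists_const_of_ordAt_eq_zero (div_ne_zero hf (mul_ne_zero ha hY0))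
    fun p hp => by
      rw [ordAt_div' hp.prime hf (mul_ne_zero ha hY0), ordAt_mul hp.prime ha hY0, hYord p hp]
      by_cases hex : ∃ k, Associated p (MvPolynomial.X (Sum.inr (Sum.inr k)))
      · obtain ⟨k, hk⟩ := hex
        have hnT : ¬ InvolvesOnly (blockT l m n) p := by
          intro hT
          refine hT (Sum.inr (Sum.inr k)) (by simp [blockT]) ?_
          rw [involves_congr hk, Involves, MvPolynomial.pderiv_X_self]
          exact one_ne_zero
        rw [(hao p hp).2 hnT, Finset.sum_eq_single k,
          (multiplicity_of_irreducible hp.prime (hXirr k)).1 hk, he, ordAt_congr hk]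
        · simp
        · intro k' _ hk'
          rw [(multiplicity_of_irreducible hp.prime (hXirr k')).2, Nat.cast_zero, mul_zero]
          exact fun h' => hk' (hXass _ _ (h'.symm.trans hk))
        · simp
      · push Not at hex
        rw [Finset.sum_eq_zero fun k _ => by
          rw [(multiplicity_of_irreducible hp.prime (hXirr k)).2 (hex k), Nat.cast_zero, mul_zero]]
        by_cases h0 : ordAt p f = 0
        · by_cases hT : InvolvesOnly (blockT l m n) p
          · rw [(hao p hp).1 hT, h0]; rfl
          · rw [(hao p hp).2 hT, h0]; rfl
        · rw [(hao p hp).1 (key p hp h0 hex)]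
          ring
  -- Up to a constant, `f` is its `t`-part times a monomial in `y`. Applying `τ_k` multiplies this
  -- by `q_k ^ e_k`, which must be one, so `e_k = 0`.
  have hfe : f = algebraMap F _ c * a * Y := by
    rw [div_eq_iff (mul_ne_zero ha hY0)] at hcf
    rw [hcf]
    ring
  have hc' : algebraMap F (RatFun F l m n) c ≠ 0 := by simpa using hc
  have hfk := hfix (Sum.inr k)
  rw [hfe, map_mul, map_mul, AlgEquiv.commutes, gen_fieldT q _ haL] at hfk
  have hYk := mul_left_cancel₀ (mul_ne_zero hc' ha) hfk
  have hgX : ∀ k' : Fin n, gen q (Sum.inr k) (X (Sum.inr (Sum.inr k')) : RatFun F l m n) =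
      (if k' = k then algebraMap F _ (q k : F) else 1) * X (Sum.inr (Sum.inr k')) := by
    intro k'
    by_cases hkk : k' = k
    · subst hkk
      rw [if_pos rfl, X, gen_algebraMap, genPoly, affinePoly_X, if_pos rfl, map_add, map_mul,
        MvPolynomial.C_0, map_zero, add_zero, IsScalarTower.algebraMap_apply F (Poly F l m n)]
      rfl
    · rw [if_neg hkk, one_mul]
      exact gen_X_of_ne q _ (by simpa using hkk)
  have hYk' : gen q (Sum.inr k) Y = algebraMap F _ (q k : F) ^ e k * Y := by
    rw [hY, map_prod]
    simp only [map_zpow₀, hgX, mul_zpow]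
    rw [Finset.prod_mul_distrib]
    congr 1
    rw [Finset.prod_eq_single k]
    · simp
    · intro k' _ hk'
      simp [hk']
    · simp
  rw [hYk'] at hYk
  have h1 : algebraMap F (RatFun F l m n) ((q k ^ e k : Fˣ) : F) = 1 := by
    rw [Units.val_zpow_eq_zpow_val, map_zpow₀]
    exact (mul_eq_right₀ hY0).1 hYk
  have h2 : q k ^ e k = q k ^ (0 : ℤ) := by
    rw [zpow_zero]
    exact Units.ext ((algebraMap F (RatFun F l m n)).injective (by rw [h1]; simp))
  have h3 := pow_injective_of_not_root hq k h2
  rw [ordAt_congr hk] at h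
  exact h h3

/-- All zeros and poles depend on `t` only, so `f` is its `t`-part times a constant. -/
theorem mem_fieldT_of_fixed (ord : MonomialOrder (Idx l m n)) {q : Fin n → Fˣ}
    (hq : ∀ k, ∀ N : ℕ, 0 < N → q k ^ N ≠ 1) {f : RatFun F l m n}
    (hfix : ∀ s, gen q s f = f) : f ∈ fieldT F l m n := by
  by_cases hf : f = 0
  · rw [hf]
    exact zero_mem _
  obtain ⟨a, ha, -, haL, hao⟩ :=
    exists_block_part ord _ _ (fun _ => algebraMap_mem_fieldT) hf
  obtain ⟨c, hc, hcf⟩ := exists_const_of_ordAt_eq_zero (div_ne_zero hf ha) fun p hp => by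
    rw [ordAt_div' hp.prime hf ha]
    by_cases hT : InvolvesOnly (blockT l m n) p
    · rw [(hao p hp).1 hT, sub_self]
    · rw [(hao p hp).2 hT, sub_zero]
      by_contra h0
      exact hT (involvesOnly_of_fixed ord hq hf hfix hp h0)
  rw [div_eq_iff ha] at hcf
  rw [hcf]
  exact mul_mem ((fieldT F l m n).algebraMap_mem c) haL

omit [CharZero F] in
/-- A function fixed by a dilation is not the difference of a function and its image under the
dilation, unless it vanishes. -/
theorem eq_zero_of_tau_sub {q : Fin n → Fˣ} (hq : ∀ k, ∀ N : ℕ, 0 < N → q k ^ N ≠ 1) {k : Fin n}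
    {u c : RatFun F l m n} (hc : tau q k c = c) (h : tau q k u - u = c) : c = 0 := by
  have hinj : Function.Injective (algebraMap (Poly F l m n) (RatFun F l m n)) :=
    IsFractionRing.injective _ _
  by_contra hc0
  obtain ⟨a, b, hb, rfl⟩ := exists_div u
  obtain ⟨c1, c2, hc1, hc2, rfl⟩ := exists_div_of_ne_zero (Poly F l m n) hc0
  set s : Idx l m n := Sum.inr (Sum.inr k) with hs
  set g : Poly F l m n ≃ₐ[F] Poly F l m n := genPoly q (Sum.inr k) with hg
  have hne : ∀ {z : Poly F l m n}, z ≠ 0 → algebraMap _ (RatFun F l m n) z ≠ 0 := fun hz =>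
    (map_ne_zero_iff _ hinj).2 hz
  have hgne : ∀ {z : Poly F l m n}, z ≠ 0 → g z ≠ 0 := fun hz => by simpa using hz
  rw [← gen_inr, map_div₀, gen_algebraMap, gen_algebraMap] at hc h
  rw [div_sub_div _ _ (hne (hgne hb)) (hne hb),
    div_eq_div_iff (mul_ne_zero (hne (hgne hb)) (hne hb)) (hne hc2)] at h
  rw [div_eq_div_iff (hne (hgne hc2)) (hne hc2)] at hc
  simp only [← map_mul, ← map_sub] at h hc
  have h' := congrArg (slice s) (hinj h)
  have hc' := congrArg (slice s) (hinj hc)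
  simp only [map_mul, map_sub] at h' hc'
  have hslice : ∀ z : Poly F l m n, slice s (genPoly q (Sum.inr k) z) =
      (slice s z).comp (Polynomial.C (MvPolynomial.C (q k : F)) * Polynomial.X) := by
    intro z
    rw [genPoly, slice_affinePoly_self, MvPolynomial.C_0, Polynomial.C_0, add_zero]
  have hQ : (MvPolynomial.C (q k : F) : Poly F l m n) ≠ 0 := by simp
  have hdeg : ∀ P : Polynomial (Poly F l m n),
      (P.comp (Polynomial.C (MvPolynomial.C (q k : F)) * Polynomial.X)).natDegree = P.natDegree := by
    intro P
    rw [Polynomial.natDegree_comp, Polynomial.natDegree_C_mul_X _ hQ, mul_one]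
  have hlead : ∀ P : Polynomial (Poly F l m n),
      (P.comp (Polynomial.C (MvPolynomial.C (q k : F)) * Polynomial.X)).leadingCoeff =
        P.leadingCoeff * MvPolynomial.C (q k : F) ^ P.natDegree := by
    intro P
    rw [Polynomial.leadingCoeff_comp (by rw [Polynomial.natDegree_C_mul_X _ hQ]; exact one_ne_zero),
      Polynomial.leadingCoeff_C_mul_X]
  have hsl : ∀ {z : Poly F l m n}, z ≠ 0 → slice s z ≠ 0 := fun hz h0 =>
    hz (slice_injective s (by rw [h0, map_zero]))
  rw [hslice, hslice] at hc' h'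
  have hB := hsl hb
  have hC1 := hsl hc1
  have hC2 := hsl hc2
  generalize slice s a = A at *
  generalize slice s b = B at *
  generalize slice s c1 = C1 at *
  generalize slice s c2 = C2 at *
  set κ : Polynomial (Poly F l m n) :=
    Polynomial.C (MvPolynomial.C (q k : F)) * Polynomial.X with hκ
  have hpowinj : ∀ d e : ℕ, (MvPolynomial.C (q k : F) : Poly F l m n) ^ d =
      MvPolynomial.C (q k : F) ^ e → d = e := by
    intro d e hde
    rw [← MvPolynomial.C_pow, ← MvPolynomial.C_pow] at hde
    have h1 := MvPolynomial.C_injective _ _ hde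
    have h2 : q k ^ (d : ℤ) = q k ^ (e : ℤ) := by
      rw [zpow_natCast, zpow_natCast]
      exact Units.ext (by simpa using h1)
    exact_mod_cast pow_injective_of_not_root hq k h2
  -- With `c = C1/C2`, a dilation multiplies the leading coefficient of `c` in `y_k` by `q_k` to the
  -- power of its degree; as `c` is fixed, this degree is zero.
  have hd12 : C1.natDegree = C2.natDegree := by
    have h1 := congrArg Polynomial.leadingCoeff hc'
    rw [Polynomial.leadingCoeff_mul, Polynomial.leadingCoeff_mul, hlead, hlead] at h1
    apply hpowinj
    have h2 : C1.leadingCoeff * C2.leadingCoeff ≠ 0 :=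
      mul_ne_zero (Polynomial.leadingCoeff_ne_zero.2 hC1) (Polynomial.leadingCoeff_ne_zero.2 hC2)
    apply mul_left_cancel₀ h2
    linear_combination h1
  have hBκ : B.comp κ ≠ 0 := by
    rw [← Polynomial.leadingCoeff_ne_zero, hlead]
    exact mul_ne_zero (Polynomial.leadingCoeff_ne_zero.2 hB) (pow_ne_zero _ hQ)
  set D := A.comp κ * B - B.comp κ * A with hD
  have hD0 : D ≠ 0 := by
    intro h0
    rw [h0, zero_mul] at h'
    exact mul_ne_zero hC1 (mul_ne_zero hBκ hB) h'.symm
  -- `D` is the numerator of `τ u - u` over the denominator `τ(B) B`, and `τ u - u = c` has degree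
  -- zero.
  have hDdeg : D.natDegree = 2 * B.natDegree := by
    have h1 := congrArg Polynomial.natDegree h'
    rw [Polynomial.natDegree_mul hD0 hC2, Polynomial.natDegree_mul hC1 (mul_ne_zero hBκ hB),
      Polynomial.natDegree_mul hBκ hB, hdeg] at h1
    omega
  -- With `deg A = deg B` the top coefficient of `D` cancels and its degree falls below `2 deg B`.
  -- Otherwise it does not cancel and the degree is `deg A + deg B ≠ 2 deg B`.
  have hcoeff : D.coeff (A.natDegree + B.natDegree) = A.leadingCoeff * B.leadingCoeff *
      (MvPolynomial.C (q k : F) ^ A.natDegree - MvPolynomial.C (q k : F) ^ B.natDegree) := by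
    have h1 : (A.comp κ * B).coeff (A.natDegree + B.natDegree) =
        (A.comp κ).leadingCoeff * B.leadingCoeff := by
      conv_lhs => rw [← hdeg A]
      exact Polynomial.coeff_mul_degree_add_degree _ _
    have h2 : (B.comp κ * A).coeff (A.natDegree + B.natDegree) =
        (B.comp κ).leadingCoeff * A.leadingCoeff := by
      conv_lhs => rw [← hdeg B, add_comm]
      exact Polynomial.coeff_mul_degree_add_degree _ _
    rw [hD, Polynomial.coeff_sub, h1, h2, hlead, hlead]
    ring
  have hDle : D.natDegree ≤ A.natDegree + B.natDegree := by
    refine (Polynomial.natDegree_sub_le _ _).trans (max_le ?_ ?_)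
    · exact Polynomial.natDegree_mul_le.trans (by rw [hdeg])
    · exact Polynomial.natDegree_mul_le.trans (by rw [hdeg, add_comm])
  have hA0 : A ≠ 0 := by
    rintro rfl
    simp [hD] at hD0
  by_cases hAB : A.natDegree = B.natDegree
  · rw [hAB, sub_self, mul_zero, ← two_mul, ← hDdeg, Polynomial.coeff_natDegree,
      Polynomial.leadingCoeff_eq_zero] at hcoeff
    exact hD0 hcoeff
  · have h1 : D.coeff (A.natDegree + B.natDegree) ≠ 0 := by
      rw [hcoeff]
      refine mul_ne_zero (mul_ne_zero (Polynomial.leadingCoeff_ne_zero.2 hA0)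
        (Polynomial.leadingCoeff_ne_zero.2 hB)) (sub_ne_zero.2 fun h => hAB (hpowinj _ _ h))
    have h2 := Polynomial.le_natDegree_of_ne_zero h1
    omega

/-- Structure of compatible rational functions. -/
theorem IsCompatible.exists_decomposition (ord : MonomialOrder (Idx l m n)) {q : Fin n → Fˣ}
    (hq : ∀ k, ∀ N : ℕ, 0 < N → q k ^ N ≠ 1) {u : Fin l → RatFun F l m n}
    {v : Fin m → RatFun F l m n} {w : Fin n → RatFun F l m n} (h : IsCompatible q u v w) :
    ∃ (f : RatFun F l m n) (α lam : Fin m → RatFun F l m n) (β : Fin l → RatFun F l m n)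
      (μ : Fin n → RatFun F l m n), f ≠ 0 ∧
      (∀ j, α j ∈ fieldT F l m n ∧ α j ≠ 0 ∧ IsMonicRat ord (α j)) ∧
      (∀ i, β i ∈ fieldT F l m n) ∧
      (∀ j, lam j ∈ fieldX F l m n ∧ lam j ≠ 0) ∧
      (∀ k, μ k ∈ fieldY F l m n ∧ μ k ≠ 0) ∧
      (∀ i, u i = delta i f / f + ∑ j, xVar j * (delta i (α j) / α j) + β i) ∧
      (∀ j, v j = sigma j f / f * α j * lam j) ∧
      (∀ k, w k = tau q k f / f * μ k) := by
  have hC : IsGenSystem q u (Sum.elim v w) := by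
    refine ⟨?_, ?_, ?_⟩
    · rintro (j | k)
      exacts [h.v_ne_zero j, h.w_ne_zero k]
    · rintro (j | k) (j' | k')
      · have := h.sigma_sigma j j'
        rwa [div_eq_div_iff (h.v_ne_zero _) (h.v_ne_zero _)] at this
      · have := h.sigma_tau j k'
        rwa [div_eq_div_iff (h.w_ne_zero _) (h.v_ne_zero _)] at this
      · have := h.sigma_tau j' k
        rw [div_eq_div_iff (h.w_ne_zero _) (h.v_ne_zero _)] at this
        exact this.symm
      · have := h.tau_tau k k'
        rwa [div_eq_div_iff (h.w_ne_zero _) (h.w_ne_zero _)] at this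
    · rintro i (j | k)
      exacts [h.delta_sigma i j, h.delta_tau i k]
  obtain ⟨f, hf, hmix⟩ := hC.exists_gauge hq
  have hC' := hC.gauge hf
  set U' : Fin l → RatFun F l m n := fun i => u i + delta i f / f with hU'
  set C' : Fin m ⊕ Fin n → RatFun F l m n :=
    fun s => Sum.elim v w s * (gen q s f / f) with hCd
  have hw : ∀ k, C' (Sum.inr k) ∈ fieldY F l m n := by
    intro k
    obtain ⟨a, b, d, ha, hb, hd, -, haL, hbL, hdL, hfe, hao, hbo, hbo', hdo⟩ :=
      exists_eq_mul_of_not_mixed ord (hC'.ne_zero (Sum.inr k)) fun p hp hpm => hmix p hp hpm _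
    -- The `x`-part: `τ_k` fixes every polynomial in `x`, so the commutation of `τ_k` with `σ_j`
    -- makes the order of `C'` for `τ_k` constant along infinite `σ_j`-orbits.
    have hbc : ∃ c : F, c ≠ 0 ∧ b = algebraMap F _ c := by
      refine exists_const_of_ordAt_eq_zero hb fun p hp => ?_
      by_cases hX : InvolvesOnly (blockX l m n) p
      · rw [hbo' p hp hX]
        obtain ⟨s, hs⟩ := exists_involves hp
        have hsX : s ∈ blockX l m n := by
          by_contra hsX
          exact hX s hsX hs
        obtain ⟨j, rfl⟩ := hsX
        refine hC'.ordAt_eq_zero hp (s := Sum.inl j) (infOrbit_of_involves hq hp hs fun k =>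
          not_associated_X_of_involves hs (by simp)) fun i => ?_
        have hni : ¬ Involves (Sum.inr (Sum.inr k)) ((genPoly q (Sum.inl j) ^ i) p) := by
          rw [zpow_invariant (involves_genPoly q (Sum.inr (Sum.inr k)) (Sum.inl j))]
          exact hX _ (by simp [blockX])
        congr 1
        conv_lhs => rw [← genPoly_of_not_involves q (Sum.inr k) hni]
        rw [genPoly_zpow_neg_one]
      · exact hbo p hp hX
    -- The `t`-part: its logarithmic derivative is fixed by `τ_k` and equals `τ_k(U'_i) - U'_i`,
    -- hence vanishes.
    have hac : ∃ c : F, c ≠ 0 ∧ a = algebraMap F _ c := by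
      have hδ : ∀ i, delta i a = 0 := by
        intro i
        have h1 := hC'.delta_eq i (Sum.inr k)
        rw [hfe, logDeriv_mul i (mul_ne_zero ha hb) hd, logDeriv_mul i ha hb, delta_fieldX i hbL,
          delta_fieldY i hdL, zero_div, zero_div, add_zero, add_zero] at h1
        have h2 := eq_zero_of_tau_sub hq (k := k) (c := delta i a / a)
          (by rw [← gen_inr, map_div₀, ← delta_gen, gen_fieldT q _ haL]) h1.symm
        exact (div_eq_zero_iff.1 h2).resolve_right ha
      refine exists_const_of_ordAt_eq_zero ha fun p hp => ?_
      by_cases hT : InvolvesOnly (blockT l m n) p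
      · obtain ⟨s, hs⟩ := exists_involves hp
        have hsT : s ∈ blockT l m n := by
          by_contra hsT
          exact hT s hsT hs
        obtain ⟨i, rfl⟩ := hsT
        refine ordAt_eq_zero_of_logDeriv hp hs ha (a := 0) (b := 1)
          (fun h1 => hp.not_isUnit (isUnit_of_dvd_one h1)) ?_
        rw [hδ i, zero_div, map_zero, zero_div]
      · exact hao p hp hT
    obtain ⟨c1, -, hc1⟩ := hac
    obtain ⟨c2, -, hc2⟩ := hbc
    rw [hfe, hc1, hc2]
    exact mul_mem (mul_mem ((fieldY F l m n).algebraMap_mem _)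
      ((fieldY F l m n).algebraMap_mem _)) hdL
  have hv : ∀ j, ∃ a b : RatFun F l m n, a ∈ fieldT F l m n ∧ a ≠ 0 ∧ IsMonicRat ord a ∧
      b ∈ fieldX F l m n ∧ b ≠ 0 ∧ C' (Sum.inl j) = a * b := by
    intro j
    obtain ⟨a, b, d, ha, hb, hd, ham, haL, hbL, hdL, hfe, hao, hbo, hbo', hdo⟩ :=
      exists_eq_mul_of_not_mixed ord (hC'.ne_zero (Sum.inl j)) fun p hp hpm => hmix p hp hpm _
    -- The certificate of `τ_k` is now in `F(y)` and fixed by `σ_j`, so commutation makes the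
    -- certificate of `σ_j` fixed by `τ_k`. Its `y`-part is then fixed by everything and is
    -- constant.
    have hfix : ∀ s, gen q s d = d := by
      rintro (j' | k)
      · exact sigma_fieldY j' hdL
      · have h1 := hC'.comm (Sum.inl j) (Sum.inr k)
        rw [gen_inl, sigma_fieldY j (hw k), mul_comm] at h1
        have h2 := mul_right_cancel₀ (hC'.ne_zero (Sum.inr k)) h1
        rw [hfe, map_mul, map_mul, gen_fieldT q _ haL, gen_inr, tau_fieldX q k hbL] at h2
        exact (mul_left_cancel₀ (mul_ne_zero ha hb) h2).symm
    obtain ⟨c, hc, hcd⟩ := exists_const_of_ordAt_eq_zero hd fun p hp => by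
      by_contra h0
      have hT := involvesOnly_of_fixed ord hq hd hfix hp h0
      exact h0 (hdo p hp (hT.not_of_disjoint hp disjoint_blockT_blockY))
    refine ⟨a, b * d, haL, ha, ham, mul_mem hbL ?_, mul_ne_zero hb hd, by rw [hfe, mul_assoc]⟩
    rw [hcd]
    exact (fieldX F l m n).algebraMap_mem _
  choose α lam hαL hα0 hαm hlL hl0 hvv using hv
  have hβ : ∀ i, U' i - ∑ j, xVar j * (delta i (α j) / α j) ∈ fieldT F l m n := by
    intro i
    have hfixα : ∀ (s : Fin m ⊕ Fin n) (j : Fin m),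
        gen q s (delta i (α j) / α j) = delta i (α j) / α j := by
      intro s j
      rw [map_div₀, ← delta_gen, gen_fieldT q _ (hαL j)]
    -- The sum changes under `σ_j` by `δ_i(α_j)/α_j`, exactly as `U'_i` does; neither changes under
    -- `τ_k`.
    refine mem_fieldT_of_fixed ord hq ?_
    rintro (j' | k)
    · have h1 := hC'.delta_eq i (Sum.inl j')
      rw [hvv, logDeriv_mul i (hα0 j') (hl0 j'), delta_fieldX i (hlL j'), zero_div, add_zero] at h1
      rw [map_sub, map_sum]
      simp only [map_mul, hfixα]
      simp only [gen_inl, sigma_xVar, add_mul, Finset.sum_add_distrib, ite_mul, one_mul, zero_mul,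
        Finset.sum_ite_eq', Finset.mem_univ, if_true]
      rw [h1, gen_inl]
      ring
    · have h1 := hC'.delta_eq i (Sum.inr k)
      rw [delta_fieldY i (hw k), zero_div] at h1
      rw [map_sub, map_sum]
      simp only [map_mul, hfixα]
      have hx : ∀ j, gen q (Sum.inr k) (xVar j : RatFun F l m n) = xVar j := fun j =>
        gen_X_of_ne q _ (by simp)
      simp only [hx]
      linear_combination -h1
  have hgf : ∀ s, gen q s f ≠ 0 := fun s => gen_ne_zero q s hf
  -- The gauge by `f` simplified the system; undoing it is the gauge by `f⁻¹`.
  refine ⟨f⁻¹, α, lam, fun i => U' i - ∑ j, xVar j * (delta i (α j) / α j),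
    fun k => C' (Sum.inr k), inv_ne_zero hf, fun j => ⟨hαL j, hα0 j, hαm j⟩, hβ,
    fun j => ⟨hlL j, hl0 j⟩, fun k => ⟨hw k, hC'.ne_zero _⟩, fun i => ?_, fun j => ?_, fun k => ?_⟩
  · rw [logDeriv_inv i hf]
    simp only [hU']
    ring
  · have h1 := hvv j
    simp only [hCd, Sum.elim_inl, gen_inl] at h1
    have h2 : sigma j f ≠ 0 := hgf (Sum.inl j)
    rw [mul_assoc, ← h1, map_inv₀]
    field_simp
  · have h2 : tau q k f ≠ 0 := hgf (Sum.inr k)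
    simp only [hCd, Sum.elim_inr, gen_inr]
    rw [map_inv₀]
    field_simp

end Decomposition

end MixedSystem

namespace MixedSystem

/-! ### Additive maps acting diagonally on a free module. -/

section Diagonal

variable {R R' I : Type*} [CommRing R] [CommRing R'] [Algebra R R'] (b : Module.Basis I R R')

/-- The additive map which acts on the `i`-th coordinate with respect to the basis `b` by `φ i`. -/
noncomputable def diagMap (φ : I → R →+ R) : R' →+ R' :=
  (Finsupp.liftAddHom fun i =>
    ((LinearMap.toSpanSingleton R R' (b i)).toAddMonoidHom.comp (φ i))).comp
      (b.repr.toAddEquiv : R' →+ (I →₀ R))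

theorem diagMap_smul (φ : I → R →+ R) (i : I) (r : R) :
    diagMap b φ (r • b i) = φ i r • b i := by
  simp [diagMap]

theorem basis_add_induction {P : R' → Prop} (h0 : P 0) (hadd : ∀ x y, P x → P y → P (x + y))
    (hsmul : ∀ i (r : R), P (r • b i)) (x : R') : P x := by
  rw [← b.repr.symm_apply_apply x]
  induction b.repr x using Finsupp.induction_linear with
  | zero => simpa using h0
  | add f g hf hg => rw [map_add]; exact hadd _ _ hf hg
  | single i r => rw [Module.Basis.repr_symm_single]; exact hsmul i r

theorem repr_diagMap (φ : I → R →+ R) (x : R') (i : I) :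
    b.repr (diagMap b φ x) i = φ i (b.repr x i) := by
  classical
  induction x using basis_add_induction b with
  | h0 => simp
  | hadd x y hx hy => simp [hx, hy]
  | hsmul j r =>
    rw [diagMap_smul, map_smul, map_smul, Module.Basis.repr_self]
    by_cases h : j = i
    · simp [h]
    · simp [h]

theorem diagMap_comm {φ ψ : I → R →+ R} (h : ∀ i r, φ i (ψ i r) = ψ i (φ i r)) (x : R') :
    diagMap b φ (diagMap b ψ x) = diagMap b ψ (diagMap b φ x) := by
  apply b.repr.injective
  ext i
  simp only [repr_diagMap, h]

theorem diagMap_injective {φ : I → R →+ R} (h : ∀ i, Function.Injective (φ i)) :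
    Function.Injective (diagMap b φ) := by
  intro x y hxy
  apply b.repr.injective
  ext i
  apply h i
  rw [← repr_diagMap, ← repr_diagMap, hxy]

/-- Two additive maps in two variables agree if they agree on multiples of basis vectors. -/
theorem basis_add_induction₂ {P : R' → R' → Prop} (h0 : ∀ y, P 0 y) (h0' : ∀ x, P x 0)
    (hadd : ∀ x x' y, P x y → P x' y → P (x + x') y)
    (hadd' : ∀ x y y', P x y → P x y' → P x (y + y'))
    (hsmul : ∀ i j (r s : R), P (r • b i) (s • b j)) (x y : R') : P x y := by
  induction x using basis_add_induction b with
  | h0 => exact h0 y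
  | hadd x x' hx hx' => exact hadd _ _ _ hx hx'
  | hsmul i r =>
    induction y using basis_add_induction b with
    | h0 => exact h0' _
    | hadd y y' hy hy' => exact hadd' _ _ _ hy hy'
    | hsmul j s => exact hsmul i j r s

end Diagonal

/-! ### Free extensions by solutions of powers of a system. -/

namespace DeltaExtension

universe v'

variable {F : Type*} [Field F] {l m n : ℕ} {q : Fin n → Fˣ}
  {R : Type v'} [CommRing R] [Algebra (RatFun F l m n) R]
  (D : DeltaExtension (l := l) (m := m) q R)

/-- The operators `σ_j` and `τ_k` as one family. -/
def op : Fin m ⊕ Fin n → R →+* R := Sum.elim D.σ D.τ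

theorem op_injective (s : Fin m ⊕ Fin n) : Function.Injective (D.op s) := by
  rcases s with j | k
  exacts [D.σ_injective j, D.τ_injective k]

theorem op_algebraMap (s : Fin m ⊕ Fin n) (f : RatFun F l m n) :
    D.op s (algebraMap _ R f) = algebraMap _ R (gen q s f) := by
  rcases s with j | k
  exacts [D.σ_extends j f, D.τ_extends k f]

theorem δ_op (i : Fin l) (s : Fin m ⊕ Fin n) (r : R) : D.δ i (D.op s r) = D.op s (D.δ i r) := by
  rcases s with j | k
  exacts [D.δ_σ i j r, D.δ_τ i k r]

theorem op_op (s s' : Fin m ⊕ Fin n) (r : R) : D.op s (D.op s' r) = D.op s' (D.op s r) := by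
  rcases s with j | k <;> rcases s' with j' | k'
  exacts [D.σ_σ j j' r, D.σ_τ j k' r, (D.σ_τ j' k r).symm, D.τ_τ k k' r]

/-- `r` solves the `e`-th power of the system with certificates `u` and `c`. -/
structure SolvesPow (u : Fin l → RatFun F l m n) (c : Fin m ⊕ Fin n → RatFun F l m n) (e : ℤ)
    (r : R) : Prop where
  δ_eq : ∀ i, D.δ i r = algebraMap _ R (e * u i) * r
  op_eq : ∀ s, D.op s r = algebraMap _ R (c s ^ e) * r

variable {D}
variable {u : Fin l → RatFun F l m n} {c : Fin m ⊕ Fin n → RatFun F l m n}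

theorem SolvesPow.one : D.SolvesPow u c 0 1 where
  δ_eq i := by simp
  op_eq s := by simp

theorem SolvesPow.inv (hc : ∀ s, c s ≠ 0) {e : ℤ} {r r' : R} (h : D.SolvesPow u c e r)
    (hr : r * r' = 1) : D.SolvesPow u c (-e) r' where
  δ_eq i := by
    have h1 := D.δ i |>.map_one_eq_zero
    rw [← hr, Derivation.leibniz, h.δ_eq, smul_eq_mul, smul_eq_mul] at h1
    rw [Int.cast_neg, neg_mul, map_neg]
    linear_combination r' * h1 - (D.δ i r' + algebraMap _ R (e * u i) * r') * hr
  op_eq s := by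
    have h1 := (D.op s).map_one
    rw [← hr, map_mul, h.op_eq, hr] at h1
    have h2 : algebraMap _ R (c s ^ (-e)) * algebraMap _ R (c s ^ e) = 1 := by
      rw [← map_mul, ← zpow_add₀ (hc s), neg_add_cancel, zpow_zero, map_one]
    linear_combination (algebraMap _ R (c s ^ (-e)) * r') * h1 -
      (D.op s r' * r * r') * h2 - (D.op s r') * hr

variable (D) in
/-- A free extension of `R` by solutions of powers of a system: `b i` is to solve the `e i`-th
power of the system, and the product of basis vectors is a multiple of a basis vector. -/
structure PowBasis (u : Fin l → RatFun F l m n) (c : Fin m ⊕ Fin n → RatFun F l m n)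
    {R' I : Type*} [CommRing R'] [Algebra R R'] (b : Module.Basis I R R') (e : I → ℤ) : Prop where
  mul : ∀ i j, ∃ k s, b i * b j = s • b k ∧ D.SolvesPow u c (e i + e j - e k) s
  one : ∃ i, b i = 1 ∧ e i = 0

section Extension

variable {R' I : Type*} [CommRing R'] [Algebra R R'] {b : Module.Basis I R R'} {e : I → ℤ}

variable (D) in
/-- The action of `δ_a` on the coordinates. -/
noncomputable def coordDelta (u : Fin l → RatFun F l m n) (e : I → ℤ) (a : Fin l) (i : I) :
    R →+ R :=
  (D.δ a : R →ₗ[ℤ] R).toAddMonoidHom + AddMonoidHom.mulLeft (algebraMap _ R (e i * u a))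

variable (D) in
/-- The action of the (`q`-)shift operators on the coordinates. -/
noncomputable def coordOp (c : Fin m ⊕ Fin n → RatFun F l m n) (e : I → ℤ) (s : Fin m ⊕ Fin n)
    (i : I) : R →+ R :=
  (AddMonoidHom.mulLeft (algebraMap _ R (c s ^ e i))).comp (D.op s : R →+ R)

theorem coordDelta_apply (a : Fin l) (i : I) (r : R) :
    D.coordDelta u e a i r = D.δ a r + algebraMap _ R (e i * u a) * r := rfl

theorem coordOp_apply (s : Fin m ⊕ Fin n) (i : I) (r : R) :
    D.coordOp c e s i r = algebraMap _ R (c s ^ e i) * D.op s r := rfl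

/-- In `b i * b j = z • b k` the factor `z` solves the power `e i + e j - e k`, which is exactly the
discrepancy between the weights on the two sides. The same balance makes `coordOp` multiplicative.
-/
theorem PowBasis.diag_leibniz (hb : D.PowBasis u c b e) (a : Fin l) (x y : R') :
    diagMap b (D.coordDelta u e a) (x * y) =
      x * diagMap b (D.coordDelta u e a) y + y * diagMap b (D.coordDelta u e a) x := by
  induction x, y using basis_add_induction₂ b with
  | h0 y => simp
  | h0' x => simp
  | hadd x x' y h h' => rw [add_mul, map_add, map_add, h, h']; ring
  | hadd' x y y' h h' => rw [mul_add, map_add, map_add, h, h']; ring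
  | hsmul i j r s =>
    obtain ⟨k, z, h1, h2⟩ := hb.mul i j
    have h3 : (r • b i) * (s • b j) = (r * s * z) • b k := by
      rw [smul_mul_smul_comm, h1, smul_smul]
    rw [h3, diagMap_smul, diagMap_smul, diagMap_smul, smul_mul_smul_comm, smul_mul_smul_comm,
      mul_comm (b j), h1, smul_smul, smul_smul, ← add_smul]
    congr 1
    simp only [coordDelta_apply, Derivation.leibniz, smul_eq_mul, h2.δ_eq]
    simp only [Int.cast_sub, Int.cast_add, sub_mul, add_mul, map_sub, map_add]
    ring

theorem PowBasis.diag_mul (hb : D.PowBasis u c b e) (hc : ∀ s, c s ≠ 0) (s : Fin m ⊕ Fin n)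
    (x y : R') : diagMap b (D.coordOp c e s) (x * y) =
      diagMap b (D.coordOp c e s) x * diagMap b (D.coordOp c e s) y := by
  induction x, y using basis_add_induction₂ b with
  | h0 y => simp
  | h0' x => simp
  | hadd x x' y h h' => rw [add_mul, map_add, map_add, h, h']; ring
  | hadd' x y y' h h' => rw [mul_add, map_add, map_add, h, h']; ring
  | hsmul i j r t =>
    obtain ⟨k, z, h1, h2⟩ := hb.mul i j
    have h3 : (r • b i) * (t • b j) = (r * t * z) • b k := by
      rw [smul_mul_smul_comm, h1, smul_smul]
    rw [h3, diagMap_smul, diagMap_smul, diagMap_smul, smul_mul_smul_comm, h1, smul_smul]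
    congr 1
    simp only [coordOp_apply, map_mul, h2.op_eq]
    have h4 : algebraMap _ R (c s ^ e k) * algebraMap _ R (c s ^ (e i + e j - e k)) =
        algebraMap _ R (c s ^ e i) * algebraMap _ R (c s ^ e j) := by
      rw [← map_mul, ← map_mul, ← zpow_add₀ (hc s), ← zpow_add₀ (hc s)]
      congr 2
      ring
    linear_combination (D.op s r * D.op s t * z) * h4

theorem PowBasis.algebraMap_eq (hb : D.PowBasis u c b e) :
    ∃ i, e i = 0 ∧ b i = 1 ∧ ∀ r, algebraMap R R' r = r • b i := by
  obtain ⟨i, hi, he⟩ := hb.one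
  exact ⟨i, he, hi, fun r => by rw [hi, Algebra.algebraMap_eq_smul_one]⟩

theorem PowBasis.diag_algebraMap_delta (hb : D.PowBasis u c b e) (a : Fin l) (r : R) :
    diagMap b (D.coordDelta u e a) (algebraMap R R' r) = algebraMap R R' (D.δ a r) := by
  obtain ⟨i, he, -, hi⟩ := hb.algebraMap_eq
  rw [hi, hi, diagMap_smul, coordDelta_apply, he]
  simp

theorem PowBasis.diag_algebraMap_op (hb : D.PowBasis u c b e) (s : Fin m ⊕ Fin n) (r : R) :
    diagMap b (D.coordOp c e s) (algebraMap R R' r) = algebraMap R R' (D.op s r) := by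
  obtain ⟨i, he, -, hi⟩ := hb.algebraMap_eq
  rw [hi, hi, diagMap_smul, coordOp_apply, he]
  simp

/-- The operators on the extension, as derivations. -/
noncomputable def PowBasis.der (hb : D.PowBasis u c b e) (a : Fin l) : Derivation ℤ R' R' :=
  Derivation.mk' (diagMap b (D.coordDelta u e a)).toIntLinearMap (hb.diag_leibniz a)

/-- The operators on the extension, as ring homomorphisms. -/
noncomputable def PowBasis.hom (hb : D.PowBasis u c b e) (hc : ∀ s, c s ≠ 0) (s : Fin m ⊕ Fin n) :
    R' →+* R' :=
  { diagMap b (D.coordOp c e s) with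
    map_one' := by
      have := hb.diag_algebraMap_op s 1
      simpa using this
    map_mul' := hb.diag_mul hc s }

theorem PowBasis.der_apply (hb : D.PowBasis u c b e) (a : Fin l) (x : R') :
    hb.der a x = diagMap b (D.coordDelta u e a) x := rfl

theorem PowBasis.hom_apply (hb : D.PowBasis u c b e) (hc : ∀ s, c s ≠ 0) (s : Fin m ⊕ Fin n)
    (x : R') : hb.hom hc s x = diagMap b (D.coordOp c e s) x := rfl

/-- On a single coordinate, commutation of the operators is the compatibility of the `e i`-th power
of the system. -/
theorem coordDelta_comm (hu : ∀ a a', delta a (u a') = delta a' (u a)) (a a' : Fin l) (i : I)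
    (r : R) : D.coordDelta u e a i (D.coordDelta u e a' i r) =
      D.coordDelta u e a' i (D.coordDelta u e a i r) := by
  have h1 : ∀ a a', delta a ((e i : RatFun F l m n) * u a') = e i * delta a (u a') := by
    intro a a'
    rw [Derivation.leibniz, Derivation.map_intCast]
    simp
  simp only [coordDelta_apply, map_add, Derivation.leibniz, smul_eq_mul, D.δ_extends, h1, hu a a',
    D.δ_δ a a' r]
  ring

theorem coordDelta_coordOp (hC : IsGenSystem q u c) (a : Fin l) (s : Fin m ⊕ Fin n) (i : I)
    (r : R) : D.coordDelta u e a i (D.coordOp c e s i r) =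
      D.coordOp c e s i (D.coordDelta u e a i r) := by
  have h1 : delta a (c s ^ e i) = c s ^ e i * (e i * gen q s (u a) - e i * u a) := by
    have h2 := hC.delta_eq a s
    rw [div_eq_iff (hC.ne_zero s)] at h2
    rw [Derivation.leibniz_zpow, h2, zpow_sub_one₀ (hC.ne_zero s)]
    have := hC.ne_zero s
    simp only [smul_eq_mul, zsmul_eq_mul]
    field_simp
  simp only [coordDelta_apply, coordOp_apply, map_add, Derivation.leibniz, smul_eq_mul,
    D.δ_extends, h1, D.δ_op, map_mul (D.op s), D.op_algebraMap, map_sub, map_mul (algebraMap _ R),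
    map_intCast]
  ring

theorem coordOp_comm (hC : IsGenSystem q u c) (s s' : Fin m ⊕ Fin n) (i : I)
    (r : R) : D.coordOp c e s i (D.coordOp c e s' i r) =
      D.coordOp c e s' i (D.coordOp c e s i r) := by
  have h1 : algebraMap _ R (c s ^ e i) * algebraMap _ R (gen q s (c s' ^ e i)) =
      algebraMap _ R (c s' ^ e i) * algebraMap _ R (gen q s' (c s ^ e i)) := by
    rw [← map_mul, ← map_mul, map_zpow₀, map_zpow₀, ← mul_zpow, ← mul_zpow, mul_comm,
      hC.comm s s', mul_comm]
  simp only [coordOp_apply, map_mul, D.op_algebraMap, D.op_op s s' r]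
  linear_combination (D.op s' (D.op s r)) * h1

theorem coordOp_injective (hc : ∀ s, c s ≠ 0) (s : Fin m ⊕ Fin n) (i : I) :
    Function.Injective (D.coordOp c e s i) := by
  intro r r' h
  rw [coordOp_apply, coordOp_apply] at h
  exact D.op_injective s ((((isUnit_iff_ne_zero.2 (zpow_ne_zero (e i) (hc s))).map (algebraMap _ R)).mul_left_cancel h))

theorem PowBasis.algebraMap_injective (hb : D.PowBasis u c b e) :
    Function.Injective (algebraMap R R') := by
  obtain ⟨i, -, -, hi⟩ := hb.algebraMap_eq
  intro r r' h
  rw [hi, hi] at h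
  have := congrArg (fun x => b.repr x i) h
  simpa using this

variable [Algebra (RatFun F l m n) R'] [IsScalarTower (RatFun F l m n) R R']

theorem algebraMap_mul_eq_smul (f : RatFun F l m n) (x : R') :
    algebraMap _ R' f * x = algebraMap _ R f • x := by
  rw [IsScalarTower.algebraMap_apply _ R R', ← Algebra.smul_def]

/-- The extension of the operators to `R'`. -/
noncomputable def PowBasis.extension (hb : D.PowBasis u c b e) (hC : IsGenSystem q u c)
    (hu : ∀ a a', delta a (u a') = delta a' (u a)) : DeltaExtension (l := l) (m := m) q R' where
  algebraMap_injective := by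
    rw [IsScalarTower.algebraMap_eq (RatFun F l m n) R R']
    exact hb.algebraMap_injective.comp D.algebraMap_injective
  δ := hb.der
  σ j := hb.hom hC.ne_zero (Sum.inl j)
  τ k := hb.hom hC.ne_zero (Sum.inr k)
  σ_injective j := diagMap_injective b (coordOp_injective hC.ne_zero _)
  τ_injective k := diagMap_injective b (coordOp_injective hC.ne_zero _)
  δ_extends a f := by
    rw [IsScalarTower.algebraMap_apply _ R R', hb.der_apply, hb.diag_algebraMap_delta,
      D.δ_extends, ← IsScalarTower.algebraMap_apply]
  σ_extends j f := by
    rw [IsScalarTower.algebraMap_apply _ R R', hb.hom_apply, hb.diag_algebraMap_op,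
      D.op_algebraMap, ← IsScalarTower.algebraMap_apply]
    rfl
  τ_extends k f := by
    rw [IsScalarTower.algebraMap_apply _ R R', hb.hom_apply, hb.diag_algebraMap_op,
      D.op_algebraMap, ← IsScalarTower.algebraMap_apply]
    rfl
  δ_δ a a' x := diagMap_comm b (coordDelta_comm hu a a') x
  δ_σ a j x := diagMap_comm b (coordDelta_coordOp hC a _) x
  δ_τ a k x := diagMap_comm b (coordDelta_coordOp hC a _) x
  σ_σ j j' x := diagMap_comm b (coordOp_comm hC _ _) x
  σ_τ j k x := diagMap_comm b (coordOp_comm hC _ _) x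
  τ_τ k k' x := diagMap_comm b (coordOp_comm hC _ _) x

variable (hb : D.PowBasis u c b e) (hC : IsGenSystem q u c)
  (hu : ∀ a a', delta a (u a') = delta a' (u a))

theorem PowBasis.extension_δ (a : Fin l) (x : R') :
    (hb.extension hC hu).δ a x = diagMap b (D.coordDelta u e a) x := rfl

theorem PowBasis.extension_op (s : Fin m ⊕ Fin n) (x : R') :
    (hb.extension hC hu).op s x = diagMap b (D.coordOp c e s) x := by
  rcases s with j | k <;> rfl

theorem PowBasis.isEmbedding :
    D.IsEmbedding (hb.extension hC hu) (IsScalarTower.toAlgHom (RatFun F l m n) R R') where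
  injective := hb.algebraMap_injective
  map_δ a r := (hb.diag_algebraMap_delta a r).symm
  map_σ j r := (hb.diag_algebraMap_op (Sum.inl j) r).symm
  map_τ k r := (hb.diag_algebraMap_op (Sum.inr k) r).symm

theorem PowBasis.solvesPow_smul (i : I) {r : R} (hr : D.SolvesPow u c (1 - e i) r) :
    (hb.extension hC hu).SolvesPow u c 1 (r • b i) where
  δ_eq a := by
    rw [hb.extension_δ, diagMap_smul, coordDelta_apply, hr.δ_eq,
      algebraMap_mul_eq_smul (R := R) _ (r • b i), smul_smul, ← add_mul, ← map_add]
    congr 3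
    push_cast
    ring
  op_eq s := by
    rw [hb.extension_op, diagMap_smul, coordOp_apply, hr.op_eq,
      algebraMap_mul_eq_smul (R := R) _ (r • b i), smul_smul, ← mul_assoc, ← map_mul,
      ← zpow_add₀ (hC.ne_zero s)]
    congr 4
    ring

/-- The operators are diagonal, so each nonzero coordinate of an `H`-solution is an `H`-solution of
`R`, hence a unit. The ratio of two of them would solve the power `e j - e i` of the system, which
`hind` forbids for `i ≠ j`. So every `H`-solution is a unit of `R` times one basis vector. -/
theorem PowBasis.isPVType (hD : D.IsPVType) (hunit : ∀ i, IsUnit (b i))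
    (hind : ∀ i j r, IsUnit r → D.SolvesPow u c (e i - e j) r → i = j) :
    (hb.extension hC hu).IsPVType := by
  obtain ⟨i0, he0, hi0, hA⟩ := hb.algebraMap_eq
  have key : ∀ (u' : Fin l → RatFun F l m n) (c' : Fin m ⊕ Fin n → RatFun F l m n) (x : R'),
      (∀ s, c' s ≠ 0) → x ≠ 0 →
      (∀ a, (hb.extension hC hu).δ a x = algebraMap _ R' (u' a) * x) →
      (∀ s, (hb.extension hC hu).op s x = algebraMap _ R' (c' s) * x) →
      ∃ i, ∃ r : R, IsUnit r ∧ x = r • b i ∧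
        (∀ a, D.δ a r = algebraMap _ R (u' a - e i * u a) * r) ∧
        ∀ s, D.op s r = algebraMap _ R (c' s * c s ^ (-e i)) * r := by
    intro u' c' x hc' hx hδ hop
    have h1 : ∀ i a, D.δ a (b.repr x i) = algebraMap _ R (u' a - e i * u a) * b.repr x i := by
      intro i a
      have h2 := congrArg (fun z => b.repr z i) (hδ a)
      simp only [hb.extension_δ, repr_diagMap, coordDelta_apply,
        algebraMap_mul_eq_smul (R := R) (R' := R'), map_smul, Finsupp.smul_apply,
        smul_eq_mul] at h2
      rw [map_sub]
      linear_combination h2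
    have h2 : ∀ i s, D.op s (b.repr x i) = algebraMap _ R (c' s * c s ^ (-e i)) * b.repr x i := by
      intro i s
      have h2 := congrArg (fun z => b.repr z i) (hop s)
      simp only [hb.extension_op, repr_diagMap, coordOp_apply,
        algebraMap_mul_eq_smul (R := R) (R' := R'), map_smul, Finsupp.smul_apply,
        smul_eq_mul] at h2
      have h3 : algebraMap _ R (c s ^ (-e i)) * algebraMap _ R (c s ^ e i) = 1 := by
        rw [← map_mul, ← zpow_add₀ (hC.ne_zero s), neg_add_cancel, zpow_zero, map_one]
      rw [map_mul]
      linear_combination algebraMap _ R (c s ^ (-e i)) * h2 - D.op s (b.repr x i) * h3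
    have h3 : ∀ i, b.repr x i ≠ 0 → IsUnit (b.repr x i) := fun i hi => hD.isUnit _
      ⟨_, fun j => c' (Sum.inl j) * c (Sum.inl j) ^ (-e i),
        fun k => c' (Sum.inr k) * c (Sum.inr k) ^ (-e i), D.hasCertificates_of_ne_zero hi
          ⟨h1 i, fun j => h2 i (Sum.inl j), fun k => h2 i (Sum.inr k)⟩⟩
    obtain ⟨i, hi⟩ : ∃ i, b.repr x i ≠ 0 := by
      by_contra! h0
      exact hx (b.repr.injective (by ext i; simpa using h0 i))
    refine ⟨i, b.repr x i, h3 i hi, ?_, h1 i, h2 i⟩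
    have h4 : ∀ j, j ≠ i → b.repr x j = 0 := by
      intro j hj
      by_contra hxj
      obtain ⟨z, hz⟩ := (h3 j hxj).exists_right_inv
      -- The certificates of `x` cancel in the ratio of the coordinates; only the powers of `u` and
      -- `c` remain.
      refine hj (hind j i (b.repr x i * z) ((h3 i hi).mul (IsUnit.of_mul_eq_one_right _ hz)) ?_)
      have hzδ : ∀ a, D.δ a z = -(algebraMap _ R (u' a - e j * u a)) * z := by
        intro a
        have h5 := D.δ a |>.map_one_eq_zero
        rw [← hz, Derivation.leibniz, h1, smul_eq_mul, smul_eq_mul] at h5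
        linear_combination z * h5 - (D.δ a z + algebraMap _ R (u' a - e j * u a) * z) * hz
      have hzop : ∀ s, algebraMap _ R (c' s * c s ^ (-e j)) * D.op s z = z := by
        intro s
        have h5 := (D.op s).map_one
        rw [← hz, map_mul, h2, hz] at h5
        linear_combination z * h5 - algebraMap _ R (c' s * c s ^ (-e j)) * D.op s z * hz
      refine ⟨fun a => ?_, fun s => ?_⟩
      · rw [Derivation.leibniz, h1, hzδ, smul_eq_mul, smul_eq_mul]
        simp only [Int.cast_sub, sub_mul, map_sub]
        ring
      · have h6 : algebraMap _ R (c s ^ (e j - e i)) * algebraMap _ R (c' s * c s ^ (-e j)) =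
            algebraMap _ R (c' s * c s ^ (-e i)) := by
          rw [← map_mul, mul_left_comm, ← zpow_add₀ (hC.ne_zero s)]
          congr 3
          ring
        rw [map_mul, h2, ← h6]
        linear_combination algebraMap _ R (c s ^ (e j - e i)) * b.repr x i * hzop s
    apply b.repr.injective
    ext j
    rw [map_smul, Module.Basis.repr_self]
    by_cases hj : j = i
    · simp [hj]
    · simp [h4 j hj, Ne.symm hj]
  refine ⟨fun x hx => ?_, ?_⟩
  · by_cases hx0 : x = 0
    · exact ⟨0, by simp [hx0]⟩
    obtain ⟨i, r, hr, hxr, h1, h2⟩ := key 0 1 x (fun _ => one_ne_zero) hx0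
      (fun a => by simp [hx.1 a]) (fun s => by
        rcases s with j | k
        · simpa [op] using hx.2.1 j
        · simpa [op] using hx.2.2 k)
    -- The coefficient of a nonzero constant solves the power `0 - e i`, so the constant lies on the
    -- basis vector `1` and comes from `R`.
    have hi : i0 = i := by
      refine hind i0 i r hr ⟨fun a => ?_, fun s => ?_⟩
      · rw [h1 a, he0]
        simp
      · rw [h2 s, he0]
        simp
    subst hi
    obtain ⟨d, hd⟩ := hD.constants r ⟨fun a => by simp [h1 a, he0],
      fun j => by simpa [he0, op] using h2 (Sum.inl j), fun k => by simpa [he0, op] using h2 (Sum.inr k)⟩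
    refine ⟨d, ?_⟩
    rw [hxr, ← hA, hd, ← IsScalarTower.algebraMap_apply]
  · rintro x ⟨u', v', w', hx⟩
    obtain ⟨i, r, hr, hxr, -⟩ := key u' (Sum.elim v' w') x
      (by rintro (j | k); exacts [hx.compatible.v_ne_zero j, hx.compatible.w_ne_zero k])
      hx.ne_zero hx.isSolution.δ_eq
      (by rintro (j | k); exacts [hx.isSolution.σ_eq j, hx.isSolution.τ_eq k])
    rw [hxr, Algebra.smul_def]
    exact (hr.map _).mul (hunit i)

end Extension

end DeltaExtension

end MixedSystem

namespace MixedSystem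

/-! ### Adjoining an invertible solution. -/

namespace DeltaExtension

universe v'

variable {F : Type*} [Field F] {l m n : ℕ} {q : Fin n → Fˣ}
  {R : Type v'} [CommRing R] [Algebra (RatFun F l m n) R]
  {D : DeltaExtension (l := l) (m := m) q R}
  {u : Fin l → RatFun F l m n} {c : Fin m ⊕ Fin n → RatFun F l m n}

theorem nontrivial (D : DeltaExtension (l := l) (m := m) q R) : Nontrivial R :=
  D.algebraMap_injective.nontrivial

theorem ne_zero_of_isUnit (D : DeltaExtension (l := l) (m := m) q R) {z : R} (hz : IsUnit z) : z ≠ 0 :=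
  have := D.nontrivial
  hz.ne_zero

variable (D u c) in
/-- Laurent polynomials over `R` as an extension by a transcendental solution. -/
theorem powBasis_laurent :
    D.PowBasis u c (AddMonoidAlgebra.basis ℤ R) (id : ℤ → ℤ) where
  mul i j := ⟨i + j, 1, by
    simp only [AddMonoidAlgebra.basis_apply, AddMonoidAlgebra.single_mul_single, mul_one,
      one_smul], by simpa using SolvesPow.one⟩
  one := ⟨0, rfl, rfl⟩

/-- The extension of `R` by a `k`-th root of `r` as an extension by an algebraic solution. -/
theorem powBasis_root {k : ℕ} (hk : 0 < k) {r : R} (hr : D.SolvesPow u c k r)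
    (hg : (Polynomial.X ^ k - Polynomial.C r : Polynomial R).Monic) :
    D.PowBasis u c (AdjoinRoot.powerBasis' hg).basis (fun i => ((i : ℕ) : ℤ)) where
  mul i j := by
    have := D.nontrivial
    have hdeg : (AdjoinRoot.powerBasis' hg).dim = k := Polynomial.natDegree_X_pow_sub_C
    simp only [PowerBasis.coe_basis]
    by_cases h : (i : ℕ) + j < k
    · refine ⟨⟨i + j, by omega⟩, 1, ?_, ?_⟩
      · rw [one_smul, ← pow_add]
      · simpa using SolvesPow.one
    -- Exponents of at least `k` are reduced by `gen ^ k = r`, and `r` solves the `k`-th power.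
    · refine ⟨⟨i + j - k, by have := i.2; have := j.2; omega⟩, r, ?_, ?_⟩
      · have h1 : (AdjoinRoot.powerBasis' hg).gen ^ k = algebraMap R _ r := by
          have h2 := AdjoinRoot.eval₂_root (Polynomial.X ^ k - Polynomial.C r : Polynomial R)
          rw [Polynomial.eval₂_sub, Polynomial.eval₂_C, Polynomial.eval₂_pow, Polynomial.eval₂_X,
            sub_eq_zero] at h2
          exact h2
        rw [Algebra.smul_def, ← h1, ← pow_add, ← pow_add]
        congr 1
        simp only
        omega
      · convert hr using 1
        simp only
        omega
  one := by
    have := D.nontrivial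
    have hdeg : (AdjoinRoot.powerBasis' hg).dim = k := Polynomial.natDegree_X_pow_sub_C
    exact ⟨⟨0, by rw [hdeg]; exact hk⟩, by simp, by simp⟩

theorem PowBasis.exists_extension {R' : Type v'} {I : Type*} [CommRing R'] [Algebra R R']
    {b : Module.Basis I R R'} {e : I → ℤ} (hb : D.PowBasis u c b e) (hC : IsGenSystem q u c)
    (hu : ∀ a a', delta a (u a') = delta a' (u a)) (hunit : ∀ i, IsUnit (b i))
    (hind : D.IsPVType → ∀ i j r, IsUnit r → D.SolvesPow u c (e i - e j) r → i = j)
    (i : I) {r : R} (hr : IsUnit r) (hrs : D.SolvesPow u c (1 - e i) r) :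
    ∃ (R' : Type v') (_ : CommRing R') (_ : Algebra (RatFun F l m n) R')
      (D' : DeltaExtension (l := l) (m := m) q R') (ι : R →ₐ[RatFun F l m n] R'),
      D.IsEmbedding D' ι ∧ (D.IsPVType → D'.IsPVType) ∧
        ∃ z : R', IsUnit z ∧ D'.SolvesPow u c 1 z := by
  let _ : Algebra (RatFun F l m n) R' :=
    ((algebraMap R R').comp (algebraMap (RatFun F l m n) R)).toAlgebra
  have : IsScalarTower (RatFun F l m n) R R' := IsScalarTower.of_algebraMap_eq' rfl
  refine ⟨R', inferInstance, inferInstance, hb.extension hC hu, _, hb.isEmbedding hC hu,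
    fun hD => hb.isPVType hC hu hD hunit (hind hD), r • b i, ?_, hb.solvesPow_smul hC hu i hrs⟩
  rw [Algebra.smul_def]
  exact (hr.map _).mul (hunit i)

/-- Every compatible system has an invertible solution in some extension, which can be taken of
Picard-Vessiot type if the given extension is. -/
theorem exists_adjoin (D : DeltaExtension (l := l) (m := m) q R) (hC : IsGenSystem q u c)
    (hu : ∀ a a', delta a (u a') = delta a' (u a)) :
    ∃ (R' : Type v') (_ : CommRing R') (_ : Algebra (RatFun F l m n) R')
      (D' : DeltaExtension (l := l) (m := m) q R') (ι : R →ₐ[RatFun F l m n] R'),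
      D.IsEmbedding D' ι ∧ (D.IsPVType → D'.IsPVType) ∧
        ∃ z : R', IsUnit z ∧ D'.SolvesPow u c 1 z := by
  classical
  have := D.nontrivial
  -- If a unit `r` of `R` already solves the `k`-th power of the system, a transcendental solution
  -- `z` would create the new constant `z^k / r`. A `k`-th root of `r` is adjoined instead, with `k`
  -- minimal. In all other cases Laurent polynomials do.
  by_cases hex : D.IsPVType ∧ ∃ k : ℕ, 0 < k ∧ ∃ r : R, IsUnit r ∧ D.SolvesPow u c k r
  · obtain ⟨hD, hex⟩ := hex
    set k := Nat.find hex with hkdef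
    obtain ⟨hk, r, hru, hr⟩ := Nat.find_spec hex
    have hmin : ∀ k' : ℕ, 0 < k' → (∃ r : R, IsUnit r ∧ D.SolvesPow u c k' r) → k ≤ k' :=
      fun k' h1 h2 => Nat.find_min' hex ⟨h1, h2⟩
    rw [← hkdef] at hk hr
    clear_value k
    have hg : (Polynomial.X ^ k - Polynomial.C r : Polynomial R).Monic :=
      Polynomial.monic_X_pow_sub_C r hk.ne'
    have hb := powBasis_root hk hr hg
    set pb := AdjoinRoot.powerBasis' hg with hpb
    have hdim : pb.dim = k := Polynomial.natDegree_X_pow_sub_C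
    have hgen : pb.gen ^ k = algebraMap R _ r := by
      have h2 := AdjoinRoot.eval₂_root (Polynomial.X ^ k - Polynomial.C r : Polynomial R)
      rw [Polynomial.eval₂_sub, Polynomial.eval₂_C, Polynomial.eval₂_pow, Polynomial.eval₂_X,
        sub_eq_zero] at h2
      exact h2
    have hunit : IsUnit pb.gen := by
      rw [← isUnit_pow_iff hk.ne', hgen]
      exact hru.map _
    have hunit' : ∀ i, IsUnit (pb.basis i) := fun i => by
      rw [PowerBasis.coe_basis]
      exact hunit.pow _
    -- Exponents differ by less than `k`; a unit solving the power `i - j`, or its inverse, would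
    -- contradict the minimality of `k`.
    have hind : D.IsPVType → ∀ (i j : Fin pb.dim) (s : R), IsUnit s →
        D.SolvesPow u c (((i : ℕ) : ℤ) - ((j : ℕ) : ℤ)) s → i = j := by
      intro _ i j s hs h
      have hi := i.2
      have hj := j.2
      obtain ⟨s', hs'⟩ := hs.exists_right_inv
      rcases lt_trichotomy (i : ℕ) (j : ℕ) with hij | hij | hij
      · have := hmin (j - i) (by omega) ⟨s', IsUnit.of_mul_eq_one_right _ hs', by
          have := h.inv hC.ne_zero hs'
          convert this using 1
          omega⟩
        omega
      · exact Fin.ext hij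
      · have := hmin (i - j) (by omega) ⟨s, hs, by
          convert h using 1
          omega⟩
        omega
    -- For `k = 1` the basis is just `1` and the solution is `r` itself; for `k > 1` it is the
    -- generator.
    by_cases hk1 : k = 1
    · refine hb.exists_extension hC hu hunit' hind ⟨0, by omega⟩ hru ?_
      convert hr using 1
      simp [hk1]
    · refine hb.exists_extension hC hu hunit' hind ⟨1, by omega⟩ isUnit_one ?_
      simpa using SolvesPow.one
  · have hb := powBasis_laurent D u c
    have hunit : ∀ i, IsUnit (AddMonoidAlgebra.basis ℤ R i) := by
      intro i
      refine IsUnit.of_mul_eq_one (AddMonoidAlgebra.basis ℤ R (-i)) ?_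
      rw [AddMonoidAlgebra.basis_apply, AddMonoidAlgebra.basis_apply,
        AddMonoidAlgebra.single_mul_single, mul_one, add_neg_cancel]
      rfl
    refine hb.exists_extension hC hu hunit (fun hD i j s hs h => ?_) 1 isUnit_one
      (by simpa using SolvesPow.one)
    by_contra hij
    obtain ⟨s', hs'⟩ := hs.exists_right_inv
    refine hex ⟨hD, (i - j).natAbs, Int.natAbs_pos.2 (sub_ne_zero.2 hij), ?_⟩
    rcases lt_or_gt_of_ne hij with hlt | hlt
    · refine ⟨s', IsUnit.of_mul_eq_one_right _ hs', ?_⟩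
      have := h.inv hC.ne_zero hs'
      convert this using 1
      simp only [id]
      omega
    · refine ⟨s, hs, ?_⟩
      convert h using 1
      simp only [id]
      omega

theorem IsEmbedding.comp {R' R'' : Type*} [CommRing R'] [Algebra (RatFun F l m n) R']
    [CommRing R''] [Algebra (RatFun F l m n) R''] {D' : DeltaExtension (l := l) (m := m) q R'}
    {D'' : DeltaExtension (l := l) (m := m) q R''} {ι : R →ₐ[RatFun F l m n] R'}
    {ι' : R' →ₐ[RatFun F l m n] R''} (h' : D'.IsEmbedding D'' ι') (h : D.IsEmbedding D' ι) :
    D.IsEmbedding D'' (ι'.comp ι) where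
  injective := h'.injective.comp h.injective
  map_δ i r := by simp [h.map_δ, h'.map_δ]
  map_σ i r := by simp [h.map_σ, h'.map_σ]
  map_τ i r := by simp [h.map_τ, h'.map_τ]

theorem IsEmbedding.map_op {R' : Type*} [CommRing R'] [Algebra (RatFun F l m n) R']
    {D' : DeltaExtension (l := l) (m := m) q R'} {ι : R →ₐ[RatFun F l m n] R'}
    (h : D.IsEmbedding D' ι) (s : Fin m ⊕ Fin n) (r : R) : ι (D.op s r) = D'.op s (ι r) := by
  rcases s with j | k
  exacts [h.map_σ j r, h.map_τ k r]

theorem IsEmbedding.solvesPow {R' : Type*} [CommRing R'] [Algebra (RatFun F l m n) R']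
    {D' : DeltaExtension (l := l) (m := m) q R'} {ι : R →ₐ[RatFun F l m n] R'}
    (h : D.IsEmbedding D' ι) {e : ℤ} {r : R} (hr : D.SolvesPow u c e r) :
    D'.SolvesPow u c e (ι r) where
  δ_eq a := by rw [← h.map_δ, hr.δ_eq, map_mul, AlgHom.commutes]
  op_eq s := by rw [← h.map_op, hr.op_eq, map_mul, AlgHom.commutes]

theorem SolvesPow.mul_system {u' : Fin l → RatFun F l m n} {c' : Fin m ⊕ Fin n → RatFun F l m n}
    {r r' : R} (h : D.SolvesPow u c 1 r) (h' : D.SolvesPow u' c' 1 r') :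
    D.SolvesPow (fun a => u a + u' a) (fun s => c s * c' s) 1 (r * r') where
  δ_eq a := by
    rw [Derivation.leibniz, h.δ_eq, h'.δ_eq]
    simp only [smul_eq_mul, Int.cast_one, one_mul, map_add]
    ring
  op_eq s := by
    rw [map_mul, h.op_eq, h'.op_eq]
    simp only [zpow_one, map_mul]
    ring

theorem SolvesPow.of_algebraMap {f : RatFun F l m n} (hf : f ≠ 0) :
    D.SolvesPow (fun a => delta a f / f) (fun s => gen q s f / f) 1 (algebraMap _ R f) where
  δ_eq a := by
    rw [D.δ_extends, ← map_mul, Int.cast_one, one_mul, div_mul_cancel₀ _ hf]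
  op_eq s := by
    rw [D.op_algebraMap, ← map_mul, zpow_one, div_mul_cancel₀ _ hf]

/-- It identifies the certificates of a quotient by an invertible solution. -/
theorem SolvesPow.cancel {u' : Fin l → RatFun F l m n} {c' : Fin m ⊕ Fin n → RatFun F l m n}
    {g r : R} (hg : IsUnit g) (hc : ∀ s, c s ≠ 0) (h : D.SolvesPow u c 1 g)
    (h' : D.SolvesPow (fun a => u a + u' a) (fun s => c s * c' s) 1 (g * r)) :
    D.SolvesPow u' c' 1 r where
  δ_eq a := by
    have h1 := h'.δ_eq a
    rw [Derivation.leibniz, h.δ_eq] at h1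
    simp only [smul_eq_mul, Int.cast_one, one_mul, map_add] at h1 ⊢
    apply hg.mul_left_cancel
    linear_combination h1
  op_eq s := by
    have h1 := h'.op_eq s
    rw [map_mul, h.op_eq] at h1
    simp only [zpow_one, map_mul] at h1 ⊢
    apply (((isUnit_iff_ne_zero.2 (hc s)).map (algebraMap _ R)).mul hg).mul_left_cancel
    linear_combination h1

theorem SolvesPow.hasCertificates {v : Fin m → RatFun F l m n} {w : Fin n → RatFun F l m n} {r : R}
    (h : D.SolvesPow u (Sum.elim v w) 1 r) (hr : r ≠ 0) : D.HasCertificates u v w r :=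
  D.hasCertificates_of_ne_zero hr
    ⟨fun a => by simpa using h.δ_eq a, fun j => by simpa [op] using h.op_eq (Sum.inl j),
      fun k => by simpa [op] using h.op_eq (Sum.inr k)⟩

theorem HasCertificates.solvesPow {v : Fin m → RatFun F l m n} {w : Fin n → RatFun F l m n} {r : R}
    (h : D.HasCertificates u v w r) : D.SolvesPow u (Sum.elim v w) 1 r where
  δ_eq a := by simpa using h.isSolution.δ_eq a
  op_eq s := by
    rcases s with j | k
    · simpa [op] using h.isSolution.σ_eq j
    · simpa [op] using h.isSolution.τ_eq k

end DeltaExtension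

/-! ### Compatibility of the systems of the factors. -/

section Systems

variable {F : Type*} [Field F] {l m n : ℕ}

theorem delta_comm (i j : Fin l) (f : RatFun F l m n) :
    delta i (delta j f) = delta j (delta i f) := by
  have h : ∀ p : Poly F l m n, ⁅(delta i : Derivation F (RatFun F l m n) _), delta j⁆
      (algebraMap _ (RatFun F l m n) p) = 0 := by
    intro p
    rw [Derivation.commutator_apply, delta_algebraMap, delta_algebraMap, delta_algebraMap,
      delta_algebraMap, sub_eq_zero]
    congr 1
    have h1 : ⁅(MvPolynomial.pderiv (Sum.inl i) : Derivation F (Poly F l m n) (Poly F l m n)),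
        (MvPolynomial.pderiv (Sum.inl j) : Derivation F (Poly F l m n) (Poly F l m n))⁆ = 0 := by
      apply MvPolynomial.derivation_ext
      intro s
      rw [Derivation.commutator_apply, MvPolynomial.pderiv_X, MvPolynomial.pderiv_X,
        Derivation.zero_apply]
      simp only [Pi.single_apply]
      split_ifs <;> simp
    have h2 := congrArg (fun d => d p) h1
    simpa [Derivation.commutator_apply, sub_eq_zero] using h2
  have h3 : ⁅(delta i : Derivation F (RatFun F l m n) _), delta j⁆ f = 0 := by
    obtain ⟨a, b, hb, rfl⟩ := exists_div f
    rw [Derivation.leibniz_div, h, h]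
    simp
  rwa [Derivation.commutator_apply, sub_eq_zero] at h3

theorem delta_logDeriv_comm (i j : Fin l) (f : RatFun F l m n) :
    delta i (delta j f / f) = delta j (delta i f / f) := by
  rw [Derivation.leibniz_div, Derivation.leibniz_div, delta_comm i j]
  simp only [smul_eq_mul]
  ring

theorem delta_symbolicPower_comm (α : Fin m → RatFun F l m n) (i i' : Fin l) :
    delta i (∑ j, xVar j * (delta i' (α j) / α j)) =
      delta i' (∑ j, xVar j * (delta i (α j) / α j)) := by
  rw [map_sum, map_sum]
  refine Finset.sum_congr rfl fun j _ => ?_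
  have hx : ∀ i : Fin l, delta i (xVar j : RatFun F l m n) = 0 := fun i => delta_X_of_ne i (by simp)
  rw [Derivation.leibniz, Derivation.leibniz, hx, hx, delta_logDeriv_comm]
  simp

/-- All operators fix `F(t)`, and the shift `x_j ↦ x_j + 1` adds exactly `δ_i(α_j)/α_j` to the sum.
-/
theorem isGenSystem_symbolicPower (q : Fin n → Fˣ) {α : Fin m → RatFun F l m n}
    (hα : ∀ j, α j ∈ fieldT F l m n ∧ α j ≠ 0) :
    IsGenSystem q (fun i => ∑ j, xVar j * (delta i (α j) / α j)) (Sum.elim α fun _ => 1) where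
  ne_zero := by
    rintro (j | k)
    exacts [(hα j).2, one_ne_zero]
  comm := by
    have h : ∀ s r : Fin m ⊕ Fin n, gen q s (Sum.elim α (fun _ => 1) r : RatFun F l m n) =
        Sum.elim α (fun _ => 1) r := by
      rintro s (j | k)
      exacts [gen_fieldT q s (hα j).1, map_one _]
    intro s r
    rw [h, h, mul_comm]
  delta_eq i s := by
    have hfix : ∀ (s : Fin m ⊕ Fin n) (j : Fin m),
        gen q s (delta i (α j) / α j) = delta i (α j) / α j := by
      intro s j
      rw [map_div₀, ← delta_gen, gen_fieldT q _ (hα j).1]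
    rw [map_sum]
    simp only [map_mul, hfix]
    rcases s with j' | k
    · simp only [gen_inl, sigma_xVar, add_mul, Finset.sum_add_distrib, ite_mul, one_mul, zero_mul,
        Finset.sum_ite_eq', Finset.mem_univ, if_true, Sum.elim_inl]
      ring
    · have hx : ∀ j, gen q (Sum.inr k) (xVar j : RatFun F l m n) = xVar j := fun j =>
        gen_X_of_ne q _ (by simp)
      simp [hx]

theorem isGenSystem_of_fieldT (q : Fin n → Fˣ) {β : Fin l → RatFun F l m n}
    (hβ : ∀ i, β i ∈ fieldT F l m n) :
    IsGenSystem q β (Sum.elim (fun _ => 1) fun _ => 1) where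
  ne_zero := by rintro (j | k) <;> exact one_ne_zero
  comm := by rintro (j | k) (j' | k') <;> simp
  delta_eq i s := by
    rw [gen_fieldT q s (hβ i)]
    rcases s with j | k <;> simp

theorem isGenSystem_of_fieldX (q : Fin n → Fˣ) {lam : Fin m → RatFun F l m n}
    (hlam : ∀ j, lam j ∈ fieldX F l m n ∧ lam j ≠ 0)
    (h : ∀ j j', sigma j (lam j') * lam j = sigma j' (lam j) * lam j') :
    IsGenSystem q (fun _ => 0) (Sum.elim lam fun _ => 1) where
  ne_zero := by
    rintro (j | k)
    exacts [(hlam j).2, one_ne_zero]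
  comm := by
    rintro (j | k) (j' | k')
    · exact h j j'
    · simp [gen_inr, tau_fieldX q k' (hlam j).1]
    · simp [gen_inr, tau_fieldX q k (hlam j').1]
    · simp
  delta_eq i s := by
    rcases s with j | k
    · simp [delta_fieldX i (hlam j).1]
    · simp

end Systems

end MixedSystem

/-! ### Assembly of the factorization. -/

open MixedSystem MixedSystem.DeltaExtension in
theorem mainTheorem2 {F : Type u} [Field F] [CharZero F] [IsAlgClosed F] {l m n : ℕ}
    (q : Fin n → Fˣ) (hq : ∀ k, ∀ N : ℕ, 0 < N → q k ^ N ≠ 1)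
    (ord : MonomialOrder (MixedSystem.Idx l m n))
    {R : Type v} [CommRing R] [Algebra (MixedSystem.RatFun F l m n) R]
    (D : MixedSystem.DeltaExtension (l := l) (m := m) q R) (h : R) (hh : D.IsHSolution h) :
    ∃ (R' : Type v) (_ : CommRing R') (_ : Algebra (MixedSystem.RatFun F l m n) R')
      (D' : MixedSystem.DeltaExtension (l := l) (m := m) q R')
      (ι : R →ₐ[MixedSystem.RatFun F l m n] R'),
      D.IsEmbedding D' ι ∧ (D.IsPVType → D'.IsPVType) ∧
      ∃ (c : F) (f : MixedSystem.RatFun F l m n) (P E G Q : R'),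
        c ≠ 0 ∧ D'.IsSymbolicPower ord P ∧ D'.IsESolution E ∧ D'.IsGSolution G ∧
        D'.IsQSolution Q ∧
        ι h = algebraMap (MixedSystem.RatFun F l m n) R' (algebraMap F _ c) *
          algebraMap (MixedSystem.RatFun F l m n) R' f * P * E * G * Q := by
  obtain ⟨u, v, w, hcert⟩ := hh
  obtain ⟨f, α, lam, β, μ, hf, hα, hβ, hlam, hμ, hu, hv, hw⟩ :=
    hcert.compatible.exists_decomposition ord hq
  have hα' : ∀ j, α j ∈ fieldT F l m n ∧ α j ≠ 0 := fun j => ⟨(hα j).1, (hα j).2.1⟩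
  -- The other two summands of `u` satisfy the symmetry condition by themselves, so it is inherited
  -- by `β`.
  have hβcomm : ∀ i i', delta i (β i') = delta i' (β i) := by
    intro i i'
    have h1 := hcert.compatible.delta_delta i i'
    rw [hu, hu, map_add, map_add, map_add, map_add, delta_logDeriv_comm,
      delta_symbolicPower_comm] at h1
    exact add_left_cancel h1
  have hlamcomm : ∀ j j', sigma j (lam j') * lam j = sigma j' (lam j) * lam j' := by
    intro j j'
    have h1 := hcert.compatible.sigma_sigma j j'
    rw [div_eq_div_iff (hcert.compatible.v_ne_zero _) (hcert.compatible.v_ne_zero _), hv, hv] at h1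
    have hT : ∀ (j j' : Fin m), sigma j (α j') = α j' := fun j j' =>
      gen_fieldT q (Sum.inl j) (hα j').1
    have hcomm : sigma j (sigma j' f) = sigma j' (sigma j f) :=
      gen_comm q (Sum.inl j) (Sum.inl j') f
    simp only [map_mul, map_div₀, hT, hcomm] at h1
    have h2 : sigma j f ≠ 0 := by simpa using hf
    have h3 : sigma j' f ≠ 0 := by simpa using hf
    have h4 : sigma j' (sigma j f) ≠ 0 := by simpa using hf
    have h5 := (hα j).2.1
    have h6 := (hα j').2.1
    field_simp at h1
    linear_combination h1
  obtain ⟨R₁, _, _, D₁, ι₁, hι₁, hPV₁, P, hP, hPs⟩ :=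
    D.exists_adjoin (isGenSystem_symbolicPower q hα') (delta_symbolicPower_comm α)
  obtain ⟨R₂, _, _, D₂, ι₂, hι₂, hPV₂, E, hE, hEs⟩ :=
    D₁.exists_adjoin (isGenSystem_of_fieldT q hβ) hβcomm
  obtain ⟨R₃, _, _, D₃, ι₃, hι₃, hPV₃, G, hG, hGs⟩ :=
    D₂.exists_adjoin (isGenSystem_of_fieldX q hlam hlamcomm) (by simp)
  have hemb := hι₃.comp (hι₂.comp hι₁)
  have hPs' := hι₃.solvesPow (hι₂.solvesPow hPs)
  have hEs' := hι₃.solvesPow hEs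
  have hP' : IsUnit (ι₃ (ι₂ P)) := (hP.map ι₂).map ι₃
  have hE' : IsUnit (ι₃ E) := hE.map ι₃
  have hf' : IsUnit (algebraMap (RatFun F l m n) R₃ f) := (isUnit_iff_ne_zero.2 hf).map _
  have hg := ((hf'.mul hP').mul hE').mul hG
  have hgs := (((SolvesPow.of_algebraMap (D := D₃) hf).mul_system hPs').mul_system hEs').mul_system hGs
  obtain ⟨g', hg'⟩ := hg.exists_right_inv
  have hhs := hemb.solvesPow hcert.solvesPow
  set g := algebraMap (RatFun F l m n) R₃ f * ι₃ (ι₂ P) * ι₃ E * G with hgdef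
  have hgQ : g * (g' * ι₃ (ι₂ (ι₁ h))) = ι₃ (ι₂ (ι₁ h)) := by
    rw [← mul_assoc, hg', one_mul]
  have hh0 : ι₃ (ι₂ (ι₁ h)) ≠ 0 := (map_ne_zero_iff _ hemb.injective).2 hcert.ne_zero
  -- `Q` is the quotient of `h` by the unit `g = f P E G`; cancelling the certificates of `g` from
  -- those of `h` leaves `0`, `1`, `μ`.
  have hQs : D₃.SolvesPow (fun _ => 0) (Sum.elim (fun _ => 1) μ) 1
      (g' * ι₃ (ι₂ (ι₁ h))) := by
    refine SolvesPow.cancel hg ?_ hgs ?_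
    · intro s
      have h1 := gen_ne_zero q s hf
      rcases s with j | k
      · exact mul_ne_zero (mul_ne_zero (mul_ne_zero (div_ne_zero h1 hf) (hα j).2.1) one_ne_zero)
          (hlam j).2
      · exact mul_ne_zero (mul_ne_zero (mul_ne_zero (div_ne_zero h1 hf) one_ne_zero) one_ne_zero)
          one_ne_zero
    · rw [hgQ]
      convert hhs using 1
      · funext i
        rw [hu]
        ring
      · funext s
        rcases s with j | k
        · simp only [Sum.elim_inl, hv, mul_one]
          rfl
        · simp only [Sum.elim_inr, hw, mul_one]
          rfl
      · rfl
  -- The constant can be taken to be one, since `Q` was defined as the exact quotient.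
  refine ⟨R₃, inferInstance, inferInstance, D₃, _, hemb, fun hD => hPV₃ (hPV₂ (hPV₁ hD)), 1, f,
    ι₃ (ι₂ P), ι₃ E, G, g' * ι₃ (ι₂ (ι₁ h)), one_ne_zero,
    ⟨α, hα, hPs'.hasCertificates (D₃.ne_zero_of_isUnit hP')⟩,
    ⟨β, hβ, hEs'.hasCertificates (D₃.ne_zero_of_isUnit hE')⟩,
    ⟨lam, hlam, hGs.hasCertificates (D₃.ne_zero_of_isUnit hG)⟩,
    ⟨μ, hμ, hQs.hasCertificates ?_⟩, ?_⟩
  · intro h0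
    rw [h0, mul_zero] at hgQ
    exact hh0 hgQ.symm
  · rw [map_one, map_one, one_mul]
    exact hgQ.symm
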